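/- Let $1\le d\le n$, let $(\Omega,\mathcal F,\mathbb P)$ be a probability space, and let $X_1,\dots,X_n$ be independent (not necessarily identically distributed) random elements with values in measurable spaces $(E_1,\mathcal E_1),\dots,(E_n,\mathcal E_n)$. Let $f:\prod_{j}E_j\to\mathbb R$ be measurable and let $W=f(X_1,\dots,X_n)\in L^4(\mathbb P)$ with $\mathbb E[W]=0$ and $\mathbb E[W^2]=1$. For $J\subseteq[n]=\{1,\dots,n\}$ put $\mathcal F_J=\sigma(X_j:j\in J)$, and let $W=\sum_{J\subseteq[n]}W_J$ be the (almost surely unique) Hoeffding decomposition of $W$: each $W_J$ is integrable and $\mathcal F_J$-measurable, and $\mathbb E[W_J\mid\mathcal F_K]=0$ almost surely whenever $J\not\subseteq K$. Assume that $W$ is a degenerate $U$-statistic of order $d$, i.e. $W_K=0$ almost surely whenever $|K|\ne d$. Put $$\rho_n^2=\max_{1\le i\le n}\ \sum_{K\subseteq[n]:\,|K|=d,\ i\in K}\operatorname{Var}(W_K),\qquad \rho_n=\sqrt{\rho_n^2}.$$ Constant. Let $\mathcal T_d$ be the class of all quadruples $(J_1,J_2,J_3,J_4)$ of $d$-subsets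 of some $\{1,\dots,m\}$, $m\ge 1$, such that every element of $J_1\cup J_2\cup J_3\cup J_4$ lies in at least two of the four sets and some element lies in at least three of them. The shadow of such a quadruple, with union $\{i_1<\dots<i_r\}$, is the quadruple $(F_1,F_2,F_3,F_4)$ of subsets of $\{1,\dots,r\}$ given by $F_l=\{a: i_a\in J_l\}$; here $d\le r\le 2d-1$. Two shadows of the same size $r$ are equivalent if some permutation $\sigma$ of $\{1,\dots,r\}$ maps $F_l$ to $F_l'$ for $l=1,2,3,4$, and $\gamma(F)$ is the number of permutations of $\{1,\dots,r\}$ with $\sigma(F_l)=F_l$ for $l=1,2,3,4$. Let $$C_d=d!\,(d-1)!\sum_{F}\frac1{\gamma(F)},\qquad \kappa_d=C_d+2d,$$ where $F$ runs through a complete system of pairwise non-equivalent shadows of quadruples in $\mathcal T_d$. Thus $\kappa_d$ is finite and depends only on $d$. Let $Z\sim N(0,1)$ and let $d_{\rm Wass}(W,Z)=\sup_h|\mathbb E[h(W)]-\mathbb E[h(Z)]|$, the supremum being over all $1$-Lipschitz functions $h:\mathbb R\to\mathbb R$. Then $\mathbb E[W^4]-3+\kappa_d\rho_n^2\ge0$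 and $2(\mathbb E[W^4]-3)+3\kappa_d\rho_n^2\ge 0$, and $$\begin{aligned}d_{\rm Wass}(W,Z)&\le\sqrt{\tfrac2\pi}\,\bigl(\mathbb E[W^4]-3+\kappa_d\rho_n^2\bigr)^{1/2}+\tfrac{2\sqrt2}{3}\bigl(2(\mathbb E[W^4]-3)+3\kappa_d\rho_n^2\bigr)^{1/2}\\&\le\Bigl(\sqrt{\tfrac2\pi}+\tfrac43\Bigr)\sqrt{|\mathbb E[W^4]-3|}+\sqrt{\kappa_d}\,\Bigl(\sqrt{\tfrac2\pi}+\tfrac{2\sqrt2}{\sqrt3}\Bigr)\rho_n.\end{aligned}$$ -/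

import Mathlib

open MeasureTheory ProbabilityTheory

noncomputable section

/-- The 1-Wasserstein distance between the laws of `X` (under `P`) and `Y` (under `Q`), i.e. the
supremum of `|E[h(X)] - E[h(Y)]|` over all 1-Lipschitz `h : ℝ → ℝ`, as an extended nonnegative
real number. It is meant for integrable `X` and `Y`. -/
def wassersteinDist {Ω Ω' : Type*} [MeasurableSpace Ω] [MeasurableSpace Ω']
    (P : Measure Ω) (X : Ω → ℝ) (Q : Measure Ω') (Y : Ω' → ℝ) : ENNReal :=
  ⨆ (h : ℝ → ℝ) (_ : LipschitzWith 1 h),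
    ENNReal.ofReal |(∫ ω, h (X ω) ∂P) - ∫ ω, h (Y ω) ∂Q|

section Hoeffding

variable {Ω : Type*} {n : ℕ} {E : Fin n → Type*} [∀ i, MeasurableSpace (E i)]

/-- The σ-algebra `F_J = σ(X_j, j ∈ J)`. -/
@[reducible] def coordSigma (X : ∀ i, Ω → E i) (J : Finset (Fin n)) : MeasurableSpace Ω :=
  ⨆ j ∈ J, MeasurableSpace.comap (X j) inferInstance

/-- The family `(W_J)`, indexed by the subsets `J` of the index set, is a Hoeffding decomposition
of `W` with respect to `X_1, …, X_n`: every `W_J` is integrable and `F_J`-measurable, `W` is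
almost surely the sum of all `W_J`, and `E[W_J | F_K] = 0` almost surely whenever `J ⊄ K`. -/
structure IsHoeffdingDecomposition [MeasurableSpace Ω] (P : Measure Ω) (X : ∀ i, Ω → E i)
    (W : Ω → ℝ) (WJ : Finset (Fin n) → Ω → ℝ) : Prop where
  integrable : ∀ J, Integrable (WJ J) P
  measurable : ∀ J, Measurable[coordSigma X J] (WJ J)
  ae_eq_sum : W =ᵐ[P] fun ω => ∑ J, WJ J ω
  condExp_eq_zero : ∀ J K, ¬ J ⊆ K → P[WJ J | coordSigma X K] =ᵐ[P] 0

/-- `W` is a degenerate U-statistic of order `d` with Hoeffding decomposition `(W_J)`: the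
components `W_K` with `|K| ≠ d` vanish almost surely. -/
structure IsDegenerateUStatistic [MeasurableSpace Ω] (P : Measure Ω) (X : ∀ i, Ω → E i) (d : ℕ)
    (W : Ω → ℝ) (WJ : Finset (Fin n) → Ω → ℝ) : Prop
    extends IsHoeffdingDecomposition P X W WJ where
  ae_eq_zero : ∀ K, K.card ≠ d → WJ K =ᵐ[P] 0

/-- The maximal influence `ρ_n² = max_i ∑_{|K| = d, i ∈ K} Var(W_K)`. -/
def maxInfluence [MeasurableSpace Ω] (P : Measure Ω) (d : ℕ) (WJ : Finset (Fin n) → Ω → ℝ) : ℝ :=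
  ⨆ i : Fin n, ∑ K ∈ Finset.univ.filter (fun K : Finset (Fin n) => K.card = d ∧ i ∈ K),
    variance (WJ K) P

end Hoeffding

section Constant

/-- The number of `l` with `j ∈ J_l`, for a quadruple `(J_1, J_2, J_3, J_4)` of subsets of
`{1, …, n}`. -/
def multiplicity4 {n : ℕ} (J : Fin 4 → Finset (Fin n)) (j : Fin n) : ℕ :=
  (Finset.univ.filter (fun l => j ∈ J l)).card

/-- A free index is an element of exactly one of the four sets. -/
def HasFreeIndex {n : ℕ} (J : Fin 4 → Finset (Fin n)) : Prop :=
  ∃ j, multiplicity4 J j = 1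

/-- A quadruple is bifold if each element of the union lies in exactly two of the four sets. -/
def IsBifold {n : ℕ} (J : Fin 4 → Finset (Fin n)) : Prop :=
  ∀ j, (∃ l, j ∈ J l) → multiplicity4 J j = 2

/-- The class `𝒯_d` of quadruples of `d`-subsets that are neither bifold nor have a free index. -/
structure IsTQuadruple (d : ℕ) {n : ℕ} (J : Fin 4 → Finset (Fin n)) : Prop where
  card_eq : ∀ l, (J l).card = d
  not_bifold : ¬ IsBifold J
  not_free : ¬ HasFreeIndex J

/-- A `d`-shadow of size `r`: four `d`-subsets of `{1, …, r}` with union `{1, …, r}`, where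
`d ≤ r ≤ 2d - 1`. -/
structure IsShadow (d r : ℕ) (F : Fin 4 → Finset (Fin r)) : Prop where
  le_size : d ≤ r
  size_lt : r < 2 * d
  card_eq : ∀ l, (F l).card = d
  union_eq : ∀ a, ∃ l, a ∈ F l

/-- The shadow `F` of size `r` is induced by the quadruple `J`: if `i_1 < … < i_r` are the elements
of the union of the `J_l` (the increasing map `e` below), then `a ∈ F_l ↔ i_a ∈ J_l`. -/
def IsInducedBy {r n : ℕ} (F : Fin 4 → Finset (Fin r)) (J : Fin 4 → Finset (Fin n)) : Prop :=
  ∃ e : Fin r ↪o Fin n, (∀ i, i ∈ Set.range e ↔ ∃ l, i ∈ J l) ∧ ∀ l a, a ∈ F l ↔ e a ∈ J l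

/-- The `d`-shadows of size `r` that are induced by some quadruple in `𝒯_d` (over some `n`). -/
def TShadow (d r : ℕ) : Type :=
  {F : Fin 4 → Finset (Fin r) // IsShadow d r F ∧
    ∃ (n : ℕ) (J : Fin 4 → Finset (Fin n)), IsTQuadruple d J ∧ IsInducedBy F J}

/-- Two shadows of size `r` are equivalent if a permutation of `{1, …, r}` maps one to the other. -/
instance shadowSetoid (d r : ℕ) : Setoid (TShadow d r) where
  r F G := ∃ s : Equiv.Perm (Fin r), ∀ l, G.1 l = (F.1 l).map s.toEmbedding
  iseqv :=
    { refl := fun F => ⟨Equiv.refl _, fun l => by ext a; simp⟩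
      symm := by
        rintro F G ⟨s, hs⟩
        refine ⟨s.symm, fun l => ?_⟩
        rw [hs l]
        ext a
        simp
      trans := by
        rintro F G H ⟨s, hs⟩ ⟨t, ht⟩
        refine ⟨s.trans t, fun l => ?_⟩
        rw [ht l, hs l, Finset.map_map]
        rfl }

/-- `γ(F)`: the number of permutations of `{1, …, r}` that fix each of the four sets. -/
def stabCard {r : ℕ} (F : Fin 4 → Finset (Fin r)) : ℕ :=
  (Finset.univ.filter
    (fun s : Equiv.Perm (Fin r) => ∀ l, (F l).map s.toEmbedding = F l)).card

instance tShadowFinite (d r : ℕ) : Finite (TShadow d r) :=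
  Subtype.finite

instance tShadowClassFintype (d r : ℕ) : Fintype (Quotient (shadowSetoid d r)) :=
  Fintype.ofFinite _

/-- `C_d = d! (d-1)! ∑ γ(F)⁻¹`, the sum over a complete system of pairwise non-equivalent
`d`-shadows that are induced by quadruples in `𝒯_d`. -/
def constC (d : ℕ) : ℝ :=
  (d.factorial : ℝ) * ((d - 1).factorial : ℝ) *
    ∑ r ∈ Finset.Icc d (2 * d - 1), ∑ c : Quotient (shadowSetoid d r),
      ((stabCard c.out.1 : ℕ) : ℝ)⁻¹

/-- `κ_d = C_d + 2d`. -/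
def constKappa (d : ℕ) : ℝ := constC d + 2 * d

end Constant

end

/-!
The proof is Stein's method for an exchangeable pair, followed by a lower bound for a fourth-order
moment. Write `E_i` for the conditional expectation given all coordinates except the `i`-th, and
`L = ∑ i, (1 - E_i)` for the number operator. By the Hoeffding decomposition, a variable all of
whose components have order `k` is an eigenvector of `L` with eigenvalue `k`; in particular
`L W = d W`.

*Stein's method.* For a `1`-Lipschitz `h` Stein's equation `f'(x) - x f(x) = h(x) - E h(Z)` has a
solution with `|f'| ≤ 1` and `f'` `2`-Lipschitz (`SteinEquation.exists_solution`). Resampling the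
`i`-th coordinate gives an exchangeable pair. Expanding `f` along it by the trapezoidal rule,
which exchangeability permits, and summing over `i` by the Cauchy–Schwarz inequality
(`abs_stein_coord_le`, `abs_stein_eigen_le`) yields
`|E h(W) - E h(Z)| ≤ √(E Γ² - 1) + (√2 / 2) √B` with the Stein kernel `Γ = W² - L(W²) / 2d`, which
has mean `1`. Here `4 d B` bounds the sum over `i` of the fourth moments of the increments, which
is `8 d E W⁴ - 6 E[W² L(W²)]`.

*Reduction to one moment.* Split `W² = T + R`, where `T` is the sum of the products `w_J w_K` with
disjoint `J`, `K`. Then `L T = 2 d T`, the sum `R` of the other products is orthogonal to `T`, and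
the spectrum of `L` on the components of `R` lies in `[0, 2d]` (`numberOp_bounds`). Hence
`E Γ² ≤ E R² = E W⁴ - E T²` and `E[W² L(W²)] ≥ 2 d E T²` (`IsDegenerateFamily.square_bounds`), so
both quantities in Stein's bound are controlled as soon as `E T² ≥ 2 - κ_d ρ_n²`.

*The lower bound for `E T²`.* The mixed moment `E[w_J w_K w_J' w_K']` with `J ∩ K = J' ∩ K' = ∅`
vanishes unless `J ∪ K = J' ∪ K'`, and then `J = A ∪ B`, `K = C ∪ D`, `J' = A ∪ C`, `K' = B ∪ D`
for pairwise disjoint blocks. If two of the blocks are empty the terms add up to twice the sum of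
`Var(w_J) Var(w_K)` over disjoint `J`, `K`. If all blocks are nonempty, the moment is `E[g_B g_C]`
with `g_B = E[w_{A ∪ B} w_{B ∪ D} | F_{A ∪ D}]`. The sum of `E[g_B g_C]` over *all* `B`, `C` is a
second moment, hence nonnegative, and the terms with overlapping `B`, `C` that have to be removed
from it are bounded by products of variances with overlapping index sets, which the maximal
influence controls (`IsDegenerateFamily.two_sub_le_integral_sq`). This costs
`d ∑_{1 ≤ j ≤ d-1} choose (d-1) j ^ 2 + 2 d` times `ρ_n²`, which is at most `κ_d ρ_n²`: the
shadows on `2d - 1` points with one point in all four sets and every other point in two of them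
already contribute the first summand to `C_d` (`le_constC`).
-/

/-! ### Stein's equation for Lipschitz test functions -/

namespace SteinEquation
open Set Filter Topology Real

/-- The unnormalised standard Gaussian density. -/
noncomputable def psi (x : ℝ) : ℝ := Real.exp (-x ^ 2 / 2)

/-- The unnormalised Gaussian upper tail. -/
noncomputable def tail (w : ℝ) : ℝ := ∫ x in Ioi w, psi x

/-- The total mass of `psi`, that is `√(2π)`. -/
noncomputable def mass : ℝ := ∫ x, psi x

/-- The unnormalised value of `E (Z - w)⁺` for a standard Gaussian `Z`. -/
noncomputable def excess (w : ℝ) : ℝ := psi w - w * tail w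

lemma psi_pos (x : ℝ) : 0 < psi x := Real.exp_pos _

lemma psi_neg (x : ℝ) : psi (-x) = psi x := by simp [psi]

lemma hasDerivAt_psi (x : ℝ) : HasDerivAt psi (-x * psi x) x := by
  have h : HasDerivAt (fun x : ℝ => -x ^ 2 / 2) (-x) x := by
    have := ((hasDerivAt_pow 2 x).neg).div_const 2
    exact this.congr_deriv (by norm_num; ring)
  exact h.exp.congr_deriv (by simp only [psi]; ring)

lemma continuous_psi : Continuous psi := by unfold psi; fun_prop

lemma integrable_pow_mul_psi (k : ℕ) : Integrable (fun x => x ^ k * psi x) := by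
  have := integrable_rpow_mul_exp_neg_mul_sq (b := 1 / 2) (by norm_num) (s := k)
    (by have : (0 : ℝ) ≤ k := by positivity
        linarith)
  refine this.congr (Eventually.of_forall fun x => ?_)
  simp only [psi, Real.rpow_natCast]
  congr 2; ring

lemma integrable_psi : Integrable psi := by simpa using integrable_pow_mul_psi 0

lemma integrable_id_mul_psi : Integrable (fun x => x * psi x) := by
  simpa using integrable_pow_mul_psi 1

lemma tendsto_psi_cocompact (k : ℕ) :
    Tendsto (fun x => x ^ k * psi x) (cocompact ℝ) (𝓝 0) := by
  have := tendsto_rpow_abs_mul_exp_neg_mul_sq_cocompact (a := 1 / 2) (by norm_num) (k : ℝ)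
  rw [tendsto_zero_iff_norm_tendsto_zero]
  refine this.congr fun x => ?_
  simp only [psi, Real.rpow_natCast, norm_mul, norm_pow, Real.norm_eq_abs, Real.abs_exp]
  congr 2; ring

lemma mass_pos : 0 < mass := by
  unfold mass
  refine (integral_pos_iff_support_of_nonneg (fun x => (psi_pos x).le) integrable_psi).2 ?_
  have : Function.support psi = univ := by
    ext x; simp [(psi_pos x).ne']
  rw [this]; simp

lemma tail_pos (w : ℝ) : 0 < tail w := by
  unfold tail
  rw [setIntegral_pos_iff_support_of_nonneg_ae
    (Eventually.of_forall fun x => (psi_pos x).le) integrable_psi.integrableOn]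
  have : Function.support psi = univ := by
    ext x; simp [(psi_pos x).ne']
  rw [this]; simp

lemma integral_Ioi_id_mul_psi (w : ℝ) : ∫ x in Ioi w, x * psi x = psi w := by
  have h := integral_Ioi_of_hasDerivAt_of_tendsto (a := w) (f := fun x => -psi x)
    (f' := fun x => x * psi x) (m := 0) continuous_psi.neg.continuousWithinAt
    (fun x _ => (hasDerivAt_psi x).neg.congr_deriv (by ring)) integrable_id_mul_psi.integrableOn
    (by simpa using ((tendsto_psi_cocompact 0).mono_left atTop_le_cocompact).neg)
  rw [h]; simp

lemma integral_Ioi_sq_mul_psi (w : ℝ) : ∫ x in Ioi w, x ^ 2 * psi x = w * psi w + tail w := by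
  have h := integral_Ioi_of_hasDerivAt_of_tendsto (a := w) (f := fun x => -(x * psi x))
    (f' := fun x => x ^ 2 * psi x - psi x) (m := 0)
    (by have := continuous_psi; fun_prop)
    (fun x _ => ((hasDerivAt_id x).mul (hasDerivAt_psi x)).neg.congr_deriv
      (by simp only [id]; ring)) ((integrable_pow_mul_psi 2).sub integrable_psi).integrableOn
    (by simpa using ((tendsto_psi_cocompact 1).mono_left atTop_le_cocompact).neg)
  rw [integral_sub (integrable_pow_mul_psi 2).integrableOn integrable_psi.integrableOn] at h
  unfold tail
  linarith

lemma integral_Iic_psi (w : ℝ) : ∫ x in Iic w, psi x = tail (-w) := by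
  unfold tail
  rw [← integral_comp_neg_Iic]
  simp [psi_neg]

lemma tail_add_tail_neg (w : ℝ) : tail w + tail (-w) = mass := by
  rw [← integral_Iic_psi, add_comm]
  exact intervalIntegral.integral_Iic_add_Ioi integrable_psi.integrableOn
    integrable_psi.integrableOn

lemma integral_Iic_id_mul_psi (w : ℝ) : ∫ x in Iic w, x * psi x = -psi w := by
  have := integral_comp_neg_Iic w (fun x => x * psi x)
  simp only [psi_neg, neg_mul, integral_neg, integral_Ioi_id_mul_psi] at this
  linarith

lemma integral_Ioi_quadratic (w a b c : ℝ) :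
    ∫ x in Ioi w, (a * x ^ 2 + b * x + c) * psi x
      = a * (w * psi w + tail w) + b * psi w + c * tail w := by
  have h1 := ((integrable_pow_mul_psi 2).const_mul a).integrableOn (s := Ioi w)
  have h2 := (integrable_id_mul_psi.const_mul b).integrableOn (s := Ioi w)
  have h3 := (integrable_psi.const_mul c).integrableOn (s := Ioi w)
  rw [← integral_Ioi_sq_mul_psi, ← integral_Ioi_id_mul_psi]
  unfold tail
  have h12 : IntegrableOn (fun x => a * (x ^ 2 * psi x) + b * (x * psi x)) (Ioi w) := h1.add h2
  rw [← integral_const_mul, ← integral_const_mul, ← integral_const_mul, ← integral_add h1 h2,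
    ← integral_add h12 h3]
  congr 1; ext x; ring

/-- The unnormalised value of `E ((Z - w)⁺)²` is nonnegative. -/
lemma tail_sub_nonneg (w : ℝ) : 0 ≤ tail w - w * excess w := by
  have h := integral_Ioi_quadratic w 1 (-2 * w) (w ^ 2)
  have h2 : 0 ≤ ∫ x in Ioi w, (1 * x ^ 2 + (-2 * w) * x + w ^ 2) * psi x :=
    setIntegral_nonneg measurableSet_Ioi fun x _ =>
      mul_nonneg (by nlinarith [sq_nonneg (x - w)]) (psi_pos x).le
  unfold excess
  nlinarith

lemma excess_eq_integral (w : ℝ) : excess w = ∫ x in Ioi w, (x - w) * psi x := by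
  have h := integral_Ioi_quadratic w 0 1 (-w)
  unfold excess
  rw [show (fun x => (x - w) * psi x) = fun x => (0 * x ^ 2 + 1 * x + -w) * psi x by
    ext x; ring, h]
  ring

lemma excess_neg_eq_integral (w : ℝ) : excess (-w) = ∫ x in Iic w, (w - x) * psi x := by
  rw [excess_eq_integral, ← integral_comp_neg_Iic]
  refine integral_congr_ae (Eventually.of_forall fun x => ?_)
  simp only [psi_neg]; ring

lemma excess_nonneg (w : ℝ) : 0 ≤ excess w := by
  rw [excess_eq_integral]
  exact setIntegral_nonneg measurableSet_Ioi fun x hx =>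
    mul_nonneg (by simpa using le_of_lt hx) (psi_pos x).le

lemma excess_neg (w : ℝ) : excess (-w) = excess w + w * mass := by
  rw [← tail_add_tail_neg w]; unfold excess; rw [psi_neg]; ring

/-- Cauchy–Schwarz for `(Z - w)⁺` on the event `Z > w`, which amounts to Birnbaum's lower bound
for the Gaussian tail. -/
lemma psi_sq_le (w : ℝ) : psi w ^ 2 ≤ tail w ^ 2 + w * psi w * tail w := by
  have hQ := tail_pos w
  -- `t` is the conditional mean of `Z - w` given `Z > w`; integrate `(x - (w + t))²`
  set t := excess w / tail w with ht
  have h := integral_Ioi_quadratic w 1 (-2 * (w + t)) ((w + t) ^ 2)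
  have h2 : 0 ≤ ∫ x in Ioi w, (1 * x ^ 2 + (-2 * (w + t)) * x + (w + t) ^ 2) * psi x :=
    setIntegral_nonneg measurableSet_Ioi fun x _ =>
      mul_nonneg (by nlinarith [sq_nonneg (x - (w + t))]) (psi_pos x).le
  rw [h] at h2
  have h3 : t * tail w = excess w := by rw [ht]; field_simp
  have h4 : w + t = psi w / tail w := by
    rw [ht, excess]; field_simp; ring
  rw [h4] at h2
  have h5 : 0 ≤ tail w * (1 * (w * psi w + tail w) + -2 * (psi w / tail w) * psi w
    + (psi w / tail w) ^ 2 * tail w) := mul_nonneg hQ.le h2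
  have h6 : tail w * (1 * (w * psi w + tail w) + -2 * (psi w / tail w) * psi w
    + (psi w / tail w) ^ 2 * tail w) = w * psi w * tail w + tail w ^ 2 - psi w ^ 2 := by
    field_simp; ring
  linarith

/-- `E|Z - w| ≤ √(1 + w²)`. -/
lemma excess_add_excess_neg_le (w : ℝ) :
    excess w + excess (-w) ≤ mass * √(1 + w ^ 2) := by
  -- integrate `(|x - w| - t)²`, whose two halves are computed separately
  set t := √(1 + w ^ 2) with ht
  have htpos : 0 < t := by rw [ht]; positivity
  have htsq : t ^ 2 = 1 + w ^ 2 := Real.sq_sqrt (by positivity)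
  have h1 := integral_Ioi_quadratic w 1 (-2 * (w + t)) ((w + t) ^ 2)
  have h2 := integral_Ioi_quadratic (-w) 1 (-2 * (-w + t)) ((-w + t) ^ 2)
  have h1' : 0 ≤ ∫ x in Ioi w, (1 * x ^ 2 + (-2 * (w + t)) * x + (w + t) ^ 2) * psi x :=
    setIntegral_nonneg measurableSet_Ioi fun x _ =>
      mul_nonneg (by nlinarith [sq_nonneg (x - (w + t))]) (psi_pos x).le
  have h2' : 0 ≤ ∫ x in Ioi (-w), (1 * x ^ 2 + (-2 * (-w + t)) * x + (-w + t) ^ 2) * psi x :=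
    setIntegral_nonneg measurableSet_Ioi fun x _ =>
      mul_nonneg (by nlinarith [sq_nonneg (x - (-w + t))]) (psi_pos x).le
  rw [h1] at h1'
  rw [h2, psi_neg] at h2'
  have hm := tail_add_tail_neg w
  have key : 0 ≤ 2 * t * (mass * t - (excess w + excess (-w))) := by
    unfold excess
    rw [psi_neg, ← hm]
    have : t ^ 2 * (tail w + tail (-w)) = (1 + w ^ 2) * (tail w + tail (-w)) := by rw [htsq]
    nlinarith
  have := nonneg_of_mul_nonneg_right key (by positivity)
  linarith

/-- Birnbaum's lower bound for the tail controls `excess w`, and the bound for `E|Z - w|` controls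
`excess (-w)`. -/
lemma two_mul_excess_mul_excess_neg_le_of_nonneg {w : ℝ} (hw : 0 ≤ w) :
    2 * (excess w * excess (-w)) ≤ psi w * mass := by
  set a := √(1 + w ^ 2 / 4) with ha
  have ha2 : a ^ 2 = 1 + w ^ 2 / 4 := Real.sq_sqrt (by positivity)
  have ha1 : 1 ≤ a := by
    rw [ha, Real.one_le_sqrt]; nlinarith
  set b := √(1 + w ^ 2) with hb
  have hb2 : b ^ 2 = 1 + w ^ 2 := Real.sq_sqrt (by positivity)
  have hb0 : 0 ≤ b := Real.sqrt_nonneg _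
  -- `r` is the positive root of `r² + w r = 1`, so that `r ψ(w) ≤ tail w` is Birnbaum's bound
  set r := a - w / 2 with hr
  have hr0 : 0 ≤ r := by
    rw [hr, sub_nonneg]; exact Real.le_sqrt_of_sq_le (by nlinarith)
  have hr1 : r ^ 2 + w * r = 1 := by rw [hr]; nlinarith
  have hp := psi_pos w
  have hQ := tail_pos w
  have hQr : r * psi w ≤ tail w := by
    by_contra hlt
    push Not at hlt
    have := psi_sq_le w
    have h3 : tail w ^ 2 < (r * psi w) ^ 2 := pow_lt_pow_left₀ hlt hQ.le (by norm_num)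
    have h4 : w * psi w * tail w ≤ w * psi w * (r * psi w) :=
      mul_le_mul_of_nonneg_left hlt.le (by positivity)
    have h5 : psi w ^ 2 = (r * psi w) ^ 2 + w * psi w * (r * psi w) := by
      linear_combination (-psi w ^ 2) * hr1
    linarith
  have h1 : excess w ≤ psi w * r ^ 2 := by
    unfold excess
    have : w * (r * psi w) ≤ w * tail w := mul_le_mul_of_nonneg_left hQr hw
    have h5 : psi w * r ^ 2 = psi w - w * (r * psi w) := by
      linear_combination psi w * hr1
    linarith
  have h2 : 2 * excess (-w) ≤ mass * (w + b) := by
    have := excess_add_excess_neg_le w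
    have h3 := excess_neg w
    nlinarith
  have h3 : r ^ 2 * (w + b) ≤ 1 := by
    have hb' : b ≤ 1 + w ^ 2 / 2 := by
      rw [hb]; exact Real.sqrt_le_iff.2 ⟨by positivity, by nlinarith [sq_nonneg (w ^ 2)]⟩
    have h4 : w + b ≤ (a + w / 2) ^ 2 := by nlinarith
    have h5 : r ^ 2 * (a + w / 2) ^ 2 = 1 := by
      rw [← mul_pow, show r * (a + w / 2) = 1 by rw [hr]; nlinarith]; norm_num
    calc _ ≤ r ^ 2 * (a + w / 2) ^ 2 := mul_le_mul_of_nonneg_left h4 (by positivity)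
      _ = 1 := h5
  calc 2 * (excess w * excess (-w)) = excess w * (2 * excess (-w)) := by ring
    _ ≤ (psi w * r ^ 2) * (mass * (w + b)) :=
        mul_le_mul h1 h2 (by have := excess_nonneg (-w); positivity) (by positivity)
    _ = psi w * mass * (r ^ 2 * (w + b)) := by ring
    _ ≤ psi w * mass * 1 := mul_le_mul_of_nonneg_left h3 (mul_pos hp mass_pos).le
    _ = _ := by ring

/-- This inequality makes the derivative of Stein's solution bounded by `1`. -/
lemma two_mul_excess_mul_excess_neg_le (w : ℝ) :
    2 * (excess w * excess (-w)) ≤ psi w * mass := by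
  rcases le_total 0 w with hw | hw
  · exact two_mul_excess_mul_excess_neg_le_of_nonneg hw
  · have := two_mul_excess_mul_excess_neg_le_of_nonneg (w := -w) (by linarith)
    rw [neg_neg, psi_neg] at this
    linarith

/-- The solution of the Stein equation `f'(w) - w f(w) = k(w)` for a right-hand side `k` with
Gaussian mean zero. -/
noncomputable def solution (k : ℝ → ℝ) (w : ℝ) : ℝ := (psi w)⁻¹ * ∫ x in Iic w, k x * psi x

lemma hasDerivAt_solution {k : ℝ → ℝ} (hk : Continuous k)
    (hi : Integrable fun x => k x * psi x) (w : ℝ) :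
    HasDerivAt (solution k) (w * solution k w + k w) w := by
  have hc : Continuous fun x => k x * psi x := hk.mul continuous_psi
  have h1 : HasDerivAt (fun w => ∫ x in Iic w, k x * psi x) (k w * psi w) w := by
    have h2 : (fun w => ∫ x in Iic w, k x * psi x)
        = fun w => (∫ x in Iic (0 : ℝ), k x * psi x) + ∫ x in (0 : ℝ)..w, k x * psi x := by
      ext v
      rw [← intervalIntegral.integral_Iic_sub_Iic hi.integrableOn hi.integrableOn]; ring
    rw [h2]
    exact (intervalIntegral.integral_hasDerivAt_right (hc.intervalIntegrable _ _)
      (hc.stronglyMeasurableAtFilter _ _) hc.continuousAt).const_add _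
  have h3 := ((hasDerivAt_psi w).inv (psi_pos w).ne').mul h1
  have hp := (psi_pos w).ne'
  refine h3.congr_deriv ?_
  simp only [Pi.inv_apply, solution]
  field_simp

lemma solution_eq_neg_integral_Ioi {k : ℝ → ℝ}
    (hi : Integrable fun x => k x * psi x) (h0 : ∫ x, k x * psi x = 0) (w : ℝ) :
    solution k w = -((psi w)⁻¹ * ∫ x in Ioi w, k x * psi x) := by
  have := intervalIntegral.integral_Iic_add_Ioi (b := w) hi.integrableOn hi.integrableOn
  rw [h0] at this
  unfold solution
  rw [eq_neg_of_add_eq_zero_left this]; ring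

/-- For a nondecreasing right-hand side the derivative of `w f(w)` is nonpositive. -/
lemma solution_monotone_bound {k : ℝ → ℝ} (hm : Monotone k)
    (hi : Integrable fun x => k x * psi x) (h0 : ∫ x, k x * psi x = 0) (w : ℝ) :
    (1 + w ^ 2) * solution k w + w * k w ≤ 0 := by
  have hp := psi_pos w
  -- use the representation of the solution by the side of `w` on which `k` has a sign bound
  rcases le_total (k w) 0 with hk | hk
  · have h1 : ∫ x in Iic w, k x * psi x ≤ k w * tail (-w) := by
      rw [← integral_Iic_psi, ← integral_const_mul]
      exact setIntegral_mono_on hi.integrableOn (integrable_psi.const_mul _).integrableOn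
        measurableSet_Iic fun x hx => mul_le_mul_of_nonneg_right (hm hx) (psi_pos x).le
    have h2 := tail_sub_nonneg (-w)
    unfold excess at h2
    rw [psi_neg] at h2
    have h3 : psi w * ((1 + w ^ 2) * solution k w + w * k w)
        = (1 + w ^ 2) * (∫ x in Iic w, k x * psi x) + w * k w * psi w := by
      unfold solution; field_simp
    have h4 : psi w * ((1 + w ^ 2) * solution k w + w * k w) ≤ 0 := by
      rw [h3]
      nlinarith [mul_le_mul_of_nonneg_left h1 (show (0 : ℝ) ≤ 1 + w ^ 2 by positivity),
        mul_nonneg (neg_nonneg.2 hk) h2]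
    exact nonpos_of_mul_nonpos_right h4 hp
  · have h1 : k w * tail w ≤ ∫ x in Ioi w, k x * psi x := by
      unfold tail
      rw [← integral_const_mul]
      exact setIntegral_mono_on (integrable_psi.const_mul _).integrableOn hi.integrableOn
        measurableSet_Ioi fun x hx => mul_le_mul_of_nonneg_right (hm (le_of_lt hx)) (psi_pos x).le
    have h2 := tail_sub_nonneg w
    unfold excess at h2
    have h3 : psi w * ((1 + w ^ 2) * solution k w + w * k w)
        = -((1 + w ^ 2) * (∫ x in Ioi w, k x * psi x)) + w * k w * psi w := by
      rw [solution_eq_neg_integral_Ioi hi h0]; field_simp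
    have h4 : psi w * ((1 + w ^ 2) * solution k w + w * k w) ≤ 0 := by
      rw [h3]
      nlinarith [mul_le_mul_of_nonneg_left h1 (show (0 : ℝ) ≤ 1 + w ^ 2 by positivity),
        mul_nonneg hk h2]
    exact nonpos_of_mul_nonpos_right h4 hp

lemma integrable_mul_psi_of_lipschitz {h : ℝ → ℝ} (hh : LipschitzWith 1 h) :
    Integrable fun x => h x * psi x := by
  refine Integrable.mono' (g := fun x => |h 0| * psi x + |x * psi x|)
    ((integrable_psi.const_mul _).add integrable_id_mul_psi.abs)
    (hh.continuous.mul continuous_psi).aestronglyMeasurable (Eventually.of_forall fun x => ?_)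
  have h1 := hh.dist_le_mul x 0
  simp only [Real.dist_eq, NNReal.coe_one, one_mul, sub_zero] at h1
  have h2 : |h x| ≤ |h 0| + |x| := by
    have := abs_sub_abs_le_abs_sub (h x) (h 0); linarith
  rw [Real.norm_eq_abs, abs_mul, abs_mul, abs_of_pos (psi_pos x)]
  nlinarith [psi_pos x]

lemma integral_gaussianReal (h : ℝ → ℝ) :
    ∫ x, h x ∂(gaussianReal 0 1) = mass⁻¹ * ∫ x, h x * psi x := by
  have e : ∀ x, gaussianPDFReal 0 1 x = (√(2 * π))⁻¹ * psi x := fun x => by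
    simp [gaussianPDFReal, psi]
  have hm : mass = √(2 * π) := by
    have := integral_gaussianPDFReal_eq_one (0 : ℝ) (v := 1) one_ne_zero
    simp only [e, integral_const_mul] at this
    unfold mass
    field_simp at this
    exact this
  rw [integral_gaussianReal_eq_integral_smul one_ne_zero, hm, ← integral_const_mul]
  simp only [e, smul_eq_mul]
  congr 1; ext x; ring

/-- Stein's equation for a `1`-Lipschitz test function `h`: there is a solution whose derivative
is bounded by `1` and `2`-Lipschitz. -/
theorem exists_solution {h : ℝ → ℝ} (hh : LipschitzWith 1 h) :
    ∃ f g : ℝ → ℝ, (∀ x, HasDerivAt f (g x) x) ∧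
      (∀ x, g x - x * f x = h x - ∫ y, h y ∂(gaussianReal 0 1)) ∧
      (∀ x, |g x| ≤ 1) ∧ LipschitzWith 2 g := by
  set m := ∫ y, h y ∂(gaussianReal 0 1) with hm
  set k : ℝ → ℝ := fun x => h x - m with hk
  have hcont : Continuous k := hh.continuous.sub continuous_const
  have hhi := integrable_mul_psi_of_lipschitz hh
  have hi : Integrable fun x => k x * psi x := by
    have := hhi.sub (integrable_psi.const_mul m)
    refine this.congr (Eventually.of_forall fun x => ?_)
    simp [hk]; ring
  have h0 : ∫ x, k x * psi x = 0 := by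
    have e : (fun x => k x * psi x) = fun x => h x * psi x - m * psi x := by
      ext x; simp [hk]; ring
    rw [e, integral_sub hhi (integrable_psi.const_mul m), integral_const_mul, hm,
      integral_gaussianReal]
    have := mass_pos.ne'
    change _ - _ * mass = 0
    field_simp; ring
  have hd := hasDerivAt_solution hcont hi
  refine ⟨solution k, fun w => w * solution k w + k w, hd, fun x => by simp [hk], ?_, ?_⟩
  · intro w
    have hp := psi_pos w
    have hM := mass_pos
    have hlip : ∀ x, |h x - h w| ≤ |x - w| := fun x => by
      have := hh.dist_le_mul x w
      simpa [Real.dist_eq] using this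
    have hji : Integrable fun x => (h x - h w) * psi x := by
      have := hhi.sub (integrable_psi.const_mul (h w))
      refine this.congr (Eventually.of_forall fun x => ?_)
      simp; ring
    set Km := ∫ x in Iic w, (h x - h w) * psi x with hKm
    set Kp := ∫ x in Ioi w, (h x - h w) * psi x with hKp
    have hq : Integrable fun x => (x - w) * psi x := by
      have := integrable_id_mul_psi.sub (integrable_psi.const_mul w)
      refine this.congr (Eventually.of_forall fun x => ?_)
      simp; ring
    have hq' : Integrable fun x => (w - x) * psi x := by
      refine hq.neg.congr (Eventually.of_forall fun x => ?_)
      simp only [Pi.neg_apply]; ring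
    have bm : |Km| ≤ excess (-w) := by
      rw [excess_neg_eq_integral, hKm, ← Real.norm_eq_abs]
      refine norm_integral_le_of_norm_le hq'.integrableOn ?_
      filter_upwards [ae_restrict_mem measurableSet_Iic] with x hx
      rw [norm_mul, Real.norm_eq_abs, Real.norm_eq_abs, abs_of_pos (psi_pos x)]
      refine mul_le_mul_of_nonneg_right ((hlip x).trans_eq ?_) (psi_pos x).le
      rw [abs_of_nonpos (sub_nonpos.2 hx)]; ring
    have bp : |Kp| ≤ excess w := by
      rw [excess_eq_integral, hKp, ← Real.norm_eq_abs]
      refine norm_integral_le_of_norm_le hq.integrableOn ?_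
      filter_upwards [ae_restrict_mem measurableSet_Ioi] with x hx
      rw [norm_mul, Real.norm_eq_abs, Real.norm_eq_abs, abs_of_pos (psi_pos x)]
      refine mul_le_mul_of_nonneg_right ((hlip x).trans_eq ?_) (psi_pos x).le
      rw [abs_of_pos (sub_pos.2 hx)]
    have e1 : ∫ x in Iic w, k x * psi x = Km + (h w - m) * tail (-w) := by
      rw [hKm, ← integral_Iic_psi, ← integral_const_mul,
        ← integral_add hji.integrableOn (integrable_psi.const_mul _).integrableOn]
      congr 1; ext x; simp [hk]; ring
    have e2 : ∫ x in Ioi w, k x * psi x = Kp + (h w - m) * tail w := by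
      rw [hKp, tail, ← integral_const_mul,
        ← integral_add hji.integrableOn (integrable_psi.const_mul _).integrableOn]
      congr 1; ext x; simp [hk]; ring
    have e3 : Km + Kp + (h w - m) * mass = 0 := by
      have := intervalIntegral.integral_Iic_add_Ioi (b := w) hi.integrableOn hi.integrableOn
      rw [h0, e1, e2] at this
      rw [← tail_add_tail_neg w]; linarith
    -- the derivative in terms of the increments of `h` to the left and to the right of `w`
    have e4 : psi w * mass * (w * solution k w + k w)
        = -(excess w * Km + excess (-w) * Kp) := by
      have e5 : psi w * solution k w = Km + (h w - m) * tail (-w) := by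
        rw [← e1, solution]; field_simp
      have e6 : k w = h w - m := rfl
      unfold excess
      rw [psi_neg, e6]
      have e7 := tail_add_tail_neg w
      linear_combination mass * w * e5 + (w * tail (-w) + psi w) * e3 - w * Km * e7
    have e8 : |psi w * mass * (w * solution k w + k w)| ≤ psi w * mass * 1 := by
      rw [e4, abs_neg, mul_one]
      refine le_trans ?_ (two_mul_excess_mul_excess_neg_le w)
      refine (abs_add_le _ _).trans ?_
      rw [abs_mul, abs_mul, abs_of_nonneg (excess_nonneg w), abs_of_nonneg (excess_nonneg (-w))]
      nlinarith [mul_le_mul_of_nonneg_left bm (excess_nonneg w),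
        mul_le_mul_of_nonneg_left bp (excess_nonneg (-w))]
    rw [abs_mul, abs_of_pos (mul_pos hp hM)] at e8
    exact le_of_mul_le_mul_left e8 (mul_pos hp hM)
  · -- the derivative of `w f(w)` is bounded by `1`, by comparison with the test functions `x ± h`
    have hxi : ∫ x, x * psi x = 0 := by
      rw [← intervalIntegral.integral_Iic_add_Ioi (b := 0) integrable_id_mul_psi.integrableOn
        integrable_id_mul_psi.integrableOn, integral_Iic_id_mul_psi, integral_Ioi_id_mul_psi]
      ring
    have hpos : ∀ w, (1 + w ^ 2) * solution k w + w * k w ≤ 1 := by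
      intro w
      have hmono : Monotone fun x => x + k x := by
        intro a b hab
        have := hh.dist_le_mul a b
        simp only [Real.dist_eq, NNReal.coe_one, one_mul] at this
        rw [abs_of_nonpos (sub_nonpos.2 hab)] at this
        have := (abs_le.1 this).2
        simp only [hk]; linarith
      have hi' : Integrable fun x => (x + k x) * psi x := by
        simp only [add_mul]; exact integrable_id_mul_psi.add hi
      have h0' : ∫ x, (x + k x) * psi x = 0 := by
        simp only [add_mul]
        rw [integral_add integrable_id_mul_psi hi, hxi, h0, add_zero]
      have := solution_monotone_bound hmono hi' h0' w
      have e : solution (fun x => x + k x) w = -1 + solution k w := by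
        unfold solution
        simp only [add_mul]
        rw [integral_add integrable_id_mul_psi.integrableOn hi.integrableOn,
          integral_Iic_id_mul_psi]
        have := (psi_pos w).ne'
        field_simp
      rw [e] at this
      linarith
    have hneg : ∀ w, -1 ≤ (1 + w ^ 2) * solution k w + w * k w := by
      intro w
      have hmono : Monotone fun x => x - k x := by
        intro a b hab
        have := hh.dist_le_mul a b
        simp only [Real.dist_eq, NNReal.coe_one, one_mul] at this
        rw [abs_of_nonpos (sub_nonpos.2 hab)] at this
        have := (abs_le.1 this).1
        simp only [hk]; linarith
      have hi' : Integrable fun x => (x - k x) * psi x := by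
        simp only [sub_mul]; exact integrable_id_mul_psi.sub hi
      have h0' : ∫ x, (x - k x) * psi x = 0 := by
        simp only [sub_mul]
        rw [integral_sub integrable_id_mul_psi hi, hxi, h0, sub_zero]
      have := solution_monotone_bound hmono hi' h0' w
      have e : solution (fun x => x - k x) w = -1 - solution k w := by
        unfold solution
        simp only [sub_mul]
        rw [integral_sub integrable_id_mul_psi.integrableOn hi.integrableOn,
          integral_Iic_id_mul_psi]
        have := (psi_pos w).ne'
        field_simp
      rw [e] at this
      linarith
    have hd' : ∀ w, HasDerivAt (fun w => w * solution k w)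
        ((1 + w ^ 2) * solution k w + w * k w) w := fun w => by
      exact ((hasDerivAt_id w).mul (hd w)).congr_deriv (by simp only [id]; ring)
    have hl : LipschitzWith 1 fun w => w * solution k w :=
      lipschitzWith_of_nnnorm_deriv_le (fun w => (hd' w).differentiableAt) fun w => by
        rw [(hd' w).deriv, ← NNReal.coe_le_coe, coe_nnnorm, Real.norm_eq_abs, NNReal.coe_one]
        exact abs_le.2 ⟨hneg w, hpos w⟩
    have hk1 : LipschitzWith 1 k := by
      simpa using hh.sub (LipschitzWith.const m)
    have := hl.add hk1
    norm_num at this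
    exact this

end SteinEquation

/-! ### Conditional expectations under independence -/

section CondExpIndep

variable {Ω : Type*} [mΩ : MeasurableSpace Ω] {P : Measure Ω} [IsProbabilityMeasure P]

/-- Enlarging the conditioning σ-algebra by one that is independent of everything else does not
change a conditional expectation. -/
lemma condExp_sup_ae_eq_of_indep {m₁ m₂ m₃ : MeasurableSpace Ω} (h12 : m₁ ≤ m₂) (h2 : m₂ ≤ mΩ)
    (h3 : m₃ ≤ mΩ) (hind : Indep m₂ m₃ P) {G : Ω → ℝ} (hG : StronglyMeasurable[m₂] G)
    (hGi : Integrable G P) : P[G | m₁ ⊔ m₃] =ᵐ[P] P[G | m₁] := by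
  have h1 : m₁ ≤ mΩ := h12.trans h2
  have hle : m₁ ⊔ m₃ ≤ mΩ := sup_le h1 h3
  symm
  refine ae_eq_condExp_of_forall_setIntegral_eq hle hGi
    (fun _ _ _ => integrable_condExp.integrableOn) ?_
    (stronglyMeasurable_condExp.mono le_sup_left).aestronglyMeasurable
  -- the two set integrals agree on the π-system of sets `s ∩ t` with `s ∈ m₁` and `t ∈ m₃`
  have hprod : ∀ {F : Ω → ℝ}, StronglyMeasurable[m₂] F → Integrable F P → ∀ s t,
      MeasurableSet[m₁] s → MeasurableSet[m₃] t →
      ∫ x in s ∩ t, F x ∂P = P.real t * ∫ x in s, F x ∂P := by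
    intro F hF hFi s t hs ht
    have hs' := h1 _ hs
    have ht' := h3 _ ht
    have hFs : StronglyMeasurable[m₂] (s.indicator F) := hF.indicator (h12 _ hs)
    have e := condExp_indep_eq h2 h3 hFs hind
    have := setIntegral_condExp h3 (hFi.indicator hs') ht
    rw [setIntegral_congr_ae (g := fun _ => ∫ x, s.indicator F x ∂P) ht'
      (e.mono fun x hx _ => hx)] at this
    rw [setIntegral_const, integral_indicator hs', setIntegral_indicator hs', smul_eq_mul] at this
    rw [Set.inter_comm, ← this]
  have hpi : IsPiSystem {u | ∃ s t, MeasurableSet[m₁] s ∧ MeasurableSet[m₃] t ∧ u = s ∩ t} := by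
    rintro _ ⟨s, t, hs, ht, rfl⟩ _ ⟨s', t', hs', ht', rfl⟩ _
    exact ⟨s ∩ s', t ∩ t', hs.inter hs', ht.inter ht', Set.inter_inter_inter_comm s t s' t'⟩
  have hgen : m₁ ⊔ m₃ = MeasurableSpace.generateFrom
      {u | ∃ s t, MeasurableSet[m₁] s ∧ MeasurableSet[m₃] t ∧ u = s ∩ t} := by
    refine le_antisymm (sup_le (fun s hs => ?_) fun t ht => ?_) ?_
    · exact MeasurableSpace.measurableSet_generateFrom
        ⟨s, Set.univ, hs, @MeasurableSet.univ _ m₃, by simp⟩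
    · exact MeasurableSpace.measurableSet_generateFrom
        ⟨Set.univ, t, @MeasurableSet.univ _ m₁, ht, by simp⟩
    · refine MeasurableSpace.generateFrom_le ?_
      rintro _ ⟨s, t, hs, ht, rfl⟩
      exact @MeasurableSet.inter _ (m₁ ⊔ m₃) _ _ (le_sup_left (a := m₁) _ hs)
        (le_sup_right (a := m₁) _ ht)
  intro u hu _
  induction u, hu using MeasurableSpace.induction_on_inter hgen hpi with
  | empty => simp
  | basic u hu =>
    obtain ⟨s, t, hs, ht, rfl⟩ := hu
    rw [hprod hG hGi s t hs ht,
      hprod (stronglyMeasurable_condExp.mono h12) integrable_condExp s t hs ht,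
      setIntegral_condExp h1 hGi hs]
  | compl u hu ih =>
    have hu' := hle _ hu
    have a1 := integral_add_compl hu' hGi
    have a2 := integral_add_compl hu' (integrable_condExp (m := m₁) (f := G) (μ := P))
    have a3 := integral_condExp h1 (f := G) (μ := P)
    have a4 := ih (measure_lt_top _ _)
    linarith
  | iUnion f hd hf ih =>
    rw [integral_iUnion (fun i => hle _ (hf i)) hd integrable_condExp.integrableOn,
      integral_iUnion (fun i => hle _ (hf i)) hd hGi.integrableOn]
    exact tsum_congr fun i => ih i (measure_lt_top _ _)

lemma integral_mul_condExp {m : MeasurableSpace Ω} (hm : m ≤ mΩ) {F G : Ω → ℝ}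
    (hF : StronglyMeasurable[m] F) (hG : Integrable G P) (hFG : Integrable (fun ω => F ω * G ω) P) :
    ∫ ω, F ω * P[G | m] ω ∂P = ∫ ω, F ω * G ω ∂P := by
  rw [← integral_condExp hm (f := fun ω => F ω * G ω)]
  exact integral_congr_ae (condExp_mul_of_stronglyMeasurable_left hF hFG hG).symm

omit [IsProbabilityMeasure P] in
/-- The conditional Cauchy–Schwarz inequality. -/
lemma condExp_mul_sq_le {m : MeasurableSpace Ω} {F G : Ω → ℝ}
    (hF : Integrable (fun ω => F ω ^ 2) P) (hG : Integrable (fun ω => G ω ^ 2) P)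
    (hFG : Integrable (fun ω => F ω * G ω) P) :
    ∀ᵐ ω ∂P, P[fun ω => F ω * G ω | m] ω ^ 2
      ≤ P[fun ω => F ω ^ 2 | m] ω * P[fun ω => G ω ^ 2 | m] ω := by
  -- `E[(F + qG)² | m] ≥ 0` for all rational `q`, hence for all real `q`
  have h : ∀ q : ℚ, ∀ᵐ ω ∂P, 0 ≤ P[fun ω => G ω ^ 2 | m] ω * ((q : ℝ) * q)
      + 2 * P[fun ω => F ω * G ω | m] ω * q + P[fun ω => F ω ^ 2 | m] ω := by
    intro q
    have h0 : 0 ≤ᵐ[P] P[fun ω => (F ω + q * G ω) ^ 2 | m] :=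
      condExp_nonneg (Filter.Eventually.of_forall fun ω => sq_nonneg _)
    have e : (fun ω => (F ω + q * G ω) ^ 2)
        = ((fun ω => F ω ^ 2) + (2 * (q : ℝ)) • fun ω => F ω * G ω)
          + ((q : ℝ) * q) • fun ω => G ω ^ 2 := by
      ext ω; simp; ring
    rw [e] at h0
    have e1 := condExp_add (m := m) (hF.add (hFG.smul (2 * (q : ℝ)))) (hG.smul ((q : ℝ) * q))
    have e2 := condExp_add (m := m) hF (hFG.smul (2 * (q : ℝ)))
    have e3 := condExp_smul (m := m) (μ := P) (2 * (q : ℝ)) (fun ω => F ω * G ω)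
    have e4 := condExp_smul (m := m) (μ := P) ((q : ℝ) * q) (fun ω => G ω ^ 2)
    filter_upwards [h0, e1, e2, e3, e4] with ω h0 e1 e2 e3 e4
    rw [e1, Pi.add_apply, e2, Pi.add_apply, e3, e4] at h0
    simp only [Pi.zero_apply, Pi.smul_apply, smul_eq_mul] at h0
    linarith
  filter_upwards [ae_all_iff.2 h] with ω hω
  have hall : ∀ x : ℝ, 0 ≤ P[fun ω => G ω ^ 2 | m] ω * (x * x)
      + 2 * P[fun ω => F ω * G ω | m] ω * x + P[fun ω => F ω ^ 2 | m] ω := by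
    have hclosed : IsClosed {x : ℝ | 0 ≤ P[fun ω => G ω ^ 2 | m] ω * (x * x)
      + 2 * P[fun ω => F ω * G ω | m] ω * x + P[fun ω => F ω ^ 2 | m] ω} :=
      isClosed_le continuous_const (by fun_prop)
    intro x
    have hd : DenseRange ((↑) : ℚ → ℝ) := Rat.denseRange_cast
    exact hd.induction_on x hclosed hω
  have := discrim_le_zero hall
  unfold discrim at this
  nlinarith

end CondExpIndep

section CoordSigma

variable {Ω : Type*} [mΩ : MeasurableSpace Ω] {P : Measure Ω} [IsProbabilityMeasure P]
  {n : ℕ} {E : Fin n → Type*} [∀ i, MeasurableSpace (E i)] {X : ∀ i, Ω → E i}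

lemma coordSigma_le (hX : ∀ i, Measurable (X i)) (J : Finset (Fin n)) :
    coordSigma X J ≤ mΩ :=
  iSup₂_le fun j _ => (hX j).comap_le

omit mΩ in
lemma coordSigma_mono {J K : Finset (Fin n)} (h : J ⊆ K) : coordSigma X J ≤ coordSigma X K :=
  biSup_mono fun _ hj => h hj

omit mΩ in
lemma coordSigma_union (J K : Finset (Fin n)) :
    coordSigma X (J ∪ K) = coordSigma X J ⊔ coordSigma X K := by
  simp only [coordSigma, Finset.mem_union, iSup_or, iSup_sup_eq]

omit [IsProbabilityMeasure P] in
lemma indep_coordSigma (hX : ∀ i, Measurable (X i)) (hindep : iIndepFun X P)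
    {J K : Finset (Fin n)} (h : Disjoint J K) : Indep (coordSigma X J) (coordSigma X K) P := by
  have := indep_iSup_of_disjoint (fun i => (hX i).comap_le) hindep
    (S := (J : Set (Fin n))) (T := (K : Set (Fin n))) (Finset.disjoint_coe.2 h)
  simpa [coordSigma] using this

/-- For independent coordinates, conditioning an `F_K`-measurable variable on `F_L` is the same as
conditioning it on `F_{K ∩ L}`. -/
lemma condExp_coordSigma_inter (hX : ∀ i, Measurable (X i)) (hindep : iIndepFun X P)
    {K : Finset (Fin n)} (L : Finset (Fin n)) {G : Ω → ℝ}
    (hG : StronglyMeasurable[coordSigma X K] G) (hGi : Integrable G P) :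
    P[G | coordSigma X L] =ᵐ[P] P[G | coordSigma X (K ∩ L)] := by
  have hL : coordSigma X L = coordSigma X (K ∩ L) ⊔ coordSigma X (L \ K) := by
    rw [← coordSigma_union]; congr 1; ext; simp; tauto
  rw [hL]
  exact condExp_sup_ae_eq_of_indep (coordSigma_mono Finset.inter_subset_left) (coordSigma_le hX K)
    (coordSigma_le hX _) (indep_coordSigma hX hindep Finset.disjoint_sdiff) hG hGi

lemma condExp_condExp_coordSigma (hX : ∀ i, Measurable (X i)) (hindep : iIndepFun X P)
    (K L : Finset (Fin n)) (G : Ω → ℝ) :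
    P[P[G | coordSigma X K] | coordSigma X L] =ᵐ[P] P[G | coordSigma X (K ∩ L)] :=
  (condExp_coordSigma_inter hX hindep L stronglyMeasurable_condExp integrable_condExp).trans
    (condExp_condExp_of_le (coordSigma_mono Finset.inter_subset_left) (coordSigma_le hX K))

omit [IsProbabilityMeasure P] in
/-- The expectation of a product of variables depending on disjoint sets of coordinates. -/
lemma integral_mul_of_disjoint (hX : ∀ i, Measurable (X i)) (hindep : iIndepFun X P)
    {J K : Finset (Fin n)} (h : Disjoint J K) {F G : Ω → ℝ}
    (hF : StronglyMeasurable[coordSigma X J] F) (hG : StronglyMeasurable[coordSigma X K] G) :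
    ∫ ω, F ω * G ω ∂P = (∫ ω, F ω ∂P) * ∫ ω, G ω ∂P := by
  have hi : IndepFun F G P := by
    rw [IndepFun_iff_Indep]
    exact indep_of_indep_of_le_left (indep_of_indep_of_le_right (indep_coordSigma hX hindep h)
      hG.measurable.comap_le) hF.measurable.comap_le
  exact hi.integral_fun_mul_eq_mul_integral
    (hF.mono (coordSigma_le hX J)).aestronglyMeasurable
    (hG.mono (coordSigma_le hX K)).aestronglyMeasurable

end CoordSigma

/-! ### Resampling a coordinate: the exchangeable pair -/

section Resampling

instance : ENNReal.HolderTriple 4 4 2 where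
  inv_add_inv_eq_inv := by
    rw [← two_mul, show (4 : ENNReal) = 2 * 2 by norm_num,
      ENNReal.mul_inv (by norm_num) (by norm_num), ← mul_assoc,
      ENNReal.mul_inv_cancel (by norm_num) (by norm_num), one_mul]

lemma memLp_two_mul {α : Type*} {mα : MeasurableSpace α} {μ : Measure α} {a b : α → ℝ}
    (ha : MemLp a 4 μ) (hb : MemLp b 4 μ) : MemLp (fun x => a x * b x) 2 μ := hb.mul ha

lemma memLp_two_sq {α : Type*} {mα : MeasurableSpace α} {μ : Measure α} {a : α → ℝ}
    (ha : MemLp a 4 μ) : MemLp (fun x => a x ^ 2) 2 μ := by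
  simpa only [sq] using memLp_two_mul ha ha

/-- Resampling one of two independent inputs: if `W = w(U, V)` with `U`, `V` independent, then there
is an exchangeable law `ρ` on `ℝ × ℝ`, that of `(w(U, V), w(U, V'))` with `V'` an independent copy
of `V`, whose marginals are the law of `W` and whose mixed moments are expressed through conditional
expectations given `U`. -/
lemma exists_exchangeable_law {Ω S T : Type*} [mΩ : MeasurableSpace Ω] {P : Measure Ω}
    [IsProbabilityMeasure P] [MeasurableSpace S] [MeasurableSpace T] {U : Ω → S} {V : Ω → T}
    (hU : Measurable U) (hV : Measurable V) (hUV : IndepFun U V P) {w : S × T → ℝ}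
    (hw : Measurable w) :
    ∃ ρ : Measure (ℝ × ℝ), IsProbabilityMeasure ρ ∧
      MeasurePreserving Prod.swap ρ ρ ∧
      ρ.map Prod.fst = P.map (fun ω => w (U ω, V ω)) ∧
      ∀ A B : ℝ → ℝ, Measurable A → Measurable B →
        Integrable (fun p : ℝ × ℝ => A p.1 * B p.2) ρ →
        Integrable (fun ω => B (w (U ω, V ω))) P →
        ∫ p, A p.1 * B p.2 ∂ρ = ∫ ω, A (w (U ω, V ω)) *
          P[fun ω => B (w (U ω, V ω)) | MeasurableSpace.comap U inferInstance] ω ∂P := by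
  set ν := P.map U with hν
  set μ := P.map V with hμ
  have : IsProbabilityMeasure ν := Measure.isProbabilityMeasure_map hU.aemeasurable
  have : IsProbabilityMeasure μ := Measure.isProbabilityMeasure_map hV.aemeasurable
  have hlaw : P.map (fun ω => (U ω, V ω)) = ν.prod μ :=
    (indepFun_iff_map_prod_eq_prod_map_map hU.aemeasurable hV.aemeasurable).1 hUV
  set pr : (S × T) × T → ℝ × ℝ := fun z => (w z.1, w (z.1.1, z.2)) with hpr
  have hprm : Measurable pr := by fun_prop
  have hswap : MeasurePreserving (fun z : (S × T) × T => ((z.1.1, z.2), z.1.2))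
      ((ν.prod μ).prod μ) ((ν.prod μ).prod μ) := by
    have e1 := measurePreserving_prodAssoc ν μ μ
    have e2 : MeasurePreserving (Prod.map id Prod.swap : S × (T × T) → S × (T × T))
        (ν.prod (μ.prod μ)) (ν.prod (μ.prod μ)) :=
      (MeasurePreserving.id ν).prod Measure.measurePreserving_swap
    exact (e1.symm.comp e2).comp e1
  -- the pair `(w(U, V), w(U, V'))`, realised on `(S × T) × T`
  refine ⟨((ν.prod μ).prod μ).map pr, Measure.isProbabilityMeasure_map hprm.aemeasurable,
    ?_, ?_, ?_⟩
  · refine ⟨measurable_swap, ?_⟩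
    rw [Measure.map_map measurable_swap hprm]
    conv_rhs => rw [← hswap.map_eq, Measure.map_map hprm hswap.measurable]
    rfl
  · rw [Measure.map_map measurable_fst hprm]
    have : Prod.fst ∘ pr = w ∘ Prod.fst := rfl
    rw [this, ← Measure.map_map hw measurable_fst, ← Measure.fst, Measure.fst_prod, ← hlaw,
      Measure.map_map hw (hU.prodMk hV)]
    rfl
  · intro A B hA hB hAB hBW
    -- integrating out the second copy gives the conditional expectation given `U`
    set k : S → ℝ := fun s => ∫ c, B (w (s, c)) ∂μ with hk
    have hBw : Measurable fun z => B (w z) := hB.comp hw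
    have hkm : StronglyMeasurable k :=
      StronglyMeasurable.integral_prod_right (f := fun s c => B (w (s, c))) hBw.stronglyMeasurable
    have hBi : Integrable (fun z => B (w z)) (ν.prod μ) := by
      rw [← hlaw, integrable_map_measure hBw.aestronglyMeasurable
        (hU.prodMk hV).aemeasurable]
      exact hBW
    have hki : Integrable k ν := hBi.integral_prod_left
    have hkU : Integrable (fun ω => k (U ω)) P := by
      have := hki
      rw [hν, integrable_map_measure hkm.aestronglyMeasurable hU.aemeasurable] at this
      exact this
    have hcond : (fun ω => k (U ω)) =ᵐ[P]
        P[fun ω => B (w (U ω, V ω)) | MeasurableSpace.comap U inferInstance] := by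
      refine ae_eq_condExp_of_forall_setIntegral_eq hU.comap_le hBW
        (fun _ _ _ => hkU.integrableOn) ?_
        (hkm.comp_measurable (comap_measurable U)).aestronglyMeasurable
      rintro _ ⟨s, hs, rfl⟩ _
      have e1 : ∫ ω in U ⁻¹' s, k (U ω) ∂P = ∫ x in s, k x ∂ν := by
        rw [hν, setIntegral_map hs hkm.aestronglyMeasurable hU.aemeasurable]
      have e2 : ∫ ω in U ⁻¹' s, B (w (U ω, V ω)) ∂P
          = ∫ z in s ×ˢ Set.univ, B (w z) ∂(ν.prod μ) := by
        rw [← hlaw, setIntegral_map (hs.prod MeasurableSet.univ)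
          hBw.aestronglyMeasurable (hU.prodMk hV).aemeasurable]
        congr 2
        ext; simp
      rw [e1, e2, setIntegral_prod _ hBi.integrableOn]
      simp [hk]
    rw [integral_map hprm.aemeasurable hAB.aestronglyMeasurable]
    rw [integrable_map_measure hAB.aestronglyMeasurable hprm.aemeasurable] at hAB
    have e4 : ∫ z, A (pr z).1 * B (pr z).2 ∂((ν.prod μ).prod μ)
        = ∫ z, ∫ c, A (pr (z, c)).1 * B (pr (z, c)).2 ∂μ ∂(ν.prod μ) := integral_prod _ hAB
    rw [e4]
    have e3 : ∀ z : S × T, ∫ c, A (pr (z, c)).1 * B (pr (z, c)).2 ∂μ = A (w z) * k z.1 := by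
      intro z
      simp only [hpr, hk]
      rw [integral_const_mul]
    simp only [e3]
    have hAk : Measurable fun z : S × T => A (w z) * k z.1 :=
      (hA.comp hw).mul (hkm.measurable.comp measurable_fst)
    rw [← hlaw, integral_map (hU.prodMk hV).aemeasurable hAk.aestronglyMeasurable]
    refine integral_congr_ae (hcond.mono fun ω hω => ?_)
    simp only at hω ⊢
    rw [hω]

/-- The Taylor error of a function with `2`-Lipschitz derivative. -/
lemma abs_sub_taylor_le {f g : ℝ → ℝ} (hf : ∀ x, HasDerivAt f (g x) x)
    (hg : LipschitzWith 2 g) (x y : ℝ) : |f y - f x - (y - x) * g x| ≤ (y - x) ^ 2 := by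
  set D := y - x with hD
  have hgc : Continuous g := hg.continuous
  have hd : ∀ s : ℝ, HasDerivAt (fun s => f (x + s * D) - s * D * g x)
      (D * (g (x + s * D) - g x)) s := fun s => by
    have h1 : HasDerivAt (fun s : ℝ => x + s * D) D s := by
      simpa using ((hasDerivAt_id s).mul_const D).const_add x
    have h2 := (hf (x + s * D)).comp s h1
    have h3 : HasDerivAt (fun s : ℝ => s * D * g x) (D * g x) s := by
      simpa using ((hasDerivAt_id s).mul_const D).mul_const (g x)
    exact (h2.sub h3).congr_deriv (by ring)
  have hint : IntervalIntegrable (fun s => D * (g (x + s * D) - g x)) volume 0 1 :=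
    (by fun_prop : Continuous fun s => D * (g (x + s * D) - g x)).intervalIntegrable _ _
  have e := intervalIntegral.integral_eq_sub_of_hasDerivAt (fun s _ => hd s) hint
  have e2 : f y - f x - D * g x = ∫ s in (0 : ℝ)..1, D * (g (x + s * D) - g x) := by
    rw [e, show x + 1 * D = y by rw [hD]; ring, show x + 0 * D = x by ring]; ring
  have e3 : ∫ s in (0 : ℝ)..1, 2 * D ^ 2 * s = D ^ 2 := by
    rw [intervalIntegral.integral_const_mul, integral_id]; ring
  rw [e2, ← e3, ← Real.norm_eq_abs]
  refine intervalIntegral.norm_integral_le_of_norm_le zero_le_one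
    (Filter.Eventually.of_forall fun s hs => ?_)
    ((by fun_prop : Continuous fun s : ℝ => 2 * D ^ 2 * s).intervalIntegrable _ _)
  have h1 := hg.dist_le_mul (x + s * D) x
  rw [Real.dist_eq, Real.dist_eq, add_sub_cancel_left, abs_mul, abs_of_pos hs.1] at h1
  rw [Real.norm_eq_abs, abs_mul, ← sq_abs D]
  have h2 := mul_le_mul_of_nonneg_left h1 (abs_nonneg D)
  refine h2.trans_eq ?_
  push_cast; ring

/-- The error of the trapezoidal rule for a function with `2`-Lipschitz derivative. -/
lemma abs_sub_trapezoid_le {f g : ℝ → ℝ} (hf : ∀ x, HasDerivAt f (g x) x)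
    (hg : LipschitzWith 2 g) (x y : ℝ) :
    |f y - f x - (y - x) * ((g x + g y) / 2)| ≤ (y - x) ^ 2 / 2 := by
  -- expand at both end points and compare at the midpoint
  have h1 := abs_le.1 (abs_sub_taylor_le hf hg x ((x + y) / 2))
  have h2 := abs_le.1 (abs_sub_taylor_le hf hg y ((x + y) / 2))
  rw [abs_le]
  constructor <;> nlinarith

/-- Taylor expansion in Stein's identity for an exchangeable pair. Exchangeability allows the
trapezoidal rule, whose error is half that of the expansion at one end point. -/
lemma abs_stein_pair_le {f g : ℝ → ℝ} (hf : ∀ x, HasDerivAt f (g x) x)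
    (hg : LipschitzWith 2 g) (hg1 : ∀ x, |g x| ≤ 1) {ρ : Measure (ℝ × ℝ)} [IsProbabilityMeasure ρ]
    (hsw : MeasurePreserving Prod.swap ρ ρ) (h4 : MemLp Prod.fst 4 ρ) :
    |∫ p, (p.2 - p.1) * (f p.2 - f p.1) ∂ρ - ∫ p, g p.1 * (p.2 - p.1) ^ 2 ∂ρ|
      ≤ √(∫ p, (p.2 - p.1) ^ 2 ∂ρ) * √(∫ p, (p.2 - p.1) ^ 4 ∂ρ) / 2 := by
  have hgc : Continuous g := hg.continuous
  have hfc : Continuous f := continuous_iff_continuousAt.2 fun x => (hf x).continuousAt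
  have h4' : MemLp Prod.snd 4 ρ := h4.comp_measurePreserving hsw
  have hΔ : MemLp (fun p : ℝ × ℝ => p.2 - p.1) 4 ρ := h4'.sub h4
  have hΔ2 : Integrable (fun p : ℝ × ℝ => (p.2 - p.1) ^ 2) ρ :=
    (hΔ.mono_exponent (by norm_num)).integrable_sq
  have hΔ4 : Integrable (fun p : ℝ × ℝ => (p.2 - p.1) ^ 4) ρ := by
    have := hΔ.integrable_norm_pow (by norm_num)
    refine this.congr (Filter.Eventually.of_forall fun p => ?_)
    simp only [Real.norm_eq_abs]
    norm_num [Even.pow_abs]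
  have hΔ2L : MemLp (fun p : ℝ × ℝ => (p.2 - p.1) ^ 2) 2 ρ :=
    (memLp_two_iff_integrable_sq (by fun_prop)).2
      (by simpa [← pow_mul] using hΔ4)
  have hΔ1L : MemLp (fun p : ℝ × ℝ => |p.2 - p.1|) 2 ρ :=
    (hΔ.mono_exponent (by norm_num)).abs
  have hΔ3 : Integrable (fun p : ℝ × ℝ => |p.2 - p.1| * (p.2 - p.1) ^ 2) ρ :=
    hΔ1L.integrable_mul hΔ2L
  have hbd : ∀ (k : ℝ × ℝ → ℝ), Continuous k → (∀ p, |k p| ≤ 1) →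
      Integrable (fun p : ℝ × ℝ => k p * (p.2 - p.1) ^ 2) ρ := fun k hk h1 =>
    hΔ2.bdd_mul hk.aestronglyMeasurable (Filter.Eventually.of_forall h1)
  have hi1 := hbd (fun p => g p.1) (by fun_prop) fun p => hg1 _
  have hi2 := hbd (fun p => g p.2) (by fun_prop) fun p => hg1 _
  have hflip : ∀ x y, |f y - f x| ≤ |y - x| := by
    have : LipschitzWith 1 f := lipschitzWith_of_nnnorm_deriv_le
      (fun x => (hf x).differentiableAt) fun x => by
        rw [(hf x).deriv, ← NNReal.coe_le_coe, coe_nnnorm, Real.norm_eq_abs]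
        exact hg1 x
    intro x y
    simpa [Real.dist_eq] using this.dist_le_mul y x
  have hi3 : Integrable (fun p : ℝ × ℝ => (p.2 - p.1) * (f p.2 - f p.1)) ρ := by
    refine hΔ2.mono' (by fun_prop) (Filter.Eventually.of_forall fun p => ?_)
    rw [Real.norm_eq_abs, abs_mul, ← sq_abs, sq]
    exact mul_le_mul_of_nonneg_left (hflip _ _) (abs_nonneg _)
  -- by exchangeability `g p.1` may be replaced by the average `(g p.1 + g p.2) / 2`
  have hsym : ∫ p, g p.2 * (p.2 - p.1) ^ 2 ∂ρ = ∫ p, g p.1 * (p.2 - p.1) ^ 2 ∂ρ := by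
    rw [← hsw.integral_comp MeasurableEquiv.prodComm.measurableEmbedding]
    refine integral_congr_ae (Filter.Eventually.of_forall fun p => ?_)
    simp only [Prod.fst_swap, Prod.snd_swap]; ring
  have e : ∫ p, (p.2 - p.1) * (f p.2 - f p.1) ∂ρ - ∫ p, g p.1 * (p.2 - p.1) ^ 2 ∂ρ
      = ∫ p, (p.2 - p.1) * (f p.2 - f p.1 - (p.2 - p.1) * ((g p.1 + g p.2) / 2)) ∂ρ := by
    have e1 : ∀ p : ℝ × ℝ, (p.2 - p.1) * (f p.2 - f p.1 - (p.2 - p.1) * ((g p.1 + g p.2) / 2))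
        = (p.2 - p.1) * (f p.2 - f p.1)
          - 2⁻¹ * (g p.1 * (p.2 - p.1) ^ 2 + g p.2 * (p.2 - p.1) ^ 2) := fun p => by ring
    have hi12 : Integrable (fun p : ℝ × ℝ =>
      g p.1 * (p.2 - p.1) ^ 2 + g p.2 * (p.2 - p.1) ^ 2) ρ := hi1.add hi2
    simp only [e1]
    rw [integral_sub hi3 (hi12.const_mul _), integral_const_mul, integral_add hi1 hi2,
      hsym]
    ring
  rw [e, ← Real.norm_eq_abs]
  have hCS := integral_mul_le_Lp_mul_Lq_of_nonneg (μ := ρ) Real.HolderConjugate.two_two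
    (f := fun p : ℝ × ℝ => |p.2 - p.1|) (g := fun p : ℝ × ℝ => (p.2 - p.1) ^ 2)
    (Filter.Eventually.of_forall fun p => abs_nonneg _)
    (Filter.Eventually.of_forall fun p => sq_nonneg _)
    (by simpa using hΔ1L) (by simpa using hΔ2L)
  simp only [Real.rpow_two, sq_abs, ← pow_mul, ← Real.sqrt_eq_rpow] at hCS
  calc _ ≤ ∫ p, |p.2 - p.1| * (p.2 - p.1) ^ 2 / 2 ∂ρ := by
        refine norm_integral_le_of_norm_le (hΔ3.div_const 2)
          (Filter.Eventually.of_forall fun p => ?_)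
        rw [norm_mul, Real.norm_eq_abs, Real.norm_eq_abs, mul_div_assoc]
        exact mul_le_mul_of_nonneg_left (abs_sub_trapezoid_le hf hg _ _) (abs_nonneg _)
    _ = (∫ p, |p.2 - p.1| * (p.2 - p.1) ^ 2 ∂ρ) / 2 := integral_div _ _
    _ ≤ _ := by
        refine div_le_div_of_nonneg_right (hCS.trans_eq ?_) (by norm_num)
        norm_num

lemma integrable_mul_mul_mul {α : Type*} {mα : MeasurableSpace α} {μ : Measure α}
    {a b c d : α → ℝ} (ha : MemLp a 4 μ) (hb : MemLp b 4 μ) (hc : MemLp c 4 μ)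
    (hd : MemLp d 4 μ) : Integrable (fun x => (a x * b x) * (c x * d x)) μ :=
  (memLp_two_mul ha hb).integrable_mul (memLp_two_mul hc hd)

lemma integrable_mul_of_four {α : Type*} {mα : MeasurableSpace α} {μ : Measure α}
    [IsFiniteMeasure μ] {a b : α → ℝ} (ha : MemLp a 4 μ) (hb : MemLp b 4 μ) :
    Integrable (fun x => a x * b x) μ :=
  (memLp_two_mul ha hb).integrable (by norm_num)

lemma memLp_comp_of_deriv_le {f g : ℝ → ℝ} (hf : ∀ x, HasDerivAt f (g x) x)
    (hg1 : ∀ x, |g x| ≤ 1) {α : Type*} {mα : MeasurableSpace α} {μ : Measure α}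
    [IsFiniteMeasure μ] {a : α → ℝ} (ha : MemLp a 4 μ) : MemLp (fun x => f (a x)) 4 μ := by
  have hfc : Continuous f := continuous_iff_continuousAt.2 fun x => (hf x).continuousAt
  have h1 : LipschitzWith 1 f := lipschitzWith_of_nnnorm_deriv_le
    (fun x => (hf x).differentiableAt) fun x => by
      rw [(hf x).deriv, ← NNReal.coe_le_coe, coe_nnnorm, Real.norm_eq_abs]
      exact hg1 x
  have hfl : ∀ x, |f x| ≤ |f 0| + |x| := by
    intro x
    have h2 := h1.dist_le_mul x 0
    simp only [Real.dist_eq, NNReal.coe_one, one_mul, sub_zero] at h2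
    have := abs_sub_abs_le_abs_sub (f x) (f 0)
    linarith
  have hb : MemLp (fun x => |f 0| + |a x|) 4 μ := (memLp_const |f 0|).add ha.norm
  exact hb.mono' (hfc.comp_aestronglyMeasurable ha.1) (Filter.Eventually.of_forall fun x => hfl _)

lemma integrable_comp_mul {g : ℝ → ℝ} (hgc : Continuous g)
    (hg1 : ∀ x, |g x| ≤ 1) {α : Type*} {mα : MeasurableSpace α} {μ : Measure α}
    {a b : α → ℝ} (ha : MemLp a 4 μ) (hb : Integrable b μ) :
    Integrable (fun x => g (a x) * b x) μ :=
  hb.bdd_mul (hgc.comp_aestronglyMeasurable ha.1) (Filter.Eventually.of_forall fun _ => hg1 _)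

/-- A Stein bound for the effect of resampling one of two independent inputs `U`, `V` of
`W = w(U, V)`, stated through conditional expectations given `U`: here `2 E[W (W - E[W|U])]` and
`8 E[W³ (W - E[W|U])] - 6 E[W² (W² - E[W²|U])]` are the second and the fourth moment of the
increment of `W`. -/
lemma abs_stein_resample_le {Ω S T : Type*} {m : MeasurableSpace Ω} [mΩ : MeasurableSpace Ω]
    {P : Measure Ω} [IsProbabilityMeasure P] [MeasurableSpace S] [MeasurableSpace T] {U : Ω → S}
    {V : Ω → T} (hU : Measurable U) (hV : Measurable V) (hUV : IndepFun U V P) {w : S × T → ℝ}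
    (hw : Measurable w) {W : Ω → ℝ} (hW : W = fun ω => w (U ω, V ω)) (hW4 : MemLp W 4 P)
    (hm : m = MeasurableSpace.comap U inferInstance)
    {f g : ℝ → ℝ} (hf : ∀ x, HasDerivAt f (g x) x)
    (hg : LipschitzWith 2 g) (hg1 : ∀ x, |g x| ≤ 1) :
    0 ≤ 2 * ∫ ω, W ω * (W ω - P[W | m] ω) ∂P ∧
    0 ≤ 8 * ∫ ω, W ω ^ 3 * (W ω - P[W | m] ω) ∂P
      - 6 * ∫ ω, W ω ^ 2 * (W ω ^ 2 - P[fun ω => W ω ^ 2 | m] ω) ∂P ∧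
    |2 * ∫ ω, f (W ω) * (W ω - P[W | m] ω) ∂P
      - ∫ ω, g (W ω) * (P[fun ω => W ω ^ 2 | m] ω - 2 * W ω * P[W | m] ω + W ω ^ 2) ∂P|
      ≤ √(2 * ∫ ω, W ω * (W ω - P[W | m] ω) ∂P) *
        √(8 * ∫ ω, W ω ^ 3 * (W ω - P[W | m] ω) ∂P
          - 6 * ∫ ω, W ω ^ 2 * (W ω ^ 2 - P[fun ω => W ω ^ 2 | m] ω) ∂P) / 2 := by
  obtain ⟨ρ, hρ, hsw, hfst, hmix⟩ := exists_exchangeable_law hU hV hUV hw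
  rw [← hm] at hmix
  have hWU : (fun ω => w (U ω, V ω)) = W := hW.symm
  have hWU' : ∀ ω, w (U ω, V ω) = W ω := fun ω => by rw [hW]
  have hWm : Measurable W := by rw [hW]; fun_prop
  simp only [hWU'] at hfst hmix
  have hgc : Continuous g := hg.continuous
  have hfc : Continuous f := continuous_iff_continuousAt.2 fun x => (hf x).continuousAt
  -- moments of the pair
  have h1 : MemLp (Prod.fst : ℝ × ℝ → ℝ) 4 ρ := by
    have : MemLp (id : ℝ → ℝ) 4 (ρ.map Prod.fst) := by
      rw [hfst, memLp_map_measure_iff aestronglyMeasurable_id hWm.aemeasurable]; exact hW4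
    rw [memLp_map_measure_iff aestronglyMeasurable_id measurable_fst.aemeasurable] at this
    exact this
  have h2 : MemLp (Prod.snd : ℝ × ℝ → ℝ) 4 ρ := h1.comp_measurePreserving hsw
  have hmarg : ∀ A : ℝ → ℝ, Measurable A → ∫ p, A p.1 ∂ρ = ∫ ω, A (W ω) ∂P := by
    intro A hA
    rw [← integral_map (f := A) measurable_fst.aemeasurable hA.aestronglyMeasurable, hfst,
      integral_map hWm.aemeasurable hA.aestronglyMeasurable]
  have hswap : ∀ F : ℝ × ℝ → ℝ, ∫ p, F p.swap ∂ρ = ∫ p, F p ∂ρ := fun F =>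
    hsw.integral_comp MeasurableEquiv.prodComm.measurableEmbedding F
  set M := P[W | m] with hM
  set S₂ := P[fun ω => W ω ^ 2 | m] with hS
  have hWi : Integrable W P := hW4.integrable (by norm_num)
  have hM4 : MemLp M 4 P := hW4.condExp (by norm_num)
  have hW22 : MemLp (fun ω => W ω ^ 2) 2 P := memLp_two_sq hW4
  have hS2 : MemLp S₂ 2 P := hW22.condExp (by norm_num)
  have i11 : Integrable (fun p : ℝ × ℝ => p.1 * p.2) ρ := integrable_mul_of_four h1 h2
  have i20 : Integrable (fun p : ℝ × ℝ => p.1 ^ 2) ρ := by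
    simpa only [sq] using integrable_mul_of_four h1 h1
  have i02 : Integrable (fun p : ℝ × ℝ => p.2 ^ 2) ρ := by
    simpa only [sq] using integrable_mul_of_four h2 h2
  have i40 : Integrable (fun p : ℝ × ℝ => p.1 ^ 4) ρ :=
    (integrable_mul_mul_mul h1 h1 h1 h1).congr (Filter.Eventually.of_forall fun p => by ring)
  have i04 : Integrable (fun p : ℝ × ℝ => p.2 ^ 4) ρ :=
    (integrable_mul_mul_mul h2 h2 h2 h2).congr (Filter.Eventually.of_forall fun p => by ring)
  have i31 : Integrable (fun p : ℝ × ℝ => p.1 ^ 3 * p.2) ρ :=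
    (integrable_mul_mul_mul h1 h1 h1 h2).congr (Filter.Eventually.of_forall fun p => by ring)
  have i13 : Integrable (fun p : ℝ × ℝ => p.1 * p.2 ^ 3) ρ :=
    (integrable_mul_mul_mul h1 h2 h2 h2).congr (Filter.Eventually.of_forall fun p => by ring)
  have i22 : Integrable (fun p : ℝ × ℝ => p.1 ^ 2 * p.2 ^ 2) ρ :=
    (integrable_mul_mul_mul h1 h1 h2 h2).congr (Filter.Eventually.of_forall fun p => by ring)
  have j4 : Integrable (fun ω => W ω ^ 4) P :=
    (integrable_mul_mul_mul hW4 hW4 hW4 hW4).congr (Filter.Eventually.of_forall fun p => by ring)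
  have j2 : Integrable (fun ω => W ω ^ 2) P := hW22.integrable (by norm_num)
  have j31 : Integrable (fun ω => W ω ^ 3 * M ω) P :=
    (integrable_mul_mul_mul hW4 hW4 hW4 hM4).congr (Filter.Eventually.of_forall fun p => by ring)
  have j11 : Integrable (fun ω => W ω * M ω) P := integrable_mul_of_four hW4 hM4
  have j22 : Integrable (fun ω => W ω ^ 2 * S₂ ω) P := hW22.integrable_mul hS2
  -- second moment of the increment
  have E2 : ∫ p, (p.2 - p.1) ^ 2 ∂ρ = 2 * ∫ ω, W ω * (W ω - M ω) ∂P := by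
    have e1 : ∀ p : ℝ × ℝ, (p.2 - p.1) ^ 2 = p.2 ^ 2 - 2 * (p.1 * p.2) + p.1 ^ 2 :=
      fun p => by ring
    have e2 : ∀ ω, W ω * (W ω - M ω) = W ω ^ 2 - W ω * M ω := fun ω => by ring
    have a1 : ∫ p, p.2 ^ 2 ∂ρ = ∫ p, p.1 ^ 2 ∂ρ := hswap fun p => p.1 ^ 2
    have a2 := hmarg (fun x => x ^ 2) (by fun_prop)
    have a3 := hmix (fun x => x) (fun x => x) measurable_id measurable_id i11 hWi
    simp only [e1, e2]
    rw [integral_add (f := fun p : ℝ × ℝ => p.2 ^ 2 - 2 * (p.1 * p.2)) (i02.sub (i11.const_mul 2))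
      i20, integral_sub i02 (i11.const_mul 2), integral_const_mul, integral_sub j2 j11]
    linear_combination a1 + 2 * a2 - 2 * a3
  -- fourth moment of the increment
  have E4 : ∫ p, (p.2 - p.1) ^ 4 ∂ρ = 8 * ∫ ω, W ω ^ 3 * (W ω - M ω) ∂P
      - 6 * ∫ ω, W ω ^ 2 * (W ω ^ 2 - S₂ ω) ∂P := by
    have e1 : ∀ p : ℝ × ℝ, (p.2 - p.1) ^ 4 = (p.2 ^ 4 + p.1 ^ 4)
        + (6 * (p.1 ^ 2 * p.2 ^ 2) - 4 * (p.1 ^ 3 * p.2 + p.1 * p.2 ^ 3)) := fun p => by ring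
    have e2 : ∀ ω, W ω ^ 3 * (W ω - M ω) = W ω ^ 4 - W ω ^ 3 * M ω := fun ω => by ring
    have e3 : ∀ ω, W ω ^ 2 * (W ω ^ 2 - S₂ ω) = W ω ^ 4 - W ω ^ 2 * S₂ ω := fun ω => by ring
    have a1 : ∫ p, p.2 ^ 4 ∂ρ = ∫ p, p.1 ^ 4 ∂ρ := hswap fun p => p.1 ^ 4
    have a2 := hmarg (fun x => x ^ 4) (by fun_prop)
    have a3 := hmix (fun x => x ^ 3) (fun x => x) (by fun_prop) measurable_id i31 hWi
    have a4 := hmix (fun x => x ^ 2) (fun x => x ^ 2) (by fun_prop) (by fun_prop) i22 j2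
    have a5 : ∫ p, p.1 * p.2 ^ 3 ∂ρ = ∫ p, p.1 ^ 3 * p.2 ∂ρ := by
      rw [← hswap fun p => p.1 ^ 3 * p.2]
      simp only [Prod.fst_swap, Prod.snd_swap, mul_comm]
    have b1 : Integrable (fun p : ℝ × ℝ => p.2 ^ 4 + p.1 ^ 4) ρ := i04.add i40
    have b2 : Integrable (fun p : ℝ × ℝ => p.1 ^ 3 * p.2 + p.1 * p.2 ^ 3) ρ := i31.add i13
    have b3 : Integrable (fun p : ℝ × ℝ =>
        6 * (p.1 ^ 2 * p.2 ^ 2) - 4 * (p.1 ^ 3 * p.2 + p.1 * p.2 ^ 3)) ρ :=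
      (i22.const_mul 6).sub (b2.const_mul 4)
    simp only [e1, e2, e3]
    rw [integral_add b1 b3, integral_add i04 i40,
      integral_sub (i22.const_mul 6) (b2.const_mul 4), integral_const_mul, integral_const_mul,
      integral_add i31 i13, integral_sub j4 j31, integral_sub j4 j22]
    linear_combination a1 + 2 * a2 + 6 * a4 - 8 * a3 - 4 * a5
  have hf1 := memLp_comp_of_deriv_le hf hg1 h1
  have hf2 := memLp_comp_of_deriv_le hf hg1 h2
  have hfW := memLp_comp_of_deriv_le hf hg1 hW4
  have Ef : ∫ p, (p.2 - p.1) * (f p.2 - f p.1) ∂ρ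
      = 2 * ∫ ω, f (W ω) * (W ω - M ω) ∂P := by
    have e1 : ∀ p : ℝ × ℝ, (p.2 - p.1) * (f p.2 - f p.1)
        = (f p.2 * p.2 + f p.1 * p.1) - (f p.1 * p.2 + f p.2 * p.1) := fun p => by ring
    have e2 : ∀ ω, f (W ω) * (W ω - M ω) = f (W ω) * W ω - f (W ω) * M ω := fun ω => by ring
    have a1 : ∫ p, f p.2 * p.2 ∂ρ = ∫ p, f p.1 * p.1 ∂ρ := hswap fun p => f p.1 * p.1
    have a2 := hmarg (fun x => f x * x) (by fun_prop)
    have a3 := hmix f (fun x => x) hfc.measurable measurable_id (integrable_mul_of_four hf1 h2) hWi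
    have a4 : ∫ p, f p.2 * p.1 ∂ρ = ∫ p, f p.1 * p.2 ∂ρ := hswap fun p => f p.1 * p.2
    have b1 : Integrable (fun p : ℝ × ℝ => f p.2 * p.2 + f p.1 * p.1) ρ :=
      (integrable_mul_of_four hf2 h2).add (integrable_mul_of_four hf1 h1)
    have b2 : Integrable (fun p : ℝ × ℝ => f p.1 * p.2 + f p.2 * p.1) ρ :=
      (integrable_mul_of_four hf1 h2).add (integrable_mul_of_four hf2 h1)
    simp only [e1, e2]
    rw [integral_sub b1 b2,
      integral_add (integrable_mul_of_four hf2 h2) (integrable_mul_of_four hf1 h1),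
      integral_add (integrable_mul_of_four hf1 h2) (integrable_mul_of_four hf2 h1),
      integral_sub (integrable_mul_of_four hfW hW4) (integrable_mul_of_four hfW hM4)]
    linear_combination a1 + 2 * a2 - 2 * a3 - a4
  have Eg : ∫ p, g p.1 * (p.2 - p.1) ^ 2 ∂ρ
      = ∫ ω, g (W ω) * (S₂ ω - 2 * W ω * M ω + W ω ^ 2) ∂P := by
    have e1 : ∀ p : ℝ × ℝ, g p.1 * (p.2 - p.1) ^ 2
        = (g p.1 * p.2 ^ 2 + g p.1 * p.1 ^ 2) - 2 * ((g p.1 * p.1) * p.2) := fun p => by ring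
    have e2 : ∀ ω, g (W ω) * (S₂ ω - 2 * W ω * M ω + W ω ^ 2)
        = (g (W ω) * S₂ ω + g (W ω) * W ω ^ 2) - 2 * ((g (W ω) * W ω) * M ω) :=
      fun ω => by ring
    have k1 := integrable_comp_mul hgc hg1 h1 i02
    have k2 := integrable_comp_mul hgc hg1 h1 i20
    have k3 : Integrable (fun p : ℝ × ℝ => (g p.1 * p.1) * p.2) ρ :=
      (integrable_comp_mul hgc hg1 h1 i11).congr (Filter.Eventually.of_forall fun p => by ring)
    have l1 := integrable_comp_mul hgc hg1 hW4 (hS2.integrable (by norm_num))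
    have l2 := integrable_comp_mul hgc hg1 hW4 j2
    have l3 : Integrable (fun ω => (g (W ω) * W ω) * M ω) P :=
      (integrable_comp_mul hgc hg1 hW4 j11).congr (Filter.Eventually.of_forall fun p => by ring)
    have a1 := hmix g (fun x => x ^ 2) hgc.measurable (by fun_prop) k1 j2
    have a2 := hmarg (fun x => g x * x ^ 2) (by fun_prop)
    have a3 := hmix (fun x => g x * x) (fun x => x) (by fun_prop) measurable_id k3 hWi
    simp only [e1, e2]
    rw [integral_sub (f := fun p : ℝ × ℝ => g p.1 * p.2 ^ 2 + g p.1 * p.1 ^ 2) (k1.add k2)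
      (k3.const_mul 2), integral_add k1 k2, integral_const_mul,
      integral_sub (f := fun ω => g (W ω) * S₂ ω + g (W ω) * W ω ^ 2) (l1.add l2)
      (l3.const_mul 2), integral_add l1 l2, integral_const_mul]
    linear_combination a1 + a2 - 2 * a3
  refine ⟨?_, ?_, ?_⟩
  · rw [← E2]; exact integral_nonneg fun p => sq_nonneg _
  · rw [← E4]; exact integral_nonneg fun p => by positivity
  · rw [← E2, ← E4, ← Ef, ← Eg]
    exact abs_stein_pair_le hf hg hg1 hsw h1

end Resampling

section ResamplingCoordinate

/-- The Stein bound for resampling the `i`-th of finitely many independent inputs. -/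
lemma abs_stein_coord_le {Ω : Type*} [mΩ : MeasurableSpace Ω] {P : Measure Ω}
    [IsProbabilityMeasure P] {n : ℕ} {E : Fin n → Type*} [∀ i, MeasurableSpace (E i)]
    {X : ∀ i, Ω → E i} (hX : ∀ i, Measurable (X i)) (hindep : iIndepFun X P)
    {F : (∀ i, E i) → ℝ} (hF : Measurable F) {W : Ω → ℝ} (hW : W = fun ω => F (fun i => X i ω))
    (hW4 : MemLp W 4 P) {f g : ℝ → ℝ} (hf : ∀ x, HasDerivAt f (g x) x)
    (hg : LipschitzWith 2 g) (hg1 : ∀ x, |g x| ≤ 1) (i : Fin n) :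
    0 ≤ 2 * ∫ ω, W ω * (W ω - P[W | coordSigma X (Finset.univ.erase i)] ω) ∂P ∧
    0 ≤ 8 * ∫ ω, W ω ^ 3 * (W ω - P[W | coordSigma X (Finset.univ.erase i)] ω) ∂P
      - 6 * ∫ ω, W ω ^ 2 *
        (W ω ^ 2 - P[fun ω => W ω ^ 2 | coordSigma X (Finset.univ.erase i)] ω) ∂P ∧
    |2 * ∫ ω, f (W ω) * (W ω - P[W | coordSigma X (Finset.univ.erase i)] ω) ∂P
      - ∫ ω, g (W ω) * (P[fun ω => W ω ^ 2 | coordSigma X (Finset.univ.erase i)] ω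
        - 2 * W ω * P[W | coordSigma X (Finset.univ.erase i)] ω + W ω ^ 2) ∂P|
      ≤ √(2 * ∫ ω, W ω * (W ω - P[W | coordSigma X (Finset.univ.erase i)] ω) ∂P) *
        √(8 * ∫ ω, W ω ^ 3 * (W ω - P[W | coordSigma X (Finset.univ.erase i)] ω) ∂P
          - 6 * ∫ ω, W ω ^ 2 *
            (W ω ^ 2 - P[fun ω => W ω ^ 2 | coordSigma X (Finset.univ.erase i)] ω) ∂P) / 2 := by
  have : Nonempty Ω := P.nonempty_of_neZero
  obtain ⟨ω₀⟩ := this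
  -- `U` collects the other coordinates; the unused `i`-th slot is filled with a fixed value
  set U : Ω → ∀ j : (Finset.univ.erase i : Finset (Fin n)), E j := fun ω j => X j ω with hUdef
  have hU : Measurable U := measurable_pi_iff.2 fun j => hX j
  have hm : coordSigma X (Finset.univ.erase i) = MeasurableSpace.comap U inferInstance := by
    rw [MeasurableSpace.comap_process_pi (fun (j : (Finset.univ.erase i : Finset (Fin n))) => X j),
      iSup_subtype]
  have hUV : IndepFun U (X i) P := by
    rw [IndepFun_iff_Indep, ← hm]
    have := indep_coordSigma hX hindep (J := Finset.univ.erase i) (K := {i})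
      (by simp)
    simpa [coordSigma] using this
  have hw : Measurable fun p : (∀ j : (Finset.univ.erase i : Finset (Fin n)), E j) × E i =>
      F (Function.update
        (Function.updateFinset (fun j => X j ω₀) (Finset.univ.erase i) p.1) i p.2) :=
    hF.comp (measurable_update'.comp
      ((measurable_updateFinset.comp measurable_fst).prodMk measurable_snd))
  refine abs_stein_resample_le hU (hX i) hUV hw ?_ hW4 hm hf hg hg1
  rw [hW]
  ext ω
  congr 1
  ext j
  rcases eq_or_ne j i with rfl | h
  · simp
  · simp [h, Function.updateFinset, hUdef]

end ResamplingCoordinate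

/-! ### The number operator of commuting projections -/

section Hilbert

variable {H : Type*} [NormedAddCommGroup H] [InnerProductSpace ℝ H] {ι : Type*} [DecidableEq ι]

open Finset

/-- The Hoeffding decomposition with respect to finitely many commuting projections. -/
lemma exists_hoeffding_sum (e : ι → Module.End ℝ H) (hidem : ∀ i x, e i (e i x) = e i x)
    (hcomm : ∀ i j x, e i (e j x) = e j (e i x)) (S : Finset ι) (y : H) :
    ∃ U : Finset ι → H, y = ∑ M ∈ S.powerset, U M ∧
      (∀ M, ∀ i ∈ S, e i (U M) = if i ∈ M then 0 else U M) ∧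
      ∀ i, e i y = y → ∀ M, e i (U M) = U M := by
  induction S using Finset.induction_on with
  | empty => exact ⟨fun _ => y, by simp, by simp, fun i h _ => h⟩
  | insert a S ha ih =>
    obtain ⟨U, hy, hU, hfix⟩ := ih
    refine ⟨fun M => if a ∈ M then U (M.erase a) - e a (U (M.erase a)) else e a (U M), ?_, ?_, ?_⟩
    · rw [sum_powerset_insert ha, ← sum_add_distrib, hy]
      refine sum_congr rfl fun M hM => ?_
      have haM : a ∉ M := fun h => ha (mem_powerset.1 hM h)
      simp [haM]
    · intro M i hi
      have hi' := mem_insert.1 hi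
      by_cases haM : a ∈ M
      · simp only [haM, if_true, map_sub]
        rcases eq_or_ne i a with rfl | hia
        · simp [hidem, haM]
        · rw [hcomm i a, hU _ i (hi'.resolve_left hia)]
          simp only [mem_erase, hia, ne_eq, not_false_eq_true, true_and]
          split_ifs <;> simp
      · simp only [haM, if_false]
        rcases eq_or_ne i a with rfl | hia
        · simp [hidem, haM]
        · rw [hcomm i a, hU _ i (hi'.resolve_left hia)]
          split_ifs <;> simp
    · intro i hi M
      simp only
      split_ifs
      · rw [map_sub, hcomm i a, hfix i hi]
      · rw [hcomm i a, hfix i hi]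

/-- If `y` is a sum of vectors, each of which involves at most `D` coordinates, then the spectrum of
the number operator `∑ i, (1 - e i)` on `y` lies in `[0, D]`. -/
lemma numberOperator_bounds [Fintype ι] (e : ι → Module.End ℝ H)
    (hidem : ∀ i x, e i (e i x) = e i x) (hcomm : ∀ i j x, e i (e j x) = e j (e i x))
    (hsymm : ∀ i x y, inner ℝ (e i x) y = inner ℝ x (e i y)) {κ : Type*} (s : Finset κ)
    (v : κ → H) (A : κ → Finset ι) {D : ℕ} (hA : ∀ k ∈ s, (A k).card ≤ D)
    (hv : ∀ k ∈ s, ∀ i ∉ A k, e i (v k) = v k) {y : H} (hy : y = ∑ k ∈ s, v k) :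
    0 ≤ inner ℝ y (∑ i, (y - e i y)) ∧
    ‖y - (D : ℝ)⁻¹ • ∑ i, (y - e i y)‖ ^ 2 ≤ ‖y‖ ^ 2 := by
  have hex : ∀ k, ∃ U : Finset ι → H, v k = ∑ M ∈ (A k).powerset, U M ∧
      (∀ M, ∀ i ∈ A k, e i (U M) = if i ∈ M then 0 else U M) ∧
      ∀ i, e i (v k) = v k → ∀ M, e i (U M) = U M :=
    fun k => exists_hoeffding_sum e hidem hcomm (A k) (v k)
  choose U hU1 hU2 hU3 using hex
  set V : Finset ι → H := fun M => ∑ k ∈ s, if M ⊆ A k then U k M else 0 with hV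
  have hyV : y = ∑ M, V M := by
    rw [hy, hV, sum_comm]
    refine sum_congr rfl fun k _ => ?_
    rw [← sum_filter, hU1 k]
    refine sum_congr ?_ fun _ _ => rfl
    ext; simp
  -- hence `V M` is an eigenvector of the number operator with eigenvalue `M.card`
  have heig : ∀ M i, e i (V M) = if i ∈ M then 0 else V M := by
    intro M i
    simp only [hV, map_sum]
    trans ∑ k ∈ s, if i ∈ M then 0 else if M ⊆ A k then U k M else 0
    · refine sum_congr rfl fun k hk => ?_
      by_cases hMk : M ⊆ A k
      · simp only [hMk, if_true]
        by_cases hi : i ∈ A k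
        · exact hU2 k M i hi
        · rw [if_neg fun h => hi (hMk h), hU3 k i (hv k hk i hi)]
      · simp [hMk]
    · split_ifs
      · exact sum_const_zero
      · rfl
  have hzero : ∀ M, D < M.card → V M = 0 := by
    intro M hM
    refine sum_eq_zero fun k hk => if_neg fun h => ?_
    exact absurd (card_le_card h) (by have := hA k hk; omega)
  have horth : ∀ M N, M ≠ N → inner ℝ (V M) (V N) = 0 := by
    have aux : ∀ M N i, i ∈ M → i ∉ N → inner ℝ (V M) (V N) = 0 := by
      intro M N i hM hN
      have h1 := hsymm i (V M) (V N)
      rw [heig, heig, if_pos hM, if_neg hN, inner_zero_left] at h1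
      exact h1.symm
    intro M N hMN
    by_cases h : M ⊆ N
    · obtain ⟨i, hi, hi'⟩ := not_subset.1 fun h' => hMN (Subset.antisymm h h')
      rw [real_inner_comm]
      exact aux N M i hi hi'
    · obtain ⟨i, hi, hi'⟩ := not_subset.1 h
      exact aux M N i hi hi'
  have hinner : ∀ a b : Finset ι → ℝ, inner ℝ (∑ M, a M • V M) (∑ M, b M • V M)
      = ∑ M, a M * b M * ‖V M‖ ^ 2 := by
    intro a b
    rw [sum_inner]
    refine sum_congr rfl fun M _ => ?_
    rw [inner_sum, sum_eq_single M]
    · rw [inner_smul_left, inner_smul_right, real_inner_self_eq_norm_sq]; simp; ring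
    · intro N _ hN
      rw [inner_smul_left, inner_smul_right, horth M N hN.symm]; simp
    · simp
  have hL : ∑ i, (y - e i y) = ∑ M, (M.card : ℝ) • V M := by
    rw [hyV]
    simp only [map_sum, ← sum_sub_distrib]
    rw [sum_comm]
    refine sum_congr rfl fun M _ => ?_
    have : ∀ i, V M - e i (V M) = if i ∈ M then V M else 0 := by
      intro i; rw [heig]; split_ifs <;> simp
    simp only [this]
    rw [sum_ite_mem, univ_inter, sum_const, Nat.cast_smul_eq_nsmul]
  have hy1 : y = ∑ M, (1 : ℝ) • V M := by simpa using hyV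
  constructor
  · rw [hL]
    conv_rhs => rw [hy1]
    rw [hinner]
    exact sum_nonneg fun M _ => by positivity
  · have h1 : y - (D : ℝ)⁻¹ • ∑ i, (y - e i y) = ∑ M, (1 - (D : ℝ)⁻¹ * M.card) • V M := by
      rw [hL, smul_sum]
      conv_lhs => rw [hy1]
      rw [← sum_sub_distrib]
      exact sum_congr rfl fun M _ => by rw [sub_smul, smul_smul]
    rw [← real_inner_self_eq_norm_sq, ← real_inner_self_eq_norm_sq, h1, hinner]
    conv_rhs => rw [hy1]
    rw [hinner]
    refine sum_le_sum fun M _ => ?_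
    rcases lt_or_ge D M.card with h | h
    · rw [hzero M h]; simp
    · have h2 : 0 ≤ (D : ℝ)⁻¹ * M.card := by positivity
      have h3 : (D : ℝ)⁻¹ * M.card ≤ 1 := by
        rw [inv_mul_eq_div]
        exact div_le_one_of_le₀ (by exact_mod_cast h) (by positivity)
      exact mul_le_mul_of_nonneg_right (by nlinarith) (by positivity)

end Hilbert

/-! ### Block decomposition of pairs of splittings -/

section Combinatorics

open Finset

variable {α : Type*} [Fintype α] [DecidableEq α]

/-- Two splittings `J ⊔ K = J' ⊔ K'` of the same set are parametrised by the four pairwise disjoint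
blocks `A = J ∩ J'`, `B = J ∩ K'`, `C = K ∩ J'`, `D = K ∩ K'`. -/
lemma sum_splittings_eq_sum_blocks (m : Finset α → Finset α → Finset α → Finset α → ℝ) :
    ∑ p : Finset α × Finset α with Disjoint p.1 p.2,
      ∑ q : Finset α × Finset α with Disjoint q.1 q.2 ∧ p.1 ∪ p.2 = q.1 ∪ q.2,
        m p.1 p.2 q.1 q.2
    = ∑ a : Finset α × Finset α with Disjoint a.1 a.2,
      ∑ b : Finset α × Finset α with Disjoint b.1 b.2 ∧ Disjoint b.1 (a.1 ∪ a.2) ∧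
        Disjoint b.2 (a.1 ∪ a.2),
        m (a.1 ∪ b.1) (b.2 ∪ a.2) (a.1 ∪ b.2) (b.1 ∪ a.2) := by
  rw [sum_sigma', sum_sigma']
  refine sum_nbij'
    (fun x => ⟨(x.1.1 ∩ x.2.1, x.1.2 ∩ x.2.2), (x.1.1 \ x.2.1, x.2.1 \ x.1.1)⟩)
    (fun x => ⟨(x.1.1 ∪ x.2.1, x.2.2 ∪ x.1.2), (x.1.1 ∪ x.2.2, x.2.1 ∪ x.1.2)⟩) ?_ ?_ ?_ ?_ ?_
  · rintro ⟨⟨J, K⟩, ⟨J', K'⟩⟩ h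
    simp only [mem_sigma, mem_filter, mem_univ, true_and, disjoint_left, Finset.ext_iff, mem_union,
      mem_inter, mem_sdiff] at h ⊢
    grind
  · rintro ⟨⟨A, D⟩, ⟨B, C⟩⟩ h
    simp only [mem_sigma, mem_filter, mem_univ, true_and, disjoint_left, Finset.ext_iff, mem_union]
      at h ⊢
    grind
  · rintro ⟨⟨J, K⟩, ⟨J', K'⟩⟩ h
    simp only [mem_sigma, mem_filter, mem_univ, true_and, disjoint_left, Finset.ext_iff,
      mem_union] at h
    simp only [Sigma.mk.injEq, Prod.mk.injEq, heq_eq_eq, Finset.ext_iff, mem_union, mem_inter,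
      mem_sdiff]
    grind
  · rintro ⟨⟨A, D⟩, ⟨B, C⟩⟩ h
    simp only [mem_sigma, mem_filter, mem_univ, true_and, disjoint_left, mem_union] at h
    simp only [Sigma.mk.injEq, Prod.mk.injEq, heq_eq_eq, Finset.ext_iff, mem_union, mem_inter,
      mem_sdiff]
    grind
  · rintro ⟨⟨J, K⟩, ⟨J', K'⟩⟩ h
    simp only [mem_sigma, mem_filter, mem_univ, true_and, disjoint_left, Finset.ext_iff,
      mem_union] at h
    have e1 : J ∩ J' ∪ J \ J' = J := by grind
    have e2 : J' \ J ∪ K ∩ K' = K := by grind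
    have e3 : J ∩ J' ∪ J' \ J = J' := by grind
    have e4 : J \ J' ∪ K ∩ K' = K' := by grind
    simp only [e1, e2, e3, e4]

/-- The number of pairs of nonempty subsets of equal size of two sets with at most `k` elements. -/
lemma card_equal_size_pairs_le {k : ℕ} {S T : Finset α} (hS : S.card ≤ k) (hT : T.card ≤ k) :
    #{a : Finset α × Finset α | a.1 ⊆ S ∧ a.2 ⊆ T ∧ a.1.Nonempty ∧ a.1.card = a.2.card}
      ≤ ∑ j ∈ Icc 1 k, k.choose j ^ 2 := by
  calc _ ≤ #((Icc 1 k).biUnion fun j => powersetCard j S ×ˢ powersetCard j T) := by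
        refine card_le_card fun a ha => ?_
        simp only [mem_filter, mem_univ, true_and] at ha
        simp only [mem_biUnion, mem_Icc, mem_product, mem_powersetCard]
        exact ⟨a.1.card, ⟨ha.2.2.1.card_pos, (card_le_card ha.1).trans hS⟩, ⟨ha.1, rfl⟩,
          ha.2.1, ha.2.2.2.symm⟩
    _ ≤ ∑ j ∈ Icc 1 k, #(powersetCard j S ×ˢ powersetCard j T) := card_biUnion_le
    _ ≤ _ := by
        refine sum_le_sum fun j _ => ?_
        rw [card_product, card_powersetCard, card_powersetCard, sq]
        exact Nat.mul_le_mul (Nat.choose_le_choose _ hS) (Nat.choose_le_choose _ hT)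

/-- The total weight of the quadruples with overlapping blocks `B`, `C`: the pair
`(J, K) = (A ∪ B, C ∪ D)` determines the quadruple up to the choice of subsets `A ⊆ J \ K` and
`D ⊆ K \ J` of equal size. -/
lemma sum_overlapping_blocks_le {d : ℕ} {s : Finset α → ℝ} (hs : ∀ J, 0 ≤ s J)
    (hsd : ∀ J, J.card ≠ d → s J = 0) :
    ∑ a : Finset α × Finset α with Disjoint a.1 a.2 ∧ a.1.Nonempty ∧ a.1.card = a.2.card,
      ∑ b : Finset α × Finset α with ¬ Disjoint b.1 b.2 ∧ Disjoint b.1 (a.1 ∪ a.2) ∧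
        Disjoint b.2 (a.1 ∪ a.2), s (a.1 ∪ b.1) * s (b.2 ∪ a.2)
    ≤ ((∑ j ∈ Icc 1 (d - 1), (d - 1).choose j ^ 2 : ℕ) : ℝ) *
      ∑ p : Finset α × Finset α with ¬ Disjoint p.1 p.2, s p.1 * s p.2 := by
  have step : ∀ a : Finset α × Finset α, Disjoint a.1 a.2 →
      ∑ b : Finset α × Finset α with ¬ Disjoint b.1 b.2 ∧ Disjoint b.1 (a.1 ∪ a.2) ∧
        Disjoint b.2 (a.1 ∪ a.2), s (a.1 ∪ b.1) * s (b.2 ∪ a.2)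
      = ∑ p : Finset α × Finset α with ¬ Disjoint p.1 p.2 ∧ (a.1 ⊆ p.1 \ p.2 ∧ a.2 ⊆ p.2 \ p.1),
          s p.1 * s p.2 := by
    rintro ⟨A, D⟩ hAD
    refine sum_nbij' (fun b => (A ∪ b.1, b.2 ∪ D)) (fun p => (p.1 \ A, p.2 \ D)) ?_ ?_ ?_ ?_ ?_
    · rintro ⟨B, C⟩ h
      simp only [mem_filter, mem_univ, true_and, disjoint_left, mem_union, subset_iff, mem_sdiff]
        at h hAD ⊢
      grind
    · rintro ⟨J, K⟩ h
      simp only [mem_filter, mem_univ, true_and, disjoint_left, mem_union, subset_iff, mem_sdiff]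
        at h hAD ⊢
      grind
    · rintro ⟨B, C⟩ h
      simp only [mem_filter, mem_univ, true_and, disjoint_left, mem_union] at h hAD
      simp only [Prod.mk.injEq, Finset.ext_iff, mem_union, mem_sdiff]
      grind
    · rintro ⟨J, K⟩ h
      simp only [mem_filter, mem_univ, true_and, disjoint_left, subset_iff, mem_sdiff]
        at h hAD
      simp only [Prod.mk.injEq, Finset.ext_iff, mem_union, mem_sdiff]
      grind
    · rintro ⟨B, C⟩ _
      rfl
  calc _ = ∑ a : Finset α × Finset α with Disjoint a.1 a.2 ∧ a.1.Nonempty ∧ a.1.card = a.2.card,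
        ∑ p : Finset α × Finset α with ¬ Disjoint p.1 p.2,
          if a.1 ⊆ p.1 \ p.2 ∧ a.2 ⊆ p.2 \ p.1 then s p.1 * s p.2 else 0 := by
        refine sum_congr rfl fun a ha => ?_
        rw [step a (mem_filter.1 ha).2.1, ← sum_filter, filter_filter]
    _ = ∑ p : Finset α × Finset α with ¬ Disjoint p.1 p.2,
        ∑ a : Finset α × Finset α with Disjoint a.1 a.2 ∧ a.1.Nonempty ∧ a.1.card = a.2.card,
          if a.1 ⊆ p.1 \ p.2 ∧ a.2 ⊆ p.2 \ p.1 then s p.1 * s p.2 else 0 := sum_comm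
    _ ≤ ∑ p : Finset α × Finset α with ¬ Disjoint p.1 p.2,
        ((∑ j ∈ Icc 1 (d - 1), (d - 1).choose j ^ 2 : ℕ) : ℝ) * (s p.1 * s p.2) := by
        refine sum_le_sum fun p hp => ?_
        rw [← sum_filter, sum_const, nsmul_eq_mul]
        by_cases h : p.1.card = d ∧ p.2.card = d
        · refine mul_le_mul_of_nonneg_right ?_ (mul_nonneg (hs _) (hs _))
          have hpos : 0 < (p.1 ∩ p.2).card :=
            card_pos.2 (not_disjoint_iff_nonempty_inter.1 (mem_filter.1 hp).2)
          have h1 := card_sdiff_add_card_inter p.1 p.2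
          have h2 := card_sdiff_add_card_inter p.2 p.1
          rw [inter_comm p.2] at h2
          refine Nat.cast_le.2 ((card_le_card fun a ha => ?_).trans
            (card_equal_size_pairs_le (S := p.1 \ p.2) (T := p.2 \ p.1) (k := d - 1)
              (by omega) (by omega)))
          simp only [mem_filter, mem_univ, true_and] at ha ⊢
          exact ⟨ha.2.1, ha.2.2, ha.1.2.1, ha.1.2.2⟩
        · have : s p.1 * s p.2 = 0 := by
            rcases not_and_or.1 h with h | h
            · rw [hsd _ h, zero_mul]
            · rw [hsd _ h, mul_zero]
          rw [this, mul_zero, mul_zero]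
    _ = _ := (mul_sum _ _ _).symm

/-- Overlapping pairs share an index, so their total weight is bounded by the maximal influence. -/
lemma sum_not_disjoint_le {d : ℕ} {s : Finset α → ℝ} (hs : ∀ J, 0 ≤ s J)
    (hsd : ∀ J, J.card ≠ d → s J = 0) {r : ℝ}
    (hr : ∀ i, ∑ K : Finset α with i ∈ K, s K ≤ r) :
    ∑ p : Finset α × Finset α with ¬ Disjoint p.1 p.2, s p.1 * s p.2 ≤ d * r * ∑ J, s J := by
  rw [sum_filter, Fintype.sum_prod_type, mul_sum]
  refine sum_le_sum fun J _ => ?_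
  by_cases hJ : J.card = d
  · calc _ ≤ ∑ K : Finset α, ∑ i ∈ J, if i ∈ K then s J * s K else 0 := by
          refine sum_le_sum fun K _ => ?_
          have hnn : ∀ i ∈ J, 0 ≤ if i ∈ K then s J * s K else 0 := fun i _ => by
            split_ifs
            exacts [mul_nonneg (hs J) (hs K), le_rfl]
          by_cases h : Disjoint J K
          · rw [if_neg (not_not.2 h)]
            exact sum_nonneg hnn
          · rw [if_pos h]
            obtain ⟨i, hi, hiK⟩ := not_disjoint_iff.1 h
            have := single_le_sum hnn hi
            rwa [if_pos hiK] at this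
      _ = ∑ i ∈ J, s J * ∑ K : Finset α with i ∈ K, s K := by
          rw [sum_comm]
          refine sum_congr rfl fun i _ => ?_
          rw [mul_sum, sum_filter]
      _ ≤ ∑ i ∈ J, s J * r :=
          sum_le_sum fun i _ => mul_le_mul_of_nonneg_left (hr i) (hs J)
      _ = d * r * s J := by rw [sum_const, hJ, nsmul_eq_mul]; ring
  · simp [hsd J hJ]

end Combinatorics

/-! ### A lower bound for the combinatorial constant -/

section ShadowConstant

open Finset

/-- Two equivalent shadows have stabilisers of the same size; this is the inequality needed here. -/
lemma stabCard_le_of_perm {r : ℕ} {F G : Fin 4 → Finset (Fin r)} (t : Equiv.Perm (Fin r))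
    (h : ∀ l, G l = (F l).map t.toEmbedding) : stabCard G ≤ stabCard F := by
  refine card_le_card_of_injOn (fun s => (t.trans s).trans t.symm) ?_ ?_
  · intro s hs
    simp only [coe_filter, mem_univ, true_and, Set.mem_ofPred_eq] at hs ⊢
    intro l
    have h1 := hs l
    rw [h l, map_map] at h1
    ext a
    have h2 := Finset.ext_iff.1 h1 (t a)
    simp only [mem_map, Equiv.coe_toEmbedding, Function.Embedding.trans_apply, Equiv.trans_apply,
      EmbeddingLike.apply_eq_iff_eq, exists_eq_right, Equiv.symm_apply_eq] at h2 ⊢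
    exact h2
  · intro s _ s' _ hss
    ext a
    have := congrArg (fun u : Equiv.Perm (Fin r) => t (u (t.symm a))) hss
    simpa using congrArg Fin.val this

/-- The shadow on `2d - 1` points whose blocks `F₀ ∩ F₂`, `F₀ ∩ F₃`, `F₁ ∩ F₂`, `F₁ ∩ F₃` have sizes
`a`, `d - 1 - a`, `d - 1 - a`, `a` and are otherwise disjoint up to one point, the last one, that
lies in all four sets. -/
def pivotShadow (d a : ℕ) : Fin 4 → Finset (Fin (2 * d - 1)) :=
  ![univ.filter fun k => k.1 < d - 1 ∨ k.1 = 2 * d - 2,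
    univ.filter fun k => d - 1 ≤ k.1,
    univ.filter fun k => k.1 < a ∨ d - 1 + a ≤ k.1,
    univ.filter fun k => (a ≤ k.1 ∧ k.1 < d - 1 + a) ∨ k.1 = 2 * d - 2]

lemma card_filter_fin (N : ℕ) (p : ℕ → Prop) [DecidablePred p] :
    #{k : Fin N | p k.1} = #{k ∈ range N | p k} := by
  rw [← card_map Fin.valEmbedding]
  congr 1
  ext k
  simp only [mem_map, mem_filter, mem_univ, true_and, Fin.valEmbedding_apply, mem_range]
  exact ⟨fun ⟨x, hx, h⟩ => h ▸ ⟨x.2, hx⟩, fun ⟨h, hp⟩ => ⟨⟨k, h⟩, hp, rfl⟩⟩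

lemma card_filter_fin_of_Ico_union {N : ℕ} {p : ℕ → Prop} [DecidablePred p] {a b c e : ℕ}
    (h : ∀ k, (k < N ∧ p k) ↔ (a ≤ k ∧ k < b) ∨ (c ≤ k ∧ k < e)) (hbc : b ≤ c) :
    #{k : Fin N | p k.1} = (b - a) + (e - c) := by
  rw [card_filter_fin]
  have : (range N).filter p = Ico a b ∪ Ico c e := by
    ext k
    simp only [mem_filter, mem_range, mem_union, mem_Ico]
    exact h k
  rw [this, card_union_of_disjoint, Nat.card_Ico, Nat.card_Ico]
  rw [disjoint_left]
  intro k hk hk'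
  simp only [mem_Ico] at hk hk'
  omega

lemma card_pivotShadow {d a : ℕ} (hd : 1 ≤ d) (ha : a ≤ d - 1) (l : Fin 4) :
    (pivotShadow d a l).card = d := by
  fin_cases l
  · exact (card_filter_fin_of_Ico_union (p := fun k => k < d - 1 ∨ k = 2 * d - 2) (a := 0)
      (b := d - 1) (c := 2 * d - 2) (e := 2 * d - 1) (fun k => by omega) (by omega)).trans
      (by omega)
  · exact (card_filter_fin_of_Ico_union (p := fun k => d - 1 ≤ k) (a := 0) (b := 0) (c := d - 1)
      (e := 2 * d - 1) (fun k => by omega) (by omega)).trans (by omega)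
  · exact (card_filter_fin_of_Ico_union (p := fun k => k < a ∨ d - 1 + a ≤ k) (a := 0) (b := a)
      (c := d - 1 + a) (e := 2 * d - 1) (fun k => by omega) (by omega)).trans (by omega)
  · exact (card_filter_fin_of_Ico_union (p := fun k => (a ≤ k ∧ k < d - 1 + a) ∨ k = 2 * d - 2)
      (a := a) (b := d - 1 + a) (c := 2 * d - 2) (e := 2 * d - 1) (fun k => by omega)
      (by omega)).trans (by omega)

lemma mem_pivotShadow {d a : ℕ} (k : Fin (2 * d - 1)) :
    (k ∈ pivotShadow d a 0 ↔ k.1 < d - 1 ∨ k.1 = 2 * d - 2) ∧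
    (k ∈ pivotShadow d a 1 ↔ d - 1 ≤ k.1) ∧
    (k ∈ pivotShadow d a 2 ↔ k.1 < a ∨ d - 1 + a ≤ k.1) ∧
    (k ∈ pivotShadow d a 3 ↔ (a ≤ k.1 ∧ k.1 < d - 1 + a) ∨ k.1 = 2 * d - 2) := by
  simp [pivotShadow]

/-- No index of `pivotShadow` is free. -/
lemma exists_two_mem_pivotShadow {d a : ℕ} (ha : a ≤ d - 1) (k : Fin (2 * d - 1)) :
    ∃ l l', l ≠ l' ∧ k ∈ pivotShadow d a l ∧ k ∈ pivotShadow d a l' := by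
  obtain ⟨h0, h1, h2, h3⟩ := mem_pivotShadow (d := d) (a := a) k
  rcases lt_or_ge k.1 (d - 1) with hk | hk
  · rcases lt_or_ge k.1 a with hk' | hk'
    · exact ⟨0, 2, by decide, h0.2 (by omega), h2.2 (by omega)⟩
    · exact ⟨0, 3, by decide, h0.2 (by omega), h3.2 (by omega)⟩
  · rcases lt_or_ge k.1 (d - 1 + a) with hk' | hk'
    · exact ⟨1, 3, by decide, h1.2 (by omega), h3.2 (by omega)⟩
    · exact ⟨1, 2, by decide, h1.2 (by omega), h2.2 (by omega)⟩

lemma isShadow_pivotShadow {d a : ℕ} (hd : 1 ≤ d) (ha : a ≤ d - 1) :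
    IsShadow d (2 * d - 1) (pivotShadow d a) where
  le_size := by omega
  size_lt := by omega
  card_eq := card_pivotShadow hd ha
  union_eq k := by
    obtain ⟨l, _, _, h, _⟩ := exists_two_mem_pivotShadow ha k
    exact ⟨l, h⟩

lemma isTQuadruple_pivotShadow {d a : ℕ} (hd : 1 ≤ d) (ha : a ≤ d - 1) :
    IsTQuadruple d (pivotShadow d a) where
  card_eq := card_pivotShadow hd ha
  not_bifold h := by
    -- the last point lies in all four sets
    obtain ⟨h0, h1, h2, h3⟩ := mem_pivotShadow (d := d) (a := a) ⟨2 * d - 2, by omega⟩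
    have hall : ∀ l, (⟨2 * d - 2, by omega⟩ : Fin (2 * d - 1)) ∈ pivotShadow d a l := by
      intro l
      fin_cases l
      exacts [h0.2 (by simp), h1.2 (by simp; omega), h2.2 (by simp; omega), h3.2 (by simp)]
    have := h _ ⟨0, hall 0⟩
    simp [multiplicity4, hall] at this
  not_free := by
    rintro ⟨k, hk⟩
    obtain ⟨l, l', hll, h, h'⟩ := exists_two_mem_pivotShadow ha k
    have : 1 < multiplicity4 (pivotShadow d a) k :=
      one_lt_card.2 ⟨l, by simp [h], l', by simp [h'], hll⟩
    omega

/-- The block of `pivotShadow d a` that contains a given point. -/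
def pivotBlock (d a : ℕ) (k : Fin (2 * d - 1)) : Fin 5 :=
  if k.1 < a then 0 else if k.1 < d - 1 then 1 else if k.1 < d - 1 + a then 2
    else if k.1 < 2 * d - 2 then 3 else 4

lemma stabCard_pivotShadow_le {d a : ℕ} (hd : 1 ≤ d) (ha : a ≤ d - 1) :
    stabCard (pivotShadow d a) ≤ (a.factorial * (d - 1 - a).factorial) ^ 2 := by
  have hfib : ∀ i : Fin 5, Fintype.card {k // pivotBlock d a k = i}
      = ![a, d - 1 - a, a, d - 1 - a, 1] i := by
    intro i
    rw [Fintype.card_subtype]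
    have hb : ∀ k : Fin (2 * d - 1), pivotBlock d a k = i ↔
        (![0, a, d - 1, d - 1 + a, 2 * d - 2] i ≤ k.1 ∧
          k.1 < ![a, d - 1, d - 1 + a, 2 * d - 2, 2 * d - 1] i) := by
      intro k
      have := k.2
      unfold pivotBlock
      fin_cases i <;> simp <;> split_ifs <;> simp <;> omega
    simp only [hb]
    refine (card_filter_fin_of_Ico_union
      (p := fun k => ![0, a, d - 1, d - 1 + a, 2 * d - 2] i ≤ k ∧
          k < ![a, d - 1, d - 1 + a, 2 * d - 2, 2 * d - 1] i)
      (a := ![0, a, d - 1, d - 1 + a, 2 * d - 2] i)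
      (b := ![a, d - 1, d - 1 + a, 2 * d - 2, 2 * d - 1] i) (c := 2 * d - 1) (e := 2 * d - 1)
      (fun k => ?_) ?_).trans ?_ <;> fin_cases i <;> simp <;> omega
  have hcard := DomMulAct.stabilizer_card (pivotBlock d a)
  simp only [hfib, Fin.prod_univ_five] at hcard
  calc stabCard (pivotShadow d a)
      ≤ Fintype.card {g : Equiv.Perm (Fin (2 * d - 1)) // pivotBlock d a ∘ g = pivotBlock d a} := by
        rw [Fintype.card_subtype]
        refine card_le_card fun s hs => ?_
        simp only [mem_filter, mem_univ, true_and] at hs ⊢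
        ext k
        have hmem : ∀ l, s k ∈ pivotShadow d a l ↔ k ∈ pivotShadow d a l := by
          intro l
          conv_lhs => rw [← hs l]
          simp
        obtain ⟨h0, h1, h2, h3⟩ := mem_pivotShadow (d := d) (a := a) k
        obtain ⟨g0, g1, g2, g3⟩ := mem_pivotShadow (d := d) (a := a) (s k)
        rw [hmem, h0] at g0
        rw [hmem, h1] at g1
        rw [hmem, h2] at g2
        rw [hmem, h3] at g3
        have := k.2
        have := (s k).2
        simp only [Function.comp_apply]
        congr 1
        unfold pivotBlock
        clear h0 h1 h2 h3 hmem hs hcard hfib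
        split_ifs <;> first | rfl | omega
    _ = _ := by rw [hcard]; simp; ring

lemma card_pivotShadow_inter {d a : ℕ} (ha : a ≤ d - 1) (hd : 1 ≤ d) :
    (pivotShadow d a 0 ∩ pivotShadow d a 2).card = a + 1 := by
  have : pivotShadow d a 0 ∩ pivotShadow d a 2
      = univ.filter fun k : Fin (2 * d - 1) => k.1 < a ∨ k.1 = 2 * d - 2 := by
    ext k
    obtain ⟨h0, -, h2, -⟩ := mem_pivotShadow (d := d) (a := a) k
    rw [mem_inter, h0, h2]
    simp only [mem_filter, mem_univ, true_and]
    omega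
  rw [this]
  refine (card_filter_fin_of_Ico_union (p := fun k => k < a ∨ k = 2 * d - 2) (a := 0) (b := a)
    (c := 2 * d - 2) (e := 2 * d - 1) (fun k => ?_) ?_).trans ?_ <;> omega

/-- `pivotShadow d a` as an element of `TShadow`: it is induced by itself. -/
def pivotTShadow {d a : ℕ} (hd : 1 ≤ d) (ha : a ≤ d - 1) : TShadow d (2 * d - 1) :=
  ⟨pivotShadow d a, isShadow_pivotShadow hd ha, 2 * d - 1, pivotShadow d a,
    isTQuadruple_pivotShadow hd ha, (OrderIso.refl _).toOrderEmbedding, fun i => by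
      obtain ⟨l, _, _, h, _⟩ := exists_two_mem_pivotShadow ha i
      simpa using ⟨l, h⟩, fun l k => by simp⟩

/-- The shadows `pivotShadow d a`, `1 ≤ a ≤ d - 1`, are pairwise inequivalent, since `F₀ ∩ F₂` has
`a + 1` elements, and have at most `a!² (d - 1 - a)!²` automorphisms. -/
lemma le_constC {d : ℕ} (hd : 1 ≤ d) :
    d * ((∑ j ∈ Icc 1 (d - 1), (d - 1).choose j ^ 2 : ℕ) : ℝ) ≤ constC d := by
  have hnn : ∀ r, 0 ≤ ∑ c : Quotient (shadowSetoid d r), ((stabCard c.out.1 : ℕ) : ℝ)⁻¹ :=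
    fun r => sum_nonneg fun c _ => by positivity
  set q : {a // a ∈ Icc 1 (d - 1)} → Quotient (shadowSetoid d (2 * d - 1)) := fun a =>
    Quotient.mk _ (pivotTShadow hd (mem_Icc.1 a.2).2) with hq
  have hqinj : Function.Injective q := by
    intro a b hab
    obtain ⟨s, hs⟩ := Quotient.exact hab
    have h0 := hs 0
    have h2 := hs 2
    simp only [pivotTShadow] at h0 h2
    have h1 := card_pivotShadow_inter (mem_Icc.1 b.2).2 hd
    rw [h0, h2, ← map_inter, card_map, card_pivotShadow_inter (mem_Icc.1 a.2).2 hd] at h1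
    exact Subtype.ext (by omega)
  have hout : ∀ a, stabCard (q a).out.1 ≤ (a.1.factorial * (d - 1 - a.1).factorial) ^ 2 := by
    intro a
    refine le_trans ?_ (stabCard_pivotShadow_le hd (mem_Icc.1 a.2).2)
    obtain ⟨t, ht⟩ := Setoid.symm (Quotient.mk_out (s := shadowSetoid d (2 * d - 1))
      (pivotTShadow hd (mem_Icc.1 a.2).2))
    exact stabCard_le_of_perm t ht
  have hpos : ∀ {r : ℕ} (F : Fin 4 → Finset (Fin r)), 0 < stabCard F := fun F =>
    card_pos.2 ⟨Equiv.refl _, by simp⟩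
  unfold constC
  classical
  calc (d : ℝ) * ((∑ j ∈ Icc 1 (d - 1), (d - 1).choose j ^ 2 : ℕ) : ℝ)
      = (d.factorial : ℝ) * ((d - 1).factorial : ℝ) * ∑ a : {a // a ∈ Icc 1 (d - 1)},
          (((a.1.factorial * (d - 1 - a.1).factorial) ^ 2 : ℕ) : ℝ)⁻¹ := by
        rw [sum_coe_sort (Icc 1 (d - 1))
          (fun a => (((a.factorial * (d - 1 - a).factorial) ^ 2 : ℕ) : ℝ)⁻¹), Nat.cast_sum,
          mul_sum, mul_sum]
        refine sum_congr rfl fun a ha => ?_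
        have h1 := Nat.choose_mul_factorial_mul_factorial (mem_Icc.1 ha).2
        have h2 : d.factorial = d * (d - 1).factorial := (Nat.mul_factorial_pred (by omega)).symm
        have h3 : (a.factorial : ℝ) ≠ 0 := by positivity
        -- `d! (d-1)! / (a! (d-1-a)!)² = d * choose (d-1) a ^ 2`
        have h4 : ((d - 1 - a).factorial : ℝ) ≠ 0 := by positivity
        rw [h2, ← h1]
        push_cast
        field_simp
    _ ≤ (d.factorial : ℝ) * ((d - 1).factorial : ℝ) * ∑ a : {a // a ∈ Icc 1 (d - 1)},
          ((stabCard (q a).out.1 : ℕ) : ℝ)⁻¹ := by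
        refine mul_le_mul_of_nonneg_left (sum_le_sum fun a _ => ?_) (by positivity)
        exact inv_anti₀ (Nat.cast_pos.2 (hpos _)) (Nat.cast_le.2 (hout a))
    _ ≤ (d.factorial : ℝ) * ((d - 1).factorial : ℝ) *
          ∑ c : Quotient (shadowSetoid d (2 * d - 1)), ((stabCard c.out.1 : ℕ) : ℝ)⁻¹ := by
        refine mul_le_mul_of_nonneg_left ?_ (by positivity)
        rw [← sum_image (f := fun c : Quotient (shadowSetoid d (2 * d - 1)) =>
          ((stabCard c.out.1 : ℕ) : ℝ)⁻¹) (g := q) (s := univ) hqinj.injOn]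
        exact sum_le_sum_of_subset_of_nonneg (subset_univ _) fun c _ _ => by positivity
    _ ≤ _ := by
        refine mul_le_mul_of_nonneg_left ?_ (by positivity)
        exact single_le_sum (fun r _ => hnn r) (mem_Icc.2 ⟨by omega, le_rfl⟩)

end ShadowConstant

/-! ### The number operator on square-integrable variables -/

section NumberOperator

open Finset Filter

variable {Ω : Type*} {m : MeasurableSpace Ω} [mΩ : MeasurableSpace Ω] {P : Measure Ω}
  [IsProbabilityMeasure P]

/-- Conditional expectation is self-adjoint on `L²`. -/
lemma integral_condExp_mul_comm (hm : m ≤ mΩ) {F G : Ω → ℝ} (hF : MemLp F 2 P)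
    (hG : MemLp G 2 P) : ∫ ω, P[F | m] ω * G ω ∂P = ∫ ω, F ω * P[G | m] ω ∂P := by
  have hF' := hF.condExp (m := m) one_le_two
  have hG' := hG.condExp (m := m) one_le_two
  have h1 := integral_mul_condExp hm (stronglyMeasurable_condExp (f := F) (m := m) (μ := P))
    (hG.integrable one_le_two) (hF'.integrable_mul hG)
  have h2 := integral_mul_condExp hm (stronglyMeasurable_condExp (f := G) (m := m) (μ := P))
    (hF.integrable one_le_two) (hG'.integrable_mul hF)
  rw [← h1]
  simp only [mul_comm] at h2 ⊢
  exact h2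

/-- Conditional expectation as a linear endomorphism of `L²`. -/
noncomputable def condExpEnd (P : Measure Ω) [IsProbabilityMeasure P] (m : MeasurableSpace Ω) :
    Module.End ℝ (Lp ℝ 2 P) where
  toFun f := ((Lp.memLp f).condExp (m := m) one_le_two).toLp _
  map_add' f g := by
    rw [← MemLp.toLp_add]
    refine MemLp.toLp_congr _ _ ((condExp_congr_ae (Lp.coeFn_add f g)).trans ?_)
    exact condExp_add ((Lp.memLp f).integrable one_le_two) ((Lp.memLp g).integrable one_le_two) m
  map_smul' c f := by
    rw [RingHom.id_apply, ← MemLp.toLp_const_smul]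
    exact MemLp.toLp_congr _ _ ((condExp_congr_ae (Lp.coeFn_smul c f)).trans (condExp_smul c _ m))

lemma condExpEnd_toLp {F : Ω → ℝ} (hF : MemLp F 2 P) :
    condExpEnd P m (hF.toLp F) = (hF.condExp (m := m) one_le_two).toLp _ :=
  MemLp.toLp_congr (hf := (Lp.memLp (hF.toLp F)).condExp one_le_two) _
    (condExp_congr_ae hF.coeFn_toLp)

omit [IsProbabilityMeasure P] in
lemma inner_toLp {F G : Ω → ℝ} (hF : MemLp F 2 P) (hG : MemLp G 2 P) :
    inner ℝ (hF.toLp F) (hG.toLp G) = ∫ ω, F ω * G ω ∂P := by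
  rw [L2.inner_def]
  refine integral_congr_ae ?_
  filter_upwards [hF.coeFn_toLp, hG.coeFn_toLp] with ω h1 h2
  rw [h1, h2]
  simp [mul_comm]

omit [IsProbabilityMeasure P] in
lemma norm_sq_toLp {F : Ω → ℝ} (hF : MemLp F 2 P) :
    ‖hF.toLp F‖ ^ 2 = ∫ ω, F ω ^ 2 ∂P := by
  rw [← real_inner_self_eq_norm_sq, inner_toLp]
  simp only [sq]

omit [IsProbabilityMeasure P] in
lemma exists_toLp (f : Lp ℝ 2 P) : ∃ (F : Ω → ℝ) (hF : MemLp F 2 P), f = hF.toLp F :=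
  ⟨f, Lp.memLp f, (Lp.toLp_coeFn f _).symm⟩

omit [IsProbabilityMeasure P] in
lemma toLp_finsetSum {κ : Type*} (s : Finset κ) {v : κ → Ω → ℝ} (hv : ∀ k, MemLp (v k) 2 P)
    (hs : MemLp (fun ω => ∑ k ∈ s, v k ω) 2 P) :
    hs.toLp _ = ∑ k ∈ s, (hv k).toLp (v k) := by
  ext1
  refine hs.coeFn_toLp.trans (EventuallyEq.trans ?_ (Lp.coeFn_finsetSum _ _).symm)
  have : ∀ᵐ ω ∂P, ∀ k ∈ s, (hv k).toLp (v k) ω = v k ω := by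
    rw [Finset.eventually_all]
    exact fun k _ => (hv k).coeFn_toLp
  filter_upwards [this] with ω hω
  rw [Finset.sum_apply]
  exact (sum_congr rfl hω).symm

variable {n : ℕ} {E : Fin n → Type*} [∀ i, MeasurableSpace (E i)] {X : ∀ i, Ω → E i}

/-- The number operator `∑ i, (1 - E_i)`, where `E_i` averages out the `i`-th coordinate. -/
noncomputable def numberOp (P : Measure Ω) (X : ∀ i, Ω → E i) (G : Ω → ℝ) (ω : Ω) : ℝ :=
  ∑ i, (G ω - P[G | coordSigma X (univ.erase i)] ω)

omit [IsProbabilityMeasure P] in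
lemma numberOp_congr {F G : Ω → ℝ} (h : F =ᵐ[P] G) : numberOp P X F =ᵐ[P] numberOp P X G := by
  have := ae_all_iff.2 fun i : Fin n =>
    condExp_congr_ae (m := coordSigma X (univ.erase i)) h
  filter_upwards [h, this] with ω h1 h2
  simp only [numberOp, h1, h2]

omit [IsProbabilityMeasure P] in
lemma numberOp_add {F G : Ω → ℝ} (hF : Integrable F P) (hG : Integrable G P) :
    numberOp P X (fun ω => F ω + G ω)
      =ᵐ[P] fun ω => numberOp P X F ω + numberOp P X G ω := by
  have := ae_all_iff.2 fun i : Fin n => condExp_add hF hG (coordSigma X (univ.erase i))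
  filter_upwards [this] with ω h
  have h' : ∀ i, P[fun ω => F ω + G ω | coordSigma X (univ.erase i)] ω
      = P[F | coordSigma X (univ.erase i)] ω + P[G | coordSigma X (univ.erase i)] ω := h
  simp only [numberOp, h', ← sum_add_distrib]
  exact sum_congr rfl fun i _ => by ring

omit [IsProbabilityMeasure P] in
lemma memLp_numberOp {G : Ω → ℝ} {p : ENNReal} (hp : 1 ≤ p) (hG : MemLp G p P) :
    MemLp (numberOp P X G) p P :=
  memLp_finsetSum _ fun _ _ => hG.sub (hG.condExp hp)

lemma integral_numberOp (hX : ∀ i, Measurable (X i)) {G : Ω → ℝ} (hG : Integrable G P) :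
    ∫ ω, numberOp P X G ω ∂P = 0 := by
  unfold numberOp
  have hi : ∀ i ∈ (univ : Finset (Fin n)),
      Integrable (fun ω => G ω - P[G | coordSigma X (univ.erase i)] ω) P :=
    fun i _ => hG.sub integrable_condExp
  rw [integral_finsetSum _ hi]
  refine sum_eq_zero fun i _ => ?_
  rw [integral_sub hG integrable_condExp, integral_condExp (coordSigma_le hX _), sub_self]

/-- The number operator is self-adjoint on `L²`. -/
lemma integral_numberOp_mul_comm (hX : ∀ i, Measurable (X i)) {F G : Ω → ℝ} (hF : MemLp F 2 P)
    (hG : MemLp G 2 P) :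
    ∫ ω, numberOp P X F ω * G ω ∂P = ∫ ω, F ω * numberOp P X G ω ∂P := by
  have hF' : ∀ i : Fin n, MemLp (P[F | coordSigma X (univ.erase i)]) 2 P :=
    fun i => hF.condExp one_le_two
  have hG' : ∀ i : Fin n, MemLp (P[G | coordSigma X (univ.erase i)]) 2 P :=
    fun i => hG.condExp one_le_two
  have i1 : Integrable (fun ω => F ω * G ω) P := hF.integrable_mul hG
  have i2 : ∀ i : Fin n, Integrable
      (fun ω => P[F | coordSigma X (univ.erase i)] ω * G ω) P := fun i => (hF' i).integrable_mul hG
  have i3 : ∀ i : Fin n, Integrable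
      (fun ω => F ω * P[G | coordSigma X (univ.erase i)] ω) P := fun i => hF.integrable_mul (hG' i)
  simp only [numberOp, sum_mul, mul_sum, sub_mul, mul_sub]
  have j2 : ∀ i ∈ (univ : Finset (Fin n)), Integrable
      (fun ω => F ω * G ω - P[F | coordSigma X (univ.erase i)] ω * G ω) P :=
    fun i _ => i1.sub (i2 i)
  have j3 : ∀ i ∈ (univ : Finset (Fin n)), Integrable
      (fun ω => F ω * G ω - F ω * P[G | coordSigma X (univ.erase i)] ω) P :=
    fun i _ => i1.sub (i3 i)
  rw [integral_finsetSum _ j2, integral_finsetSum _ j3]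
  refine sum_congr rfl fun i _ => ?_
  rw [integral_sub i1 (i2 i), integral_sub i1 (i3 i),
    integral_condExp_mul_comm (coordSigma_le hX _) hF hG]

/-- Sums of variables that each depend on at most `D` coordinates: on the span of such variables the
spectrum of the number operator lies in `[0, D]`. -/
lemma numberOp_bounds (hX : ∀ i, Measurable (X i)) (hindep : iIndepFun X P) {κ : Type*}
    (s : Finset κ) (v : κ → Ω → ℝ) (A : κ → Finset (Fin n)) {D : ℕ}
    (hA : ∀ k ∈ s, (A k).card ≤ D)
    (hvm : ∀ k ∈ s, StronglyMeasurable[coordSigma X (A k)] (v k))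
    (hv2 : ∀ k, MemLp (v k) 2 P) :
    0 ≤ ∫ ω, (∑ k ∈ s, v k ω) * numberOp P X (fun ω => ∑ k ∈ s, v k ω) ω ∂P ∧
    ∫ ω, (∑ k ∈ s, v k ω - (D : ℝ)⁻¹ * numberOp P X (fun ω => ∑ k ∈ s, v k ω) ω) ^ 2 ∂P
      ≤ ∫ ω, (∑ k ∈ s, v k ω) ^ 2 ∂P := by
  set Y : Ω → ℝ := fun ω => ∑ k ∈ s, v k ω with hYdef
  have hY2 : MemLp Y 2 P := memLp_finsetSum _ fun k _ => hv2 k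
  set e : Fin n → Module.End ℝ (Lp ℝ 2 P) :=
    fun i => condExpEnd P (coordSigma X (univ.erase i)) with he
  have hcc : ∀ i j (f : Lp ℝ 2 P) (F : Ω → ℝ) (hF : MemLp F 2 P), f = hF.toLp F →
      e i (e j f) = (hF.condExp
        (m := coordSigma X (univ.erase j ∩ univ.erase i)) one_le_two).toLp _ := by
    rintro i j _ F hF rfl
    simp only [he]
    rw [condExpEnd_toLp, condExpEnd_toLp]
    exact MemLp.toLp_congr _ _ (condExp_condExp_coordSigma hX hindep _ _ F)
  have hcomm : ∀ i j x, e i (e j x) = e j (e i x) := by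
    intro i j x
    obtain ⟨F, hF, hx⟩ := exists_toLp x
    rw [hcc i j x F hF hx, hcc j i x F hF hx]
    simp only [inter_comm]
  have hidem : ∀ i x, e i (e i x) = e i x := by
    intro i x
    obtain ⟨F, hF, hx⟩ := exists_toLp x
    rw [hcc i i x F hF hx, hx]
    simp only [inter_self, he]
    rw [condExpEnd_toLp]
  have hsymm : ∀ i x y, inner ℝ (e i x) y = inner ℝ x (e i y) := by
    intro i x y
    obtain ⟨F, hF, rfl⟩ := exists_toLp x
    obtain ⟨G, hG, rfl⟩ := exists_toLp y
    simp only [he]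
    rw [condExpEnd_toLp, condExpEnd_toLp, inner_toLp, inner_toLp,
      integral_condExp_mul_comm (coordSigma_le hX _) hF hG]
  have hfix : ∀ k ∈ s, ∀ i ∉ A k, e i ((hv2 k).toLp _) = (hv2 k).toLp _ := by
    intro k hk i hi
    simp only [he]
    rw [condExpEnd_toLp]
    refine MemLp.toLp_congr _ _ ?_
    rw [condExp_of_stronglyMeasurable (coordSigma_le hX _)
      ((hvm k hk).mono (coordSigma_mono fun j hj => ?_)) ((hv2 k).integrable one_le_two)]
    exact mem_erase.2 ⟨fun h => hi (h ▸ hj), mem_univ _⟩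
  have hsum : hY2.toLp Y = ∑ k ∈ s, (hv2 k).toLp (v k) := toLp_finsetSum s hv2 hY2
  have key := numberOperator_bounds e hidem hcomm hsymm s (fun k => (hv2 k).toLp (v k)) A hA hfix
    hsum
  have hL2 : MemLp (numberOp P X Y) 2 P := memLp_numberOp one_le_two hY2
  have hL : ∑ i, (hY2.toLp Y - e i (hY2.toLp Y)) = hL2.toLp _ := by
    have hd : ∀ i : Fin n, MemLp (fun ω => Y ω - P[Y | coordSigma X (univ.erase i)] ω) 2 P :=
      fun i => hY2.sub (hY2.condExp one_le_two)
    refine Eq.trans ?_ (toLp_finsetSum univ hd hL2).symm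
    refine sum_congr rfl fun i _ => ?_
    simp only [he]
    rw [condExpEnd_toLp, ← MemLp.toLp_sub]
    rfl
  rw [hL, inner_toLp] at key
  refine ⟨key.1, ?_⟩
  have h2 := key.2
  rw [← MemLp.toLp_const_smul, ← MemLp.toLp_sub, norm_sq_toLp, norm_sq_toLp] at h2
  exact h2

omit [IsProbabilityMeasure P] in
/-- A sum of vectors with a common eigenvalue `D` of the number operator. -/
lemma numberOp_eq_of_eigen {κ : Type*} (s : Finset κ) (v : κ → Ω → ℝ) (B : κ → Finset (Fin n))
    {D : ℕ} (hB : ∀ k ∈ s, (B k).card = D ∨ v k = 0) (hvi : ∀ k, Integrable (v k) P)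
    (h0 : ∀ k ∈ s, ∀ i ∈ B k, P[v k | coordSigma X (univ.erase i)] =ᵐ[P] 0)
    (h1 : ∀ k ∈ s, ∀ i ∉ B k, P[v k | coordSigma X (univ.erase i)] =ᵐ[P] v k) :
    numberOp P X (fun ω => ∑ k ∈ s, v k ω) =ᵐ[P] fun ω => D * ∑ k ∈ s, v k ω := by
  have hlin : ∀ᵐ ω ∂P, ∀ i : Fin n, P[fun ω => ∑ k ∈ s, v k ω | coordSigma X (univ.erase i)] ω
      = ∑ k ∈ s, if i ∈ B k then 0 else v k ω := by
    rw [ae_all_iff]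
    intro i
    have e1 := condExp_finsetSum (μ := P) (fun k (_ : k ∈ s) => hvi k) (coordSigma X (univ.erase i))
    have e2 : ∀ᵐ ω ∂P, ∀ k ∈ s, P[v k | coordSigma X (univ.erase i)] ω
        = if i ∈ B k then 0 else v k ω := by
      rw [Finset.eventually_all]
      intro k hk
      split_ifs with h
      · exact h0 k hk i h
      · exact h1 k hk i h
    have e3 : (∑ k ∈ s, v k) = fun ω => ∑ k ∈ s, v k ω := by ext; simp
    rw [e3] at e1
    filter_upwards [e1, e2] with ω e1 e2
    rw [e1, Finset.sum_apply]
    exact sum_congr rfl e2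
  filter_upwards [hlin] with ω hω
  simp only [numberOp, hω, ← sum_sub_distrib]
  rw [sum_comm, mul_sum]
  refine sum_congr rfl fun k hk => ?_
  have : ∀ i, v k ω - (if i ∈ B k then 0 else v k ω) = if i ∈ B k then v k ω else 0 := by
    intro i; split_ifs <;> simp
  simp only [this]
  rw [sum_ite_mem, univ_inter, sum_const, nsmul_eq_mul]
  rcases hB k hk with h | h
  · rw [h]
  · simp [h]

end NumberOperator

/-! ### The part of top order in the square of a degenerate `U`-statistic -/

section FourthMoment

open Finset Filter

variable {Ω : Type*} [mΩ : MeasurableSpace Ω] {P : Measure Ω}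
  {n d : ℕ} {E : Fin n → Type*} [∀ i, MeasurableSpace (E i)] {X : ∀ i, Ω → E i}

/-- The components of a degenerate `U`-statistic of order `d` in `L⁴`, normalised so that the
components of order other than `d` vanish identically. -/
structure IsDegenerateFamily (P : Measure Ω) (X : ∀ i, Ω → E i) (d : ℕ)
    (w : Finset (Fin n) → Ω → ℝ) : Prop where
  stronglyMeasurable : ∀ J, StronglyMeasurable[coordSigma X J] (w J)
  memLp : ∀ J, MemLp (w J) 4 P
  condExp_erase : ∀ J, ∀ i ∈ J, P[w J | coordSigma X (univ.erase i)] =ᵐ[P] 0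
  eq_zero : ∀ J, J.card ≠ d → w J = 0

/-- The mixed fourth moment `E[w_J w_K w_L w_M]`. -/
noncomputable def mixedMoment (P : Measure Ω) (w : Finset (Fin n) → Ω → ℝ)
    (J K L M : Finset (Fin n)) : ℝ :=
  ∫ ω, (w J ω * w K ω) * (w L ω * w M ω) ∂P

/-- The second moment `E[w_J²]`. -/
noncomputable def secondMoment (P : Measure Ω) (w : Finset (Fin n) → Ω → ℝ)
    (J : Finset (Fin n)) : ℝ :=
  ∫ ω, w J ω ^ 2 ∂P

namespace IsDegenerateFamily

variable {w : Finset (Fin n) → Ω → ℝ} (h : IsDegenerateFamily P X d w)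
include h

lemma memLp_two [IsProbabilityMeasure P]
    (J : Finset (Fin n)) : MemLp (w J) 2 P := (h.memLp J).mono_exponent (by norm_num)

lemma stronglyMeasurable_of_subset {J K : Finset (Fin n)} (hJK : J ⊆ K) :
    StronglyMeasurable[coordSigma X K] (w J) :=
  (h.stronglyMeasurable J).mono (coordSigma_mono hJK)

lemma integral_mul_eq_zero [IsProbabilityMeasure P]
    (hX : ∀ i, Measurable (X i)) {J : Finset (Fin n)} {i : Fin n}
    (hi : i ∈ J) {G : Ω → ℝ} (hG : StronglyMeasurable[coordSigma X (univ.erase i)] G)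
    (hGi : Integrable (fun ω => G ω * w J ω) P) : ∫ ω, G ω * w J ω ∂P = 0 := by
  rw [← integral_mul_condExp (coordSigma_le hX (univ.erase i)) hG
    ((h.memLp_two J).integrable one_le_two) hGi]
  refine integral_eq_zero_of_ae ?_
  filter_upwards [h.condExp_erase J i hi] with ω hω
  rw [hω]; simp

/-- A mixed moment vanishes as soon as one index is free. -/
lemma mixedMoment_eq_zero [IsProbabilityMeasure P]
    (hX : ∀ i, Measurable (X i)) {J K L M : Finset (Fin n)} {i : Fin n}
    (hJ : i ∈ J) (hK : i ∉ K) (hL : i ∉ L) (hM : i ∉ M) : mixedMoment P w J K L M = 0 := by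
  have hsub : ∀ {S : Finset (Fin n)}, i ∉ S → S ⊆ univ.erase i := fun hS j hj =>
    mem_erase.2 ⟨fun e => hS (e ▸ hj), mem_univ _⟩
  have hG : StronglyMeasurable[coordSigma X (univ.erase i)]
      fun ω => w K ω * (w L ω * w M ω) :=
    (h.stronglyMeasurable_of_subset (hsub hK)).mul
      ((h.stronglyMeasurable_of_subset (hsub hL)).mul (h.stronglyMeasurable_of_subset (hsub hM)))
  have hint := integrable_mul_mul_mul (h.memLp J) (h.memLp K) (h.memLp L) (h.memLp M)
  have e : ∀ ω, (w J ω * w K ω) * (w L ω * w M ω) = (w K ω * (w L ω * w M ω)) * w J ω :=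
    fun ω => by ring
  unfold mixedMoment
  simp only [e] at hint ⊢
  exact h.integral_mul_eq_zero hX hJ hG hint

omit h in
lemma mixedMoment_swap_left (J K L M : Finset (Fin n)) :
    mixedMoment P w J K L M = mixedMoment P w K J L M := by
  unfold mixedMoment; simp only [mul_comm]

omit h in
lemma mixedMoment_swap_pairs (J K L M : Finset (Fin n)) :
    mixedMoment P w J K L M = mixedMoment P w L M J K := by
  unfold mixedMoment; simp only [mul_comm]

lemma mixedMoment_eq_zero_of_card {J K L M : Finset (Fin n)}
    (hc : J.card ≠ d ∨ K.card ≠ d ∨ L.card ≠ d ∨ M.card ≠ d) : mixedMoment P w J K L M = 0 := by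
  unfold mixedMoment
  rcases hc with hc | hc | hc | hc <;> simp [h.eq_zero _ hc]

/-- A product of two components with disjoint index sets is orthogonal to every product of two
components that does not involve one of its indices. -/
lemma mixedMoment_eq_zero_of_mem_union [IsProbabilityMeasure P]
    (hX : ∀ i, Measurable (X i)) {J K L M : Finset (Fin n)}
    (hJK : Disjoint J K) {i : Fin n} (hi : i ∈ J ∪ K) (hi' : i ∉ L ∪ M) :
    mixedMoment P w J K L M = 0 := by
  rw [mem_union, not_or] at hi'
  rcases mem_union.1 hi with hi | hi
  · exact h.mixedMoment_eq_zero hX hi (disjoint_left.1 hJK hi) hi'.1 hi'.2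
  · rw [mixedMoment_swap_left]
    exact h.mixedMoment_eq_zero hX hi (disjoint_right.1 hJK hi) hi'.1 hi'.2

lemma mixedMoment_eq_zero_of_union_ne [IsProbabilityMeasure P]
    (hX : ∀ i, Measurable (X i)) {J K L M : Finset (Fin n)}
    (hJK : Disjoint J K) (hLM : Disjoint L M) (hne : J ∪ K ≠ L ∪ M) :
    mixedMoment P w J K L M = 0 := by
  by_cases hs : J ∪ K ⊆ L ∪ M
  · obtain ⟨i, hi, hi'⟩ := not_subset.1 fun hs' => hne (Subset.antisymm hs hs')
    rw [mixedMoment_swap_pairs]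
    exact h.mixedMoment_eq_zero_of_mem_union hX hLM hi hi'
  · obtain ⟨i, hi, hi'⟩ := not_subset.1 hs
    exact h.mixedMoment_eq_zero_of_mem_union hX hJK hi hi'

/-- Disjoint products have larger order than overlapping ones and are orthogonal to them. -/
lemma mixedMoment_eq_zero_of_not_disjoint [IsProbabilityMeasure P] (hX : ∀ i, Measurable (X i))
    {J K L M : Finset (Fin n)} (hJK : Disjoint J K) (hLM : ¬ Disjoint L M) :
    mixedMoment P w J K L M = 0 := by
  by_cases hc : J.card ≠ d ∨ K.card ≠ d ∨ L.card ≠ d ∨ M.card ≠ d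
  · exact h.mixedMoment_eq_zero_of_card hc
  · push Not at hc
    obtain ⟨h1, h2, h3, h4⟩ := hc
    have hlt : (L ∪ M).card < (J ∪ K).card := by
      have e1 := card_union_of_disjoint hJK
      have e2 := card_union_add_card_inter L M
      have e3 : 0 < (L ∩ M).card := card_pos.2 (not_disjoint_iff_nonempty_inter.1 hLM)
      omega
    obtain ⟨i, hi, hi'⟩ := exists_mem_notMem_of_card_lt_card hlt
    exact h.mixedMoment_eq_zero_of_mem_union hX hJK hi hi'

omit h in
lemma secondMoment_nonneg (J : Finset (Fin n)) : 0 ≤ secondMoment P w J :=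
  integral_nonneg fun _ => sq_nonneg _

lemma secondMoment_eq_zero {J : Finset (Fin n)} (hJ : J.card ≠ d) : secondMoment P w J = 0 := by
  simp [secondMoment, h.eq_zero J hJ]

lemma mixedMoment_self_of_disjoint [IsProbabilityMeasure P]
    (hX : ∀ i, Measurable (X i)) (hindep : iIndepFun X P)
    {J K : Finset (Fin n)} (hJK : Disjoint J K) :
    mixedMoment P w J K J K = secondMoment P w J * secondMoment P w K := by
  unfold mixedMoment secondMoment
  have e := integral_mul_of_disjoint hX hindep hJK (F := fun ω => w J ω ^ 2)
    (G := fun ω => w K ω ^ 2) ((h.stronglyMeasurable J).pow 2) ((h.stronglyMeasurable K).pow 2)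
  rw [← e]
  exact integral_congr_ae (Eventually.of_forall fun ω => by ring)

/-- Factorisation of a mixed moment over two disjoint blocks `B`, `C` by conditioning on the
remaining blocks `A`, `D`. -/
lemma mixedMoment_eq_integral_condExp_mul [IsProbabilityMeasure P]
    (hX : ∀ i, Measurable (X i)) (hindep : iIndepFun X P)
    {A B C D : Finset (Fin n)} (hBC : Disjoint B C) :
    mixedMoment P w (A ∪ B) (C ∪ D) (A ∪ C) (B ∪ D)
      = ∫ ω, P[fun ω => w (A ∪ B) ω * w (B ∪ D) ω | coordSigma X (A ∪ D)] ω *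
          P[fun ω => w (A ∪ C) ω * w (C ∪ D) ω | coordSigma X (A ∪ D)] ω ∂P := by
  have hU2 := memLp_two_mul (h.memLp (A ∪ B)) (h.memLp (B ∪ D))
  have hV2 := memLp_two_mul (h.memLp (A ∪ C)) (h.memLp (C ∪ D))
  have hUm : StronglyMeasurable[coordSigma X (A ∪ B ∪ D)]
      fun ω => w (A ∪ B) ω * w (B ∪ D) ω :=
    (h.stronglyMeasurable_of_subset (by grind)).mul (h.stronglyMeasurable_of_subset (by grind))
  have hVm : StronglyMeasurable[coordSigma X (A ∪ C ∪ D)]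
      fun ω => w (A ∪ C) ω * w (C ∪ D) ω :=
    (h.stronglyMeasurable_of_subset (by grind)).mul (h.stronglyMeasurable_of_subset (by grind))
  have hinter : (A ∪ C ∪ D) ∩ (A ∪ B ∪ D) = A ∪ D := by
    rw [disjoint_left] at hBC
    grind
  have e1 := condExp_coordSigma_inter hX hindep (A ∪ B ∪ D) hVm (hV2.integrable one_le_two)
  rw [hinter] at e1
  have e2 := integral_mul_condExp (coordSigma_le hX (A ∪ B ∪ D)) hUm
    (hV2.integrable one_le_two) (hU2.integrable_mul hV2)
  have e3 := integral_mul_condExp (coordSigma_le hX (A ∪ D))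
    (stronglyMeasurable_condExp (f := fun ω => w (A ∪ C) ω * w (C ∪ D) ω)
      (m := coordSigma X (A ∪ D)) (μ := P)) (hU2.integrable one_le_two)
    ((hV2.condExp one_le_two).integrable_mul hU2)
  calc mixedMoment P w (A ∪ B) (C ∪ D) (A ∪ C) (B ∪ D)
      = ∫ ω, (w (A ∪ B) ω * w (B ∪ D) ω) * (w (A ∪ C) ω * w (C ∪ D) ω) ∂P :=
        integral_congr_ae (Eventually.of_forall fun ω => by ring)
    _ = ∫ ω, (w (A ∪ B) ω * w (B ∪ D) ω) *
          P[fun ω => w (A ∪ C) ω * w (C ∪ D) ω | coordSigma X (A ∪ D)] ω ∂P := by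
        rw [← e2]
        exact integral_congr_ae (e1.mono fun ω hω => by simp only [hω])
    _ = _ := by
        simp only [mul_comm] at e3 ⊢
        rw [← e3]

/-- For overlapping blocks the product of conditional expectations is controlled by second
moments. -/
lemma abs_integral_condExp_mul_le [IsProbabilityMeasure P]
    (hX : ∀ i, Measurable (X i)) (hindep : iIndepFun X P)
    {A B C D : Finset (Fin n)} (hAD : Disjoint A D) (hB : Disjoint B (A ∪ D))
    (hC : Disjoint C (A ∪ D)) :
    |∫ ω, P[fun ω => w (A ∪ B) ω * w (B ∪ D) ω | coordSigma X (A ∪ D)] ω *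
          P[fun ω => w (A ∪ C) ω * w (C ∪ D) ω | coordSigma X (A ∪ D)] ω ∂P|
      ≤ (secondMoment P w (A ∪ B) * secondMoment P w (C ∪ D)
        + secondMoment P w (A ∪ C) * secondMoment P w (B ∪ D)) / 2 := by
  rw [disjoint_left] at hB hC
  have hsq : ∀ J, MemLp (fun ω => w J ω ^ 2) 2 P := fun J => memLp_two_sq (h.memLp J)
  have hsqi : ∀ J, Integrable (fun ω => w J ω ^ 2) P := fun J => (hsq J).integrable one_le_two
  have hsqm : ∀ J, StronglyMeasurable[coordSigma X J] fun ω => w J ω ^ 2 :=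
    fun J => (h.stronglyMeasurable J).pow 2
  -- conditioning the square on `A ∪ D` only sees the coordinates it depends on
  have red : ∀ J I, J ∩ (A ∪ D) = I → P[fun ω => w J ω ^ 2 | coordSigma X (A ∪ D)]
      =ᵐ[P] P[fun ω => w J ω ^ 2 | coordSigma X I] := by
    intro J I hI
    rw [← hI]
    exact condExp_coordSigma_inter hX hindep (A ∪ D) (hsqm J) (hsqi J)
  rw [disjoint_left] at hAD
  have r1 := red (A ∪ B) A (by grind)
  have r2 := red (B ∪ D) D (by grind)
  have r3 := red (A ∪ C) A (by grind)
  have r4 := red (C ∪ D) D (by grind)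
  have hm : ∀ J K, Integrable (fun ω => w J ω * w K ω) P := fun J K =>
    integrable_mul_of_four (h.memLp J) (h.memLp K)
  have c1 := condExp_mul_sq_le (m := coordSigma X (A ∪ D)) (hsqi (A ∪ B)) (hsqi (B ∪ D))
    (hm (A ∪ B) (B ∪ D))
  have c2 := condExp_mul_sq_le (m := coordSigma X (A ∪ D)) (hsqi (A ∪ C)) (hsqi (C ∪ D))
    (hm (A ∪ C) (C ∪ D))
  have hnn : ∀ J I, ∀ᵐ ω ∂P, 0 ≤ P[fun ω => w J ω ^ 2 | coordSigma X I] ω := fun J I =>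
    condExp_nonneg (Eventually.of_forall fun ω => sq_nonneg _)
  have hprod : ∀ J K, ∫ ω, P[fun ω => w J ω ^ 2 | coordSigma X A] ω *
      P[fun ω => w K ω ^ 2 | coordSigma X D] ω ∂P = secondMoment P w J * secondMoment P w K := by
    intro J K
    rw [integral_mul_of_disjoint hX hindep (disjoint_left.2 hAD) stronglyMeasurable_condExp
      stronglyMeasurable_condExp, integral_condExp (coordSigma_le hX A),
      integral_condExp (coordSigma_le hX D)]
    rfl
  have hpi : ∀ J K, Integrable (fun ω => P[fun ω => w J ω ^ 2 | coordSigma X A] ω *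
      P[fun ω => w K ω ^ 2 | coordSigma X D] ω) P := fun J K =>
    ((hsq J).condExp one_le_two).integrable_mul ((hsq K).condExp one_le_two)
  rw [← hprod, ← hprod, ← integral_add (hpi _ _) (hpi _ _), ← integral_div, ← Real.norm_eq_abs]
  refine norm_integral_le_of_norm_le (((hpi _ _).add (hpi _ _)).div_const 2) ?_
  filter_upwards [r1, r2, r3, r4, c1, c2, hnn (A ∪ B) A, hnn (B ∪ D) D, hnn (A ∪ C) A,
    hnn (C ∪ D) D] with ω r1 r2 r3 r4 c1 c2 n1 n2 n3 n4
  rw [r1, r2] at c1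
  rw [r3, r4] at c2
  rw [Real.norm_eq_abs]
  refine abs_le_of_sq_le_sq ?_ (by positivity)
  -- `(xy)² ≤ (ab)(ce)` and `(ab)(ce) = (ae)(cb) ≤ ((ae + cb) / 2)²`
  generalize P[fun ω => w (A ∪ B) ω ^ 2 | coordSigma X A] ω = a at *
  generalize P[fun ω => w (B ∪ D) ω ^ 2 | coordSigma X D] ω = b at *
  generalize P[fun ω => w (A ∪ C) ω ^ 2 | coordSigma X A] ω = c at *
  generalize P[fun ω => w (C ∪ D) ω ^ 2 | coordSigma X D] ω = e at *
  have := mul_le_mul c1 c2 (sq_nonneg _) (mul_nonneg n1 n2)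
  rw [mul_pow]
  nlinarith [sq_nonneg (a * e - c * b)]

/-- The contribution of fixed nonempty blocks `A`, `D` to the second moment of the top-order part of
`W²`. The terms with nonempty `B`, `C` would sum to the second moment of `∑_B g_B` if overlapping
blocks were included. -/
lemma sum_blocks_ge [IsProbabilityMeasure P] (hX : ∀ i, Measurable (X i)) (hindep : iIndepFun X P)
    {A D : Finset (Fin n)} (hAD : Disjoint A D) :
    secondMoment P w A * secondMoment P w D
      - ∑ b : Finset (Fin n) × Finset (Fin n) with ¬ Disjoint b.1 b.2 ∧ Disjoint b.1 (A ∪ D) ∧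
        Disjoint b.2 (A ∪ D), secondMoment P w (A ∪ b.1) * secondMoment P w (b.2 ∪ D)
    ≤ ∑ b : Finset (Fin n) × Finset (Fin n) with Disjoint b.1 b.2 ∧ Disjoint b.1 (A ∪ D) ∧
        Disjoint b.2 (A ∪ D), mixedMoment P w (A ∪ b.1) (b.2 ∪ D) (A ∪ b.2) (b.1 ∪ D) := by
  set g : Finset (Fin n) → Ω → ℝ := fun B =>
    P[fun ω => w (A ∪ B) ω * w (B ∪ D) ω | coordSigma X (A ∪ D)] with hg
  have hg2 : ∀ B, MemLp (g B) 2 P := fun B =>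
    (memLp_two_mul (h.memLp (A ∪ B)) (h.memLp (B ∪ D))).condExp one_le_two
  set t : Finset (Fin n) × Finset (Fin n) → ℝ := fun b => ∫ ω, g b.1 ω * g b.2 ω ∂P with ht
  set N : Finset (Fin n) × Finset (Fin n) → Prop := fun b => b.1.Nonempty ∧ b.2.Nonempty with hN
  classical
  -- the terms in which `B` or `C` is empty
  have hterm : ∀ b : Finset (Fin n) × Finset (Fin n), Disjoint b.1 b.2 ∧ Disjoint b.1 (A ∪ D) ∧
        Disjoint b.2 (A ∪ D) → mixedMoment P w (A ∪ b.1) (b.2 ∪ D) (A ∪ b.2) (b.1 ∪ D)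
      = (if b = (∅, ∅) then secondMoment P w A * secondMoment P w D else 0)
        + if N b then t b else 0 := by
    rintro ⟨B, C⟩ ⟨hBC, hB, hC⟩
    simp only [disjoint_union_right] at hBC hB hC
    rcases B.eq_empty_or_nonempty with rfl | hBne
    · rcases C.eq_empty_or_nonempty with rfl | hCne
      · simp [hN, h.mixedMoment_self_of_disjoint hX hindep hAD]
      · have hC0 : C ≠ ∅ := hCne.ne_empty
        simp only [hN, Prod.mk.injEq, hC0, and_false, if_false, Finset.not_nonempty_empty,
          false_and, add_zero, union_empty, empty_union]
        refine h.mixedMoment_eq_zero_of_card ?_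
        have e := card_union_of_disjoint hC.1.symm
        have := hCne.card_pos
        by_cases hA : A.card = d
        · right; right; left; omega
        · left; exact hA
    · have hB0 : B ≠ ∅ := hBne.ne_empty
      rcases C.eq_empty_or_nonempty with rfl | hCne
      · simp only [hN, Prod.mk.injEq, hB0, false_and, if_false, Finset.not_nonempty_empty,
          and_false, add_zero, union_empty, empty_union]
        refine h.mixedMoment_eq_zero_of_card ?_
        have e := card_union_of_disjoint hB.1.symm
        have := hBne.card_pos
        by_cases hA : A.card = d
        · left; omega
        · right; right; left; exact hA
      · simp only [hN, Prod.mk.injEq, hB0, false_and, if_false, hBne, hCne, and_self, if_true,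
          zero_add, ht, hg]
        exact h.mixedMoment_eq_integral_condExp_mul hX hindep hBC
  rw [sum_congr rfl fun b hb => hterm b (mem_filter.1 hb).2, sum_add_distrib]
  have hfirst : ∑ b : Finset (Fin n) × Finset (Fin n) with Disjoint b.1 b.2 ∧
      Disjoint b.1 (A ∪ D) ∧ Disjoint b.2 (A ∪ D),
      (if b = (∅, ∅) then secondMoment P w A * secondMoment P w D else 0)
      = secondMoment P w A * secondMoment P w D := by
    rw [sum_ite_eq']
    simp
  rw [hfirst, ← sum_filter, filter_filter]
  -- nonnegativity of the second moment of the sum of all `g B`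
  set S : Finset (Finset (Fin n)) := {B | B.Nonempty ∧ Disjoint B (A ∪ D)} with hS
  have hsq : 0 ≤ ∑ b ∈ S ×ˢ S, t b := by
    have : ∑ b ∈ S ×ˢ S, t b = ∫ ω, (∑ B ∈ S, g B ω) ^ 2 ∂P := by
      simp only [sq, sum_mul_sum, ← sum_product', ht]
      rw [integral_finsetSum]
      exact fun b _ => (hg2 b.1).integrable_mul (hg2 b.2)
    rw [this]
    exact integral_nonneg fun ω => sq_nonneg _
  rw [← sum_filter_add_sum_filter_not (S ×ˢ S) (fun b => Disjoint b.1 b.2)] at hsq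
  have hset1 : (S ×ˢ S).filter (fun b => Disjoint b.1 b.2) = univ.filter
      (fun b : Finset (Fin n) × Finset (Fin n) => (Disjoint b.1 b.2 ∧ Disjoint b.1 (A ∪ D) ∧
        Disjoint b.2 (A ∪ D)) ∧ N b) := by
    ext b
    simp only [hS, hN, mem_filter, mem_product, mem_univ, true_and]
    tauto
  have hset2 : (S ×ˢ S).filter (fun b => ¬ Disjoint b.1 b.2) = univ.filter
      (fun b : Finset (Fin n) × Finset (Fin n) => ¬ Disjoint b.1 b.2 ∧ Disjoint b.1 (A ∪ D) ∧
        Disjoint b.2 (A ∪ D)) := by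
    ext b
    simp only [hS, mem_filter, mem_product, mem_univ, true_and]
    constructor
    · tauto
    · rintro ⟨h1, h2, h3⟩
      obtain ⟨i, hi, hi'⟩ := not_disjoint_iff.1 h1
      exact ⟨⟨⟨⟨i, hi⟩, h2⟩, ⟨i, hi'⟩, h3⟩, h1⟩
  rw [hset1, hset2] at hsq
  -- the overlapping blocks, symmetrised in `B` and `C`
  have hover : ∑ b : Finset (Fin n) × Finset (Fin n) with ¬ Disjoint b.1 b.2 ∧
      Disjoint b.1 (A ∪ D) ∧ Disjoint b.2 (A ∪ D), t b
      ≤ ∑ b : Finset (Fin n) × Finset (Fin n) with ¬ Disjoint b.1 b.2 ∧ Disjoint b.1 (A ∪ D) ∧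
        Disjoint b.2 (A ∪ D), secondMoment P w (A ∪ b.1) * secondMoment P w (b.2 ∪ D) := by
    have hswap : ∑ b : Finset (Fin n) × Finset (Fin n) with ¬ Disjoint b.1 b.2 ∧
        Disjoint b.1 (A ∪ D) ∧ Disjoint b.2 (A ∪ D),
          secondMoment P w (A ∪ b.2) * secondMoment P w (b.1 ∪ D)
        = ∑ b : Finset (Fin n) × Finset (Fin n) with ¬ Disjoint b.1 b.2 ∧ Disjoint b.1 (A ∪ D) ∧
          Disjoint b.2 (A ∪ D), secondMoment P w (A ∪ b.1) * secondMoment P w (b.2 ∪ D) := by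
      refine sum_nbij' Prod.swap Prod.swap ?_ ?_ (fun _ _ => rfl) (fun _ _ => rfl)
        (fun _ _ => rfl) <;>
      · rintro ⟨B, C⟩ hb
        simp only [mem_filter, mem_univ, true_and, Prod.fst_swap, Prod.snd_swap] at hb ⊢
        exact ⟨fun hd => hb.1 hd.symm, hb.2.2, hb.2.1⟩
    calc _ ≤ ∑ b : Finset (Fin n) × Finset (Fin n) with ¬ Disjoint b.1 b.2 ∧
        Disjoint b.1 (A ∪ D) ∧ Disjoint b.2 (A ∪ D),
          (secondMoment P w (A ∪ b.1) * secondMoment P w (b.2 ∪ D)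
            + secondMoment P w (A ∪ b.2) * secondMoment P w (b.1 ∪ D)) / 2 := by
          refine sum_le_sum fun b hb => (le_abs_self _).trans ?_
          have hb' := (mem_filter.1 hb).2
          exact h.abs_integral_condExp_mul_le hX hindep hAD hb'.2.1 hb'.2.2
      _ = _ := by
          rw [← sum_div, sum_add_distrib, hswap]; ring
  linarith

/-- The second moment of `∑_{J ∩ K = ∅} w_J w_K`, the part of `W²` of order `2d`, is almost at least
`2`. -/
lemma two_sub_le_integral_sq [IsProbabilityMeasure P]
    (hX : ∀ i, Measurable (X i)) (hindep : iIndepFun X P) (hd : 1 ≤ d)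
    (hsum : ∑ J, secondMoment P w J = 1) {r : ℝ}
    (hr : ∀ i, ∑ K : Finset (Fin n) with i ∈ K, secondMoment P w K ≤ r) :
    2 - (((∑ j ∈ Icc 1 (d - 1), (d - 1).choose j ^ 2 : ℕ) : ℝ) + 2) * (d * r)
      ≤ ∫ ω, (∑ p : Finset (Fin n) × Finset (Fin n) with Disjoint p.1 p.2,
          w p.1 ω * w p.2 ω) ^ 2 ∂P := by
  set s := secondMoment P w with hs
  have hs0 : ∀ J, 0 ≤ s J := secondMoment_nonneg
  have hsd : ∀ J, J.card ≠ d → s J = 0 := fun J => h.secondMoment_eq_zero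
  set Sd := ∑ p : Finset (Fin n) × Finset (Fin n) with Disjoint p.1 p.2, s p.1 * s p.2 with hSd
  set Sn := ∑ p : Finset (Fin n) × Finset (Fin n) with ¬ Disjoint p.1 p.2, s p.1 * s p.2 with hSn
  have hSum : Sd + Sn = 1 := by
    rw [hSd, hSn, sum_filter_add_sum_filter_not univ
      (fun p : Finset (Fin n) × Finset (Fin n) => Disjoint p.1 p.2)
      (fun p => s p.1 * s p.2), Fintype.sum_prod_type]
    simp only [← mul_sum, hsum, mul_one]
  have hSnle : Sn ≤ d * r := by
    have := sum_not_disjoint_le hs0 hsd hr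
    rwa [hsum, mul_one] at this
  -- expand the square, and regroup into blocks
  have hexp : ∫ ω, (∑ p : Finset (Fin n) × Finset (Fin n) with Disjoint p.1 p.2,
      w p.1 ω * w p.2 ω) ^ 2 ∂P
      = ∑ a : Finset (Fin n) × Finset (Fin n) with Disjoint a.1 a.2,
        ∑ b : Finset (Fin n) × Finset (Fin n) with Disjoint b.1 b.2 ∧ Disjoint b.1 (a.1 ∪ a.2) ∧
          Disjoint b.2 (a.1 ∪ a.2),
          mixedMoment P w (a.1 ∪ b.1) (b.2 ∪ a.2) (a.1 ∪ b.2) (b.1 ∪ a.2) := by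
    rw [← sum_splittings_eq_sum_blocks (mixedMoment P w)]
    have hint : ∀ p q : Finset (Fin n) × Finset (Fin n),
        Integrable (fun ω => (w p.1 ω * w p.2 ω) * (w q.1 ω * w q.2 ω)) P := fun p q =>
      integrable_mul_mul_mul (h.memLp _) (h.memLp _) (h.memLp _) (h.memLp _)
    simp only [sq, sum_mul_sum]
    rw [integral_finsetSum _ fun p _ => integrable_finsetSum _ fun q _ => hint p q]
    refine sum_congr rfl fun p hp => ?_
    rw [integral_finsetSum _ fun q _ => hint p q]
    conv_rhs => rw [← filter_filter, sum_filter]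
    refine sum_congr rfl fun q hq => ?_
    split_ifs with hpq
    · rfl
    · exact h.mixedMoment_eq_zero_of_union_ne hX (mem_filter.1 hp).2 (mem_filter.1 hq).2 hpq
  have hover := sum_overlapping_blocks_le hs0 hsd
  -- blocks with `|A| ≠ |D|` contribute nothing, `A = D = ∅` contributes `Sd`
  have hblock : ∀ a : Finset (Fin n) × Finset (Fin n), Disjoint a.1 a.2 →
      ((if a = (∅, ∅) then Sd else 0) + s a.1 * s a.2)
        - (if a.1.Nonempty ∧ a.1.card = a.2.card then
          ∑ b : Finset (Fin n) × Finset (Fin n) with ¬ Disjoint b.1 b.2 ∧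
            Disjoint b.1 (a.1 ∪ a.2) ∧ Disjoint b.2 (a.1 ∪ a.2),
            s (a.1 ∪ b.1) * s (b.2 ∪ a.2) else 0)
      ≤ ∑ b : Finset (Fin n) × Finset (Fin n) with Disjoint b.1 b.2 ∧ Disjoint b.1 (a.1 ∪ a.2) ∧
          Disjoint b.2 (a.1 ∪ a.2),
          mixedMoment P w (a.1 ∪ b.1) (b.2 ∪ a.2) (a.1 ∪ b.2) (b.1 ∪ a.2) := by
    rintro ⟨A, D⟩ hAD
    simp only at hAD ⊢
    by_cases hcard : A.card = D.card
    · rcases A.eq_empty_or_nonempty with rfl | hA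
      · obtain rfl : D = ∅ := by rw [← card_eq_zero, ← hcard, card_empty]
        have h0 : s ∅ = 0 := hsd ∅ (by simp; omega)
        simp only [if_true, h0, mul_zero, add_zero, Finset.not_nonempty_empty, if_false,
          sub_zero, union_empty, empty_union, disjoint_empty_right, and_true]
        refine le_of_eq (sum_congr rfl fun b hb => ?_)
        have hb' := (mem_filter.1 hb).2
        rw [hs, ← h.mixedMoment_self_of_disjoint hX hindep hb', mixedMoment_swap_pairs b.1 b.2 b.2,
          mixedMoment_swap_left]
      · have hA0 : A ≠ ∅ := hA.ne_empty
        simp only [Prod.mk.injEq, hA0, false_and, if_false, zero_add, hA, hcard, and_self, if_true]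
        exact h.sum_blocks_ge hX hindep hAD
    · have hne : ¬ (A = ∅ ∧ D = ∅) := by
        rintro ⟨rfl, rfl⟩; exact hcard rfl
      have hprod : s A * s D = 0 := by
        by_cases hA : A.card = d
        · rw [hsd D (fun hD => hcard (hA.trans hD.symm)), mul_zero]
        · rw [hsd A hA, zero_mul]
      simp only [Prod.mk.injEq, hne, if_false, zero_add, hprod, hcard, and_false, sub_zero]
      refine le_of_eq (sum_eq_zero fun b hb => ?_).symm
      have hb' := (mem_filter.1 hb).2
      simp only [disjoint_union_right] at hb'
      refine h.mixedMoment_eq_zero_of_card ?_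
      have e1 := card_union_of_disjoint hb'.2.1.1.symm
      have e2 := card_union_of_disjoint hb'.2.1.2
      by_cases hA : (A ∪ b.1).card = d
      · right; right; right; omega
      · left; exact hA
  rw [hexp]
  have htot := sum_le_sum fun a (ha : a ∈ univ.filter
    fun a : Finset (Fin n) × Finset (Fin n) => Disjoint a.1 a.2) => hblock a (mem_filter.1 ha).2
  rw [sum_sub_distrib, sum_add_distrib, sum_ite_eq', ← sum_filter, filter_filter] at htot
  simp only [mem_filter, mem_univ, disjoint_empty_right, and_self, if_true] at htot
  refine le_trans ?_ htot
  have hc : 0 ≤ ((∑ j ∈ Icc 1 (d - 1), (d - 1).choose j ^ 2 : ℕ) : ℝ) := Nat.cast_nonneg _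
  have := mul_le_mul_of_nonneg_left hSnle hc
  linarith

end IsDegenerateFamily

end FourthMoment

/-! ### The number operator and the square of a degenerate `U`-statistic -/

section SquareDecomposition

open Finset Filter

variable {Ω : Type*} [mΩ : MeasurableSpace Ω] {P : Measure Ω} [IsProbabilityMeasure P]
  {n d : ℕ} {E : Fin n → Type*} [∀ i, MeasurableSpace (E i)] {X : ∀ i, Ω → E i}

namespace IsDegenerateFamily

variable {w : Finset (Fin n) → Ω → ℝ} (h : IsDegenerateFamily P X d w)
include h

lemma integral_mul_eq_zero_of_ne (hX : ∀ i, Measurable (X i)) {J K : Finset (Fin n)}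
    (hne : J ≠ K) : ∫ ω, w J ω * w K ω ∂P = 0 := by
  have aux : ∀ {J K : Finset (Fin n)} {i : Fin n}, i ∈ J → i ∉ K →
      ∫ ω, w K ω * w J ω ∂P = 0 := fun {J K _} hi hi' =>
    h.integral_mul_eq_zero hX hi
      (h.stronglyMeasurable_of_subset fun j hj => mem_erase.2 ⟨fun e => hi' (e ▸ hj), mem_univ _⟩)
      (integrable_mul_of_four (h.memLp K) (h.memLp J))
  by_cases hs : J ⊆ K
  · obtain ⟨i, hi, hi'⟩ := not_subset.1 fun hs' => hne (Subset.antisymm hs hs')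
    exact aux hi hi'
  · obtain ⟨i, hi, hi'⟩ := not_subset.1 hs
    simp only [mul_comm (w J _)]
    exact aux hi hi'

lemma sum_secondMoment (hX : ∀ i, Measurable (X i)) :
    ∑ J, secondMoment P w J = ∫ ω, (∑ J, w J ω) ^ 2 ∂P := by
  have hint : ∀ J K, Integrable (fun ω => w J ω * w K ω) P := fun J K =>
    integrable_mul_of_four (h.memLp J) (h.memLp K)
  simp only [sq, sum_mul_sum]
  rw [integral_finsetSum _ fun J _ => integrable_finsetSum _ fun K _ => hint J K]
  refine sum_congr rfl fun J _ => ?_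
  rw [integral_finsetSum _ fun K _ => hint J K, sum_eq_single J]
  · simp only [secondMoment, sq]
  · exact fun K _ hK => h.integral_mul_eq_zero_of_ne hX hK.symm
  · simp

lemma condExp_eq_self (hX : ∀ i, Measurable (X i)) {J : Finset (Fin n)} {i : Fin n} (hi : i ∉ J) :
    P[w J | coordSigma X (univ.erase i)] = w J :=
  condExp_of_stronglyMeasurable (coordSigma_le hX _)
    (h.stronglyMeasurable_of_subset fun _ hj => mem_erase.2 ⟨fun e => hi (e ▸ hj), mem_univ _⟩)
    ((h.memLp_two J).integrable one_le_two)

/-- A degenerate `U`-statistic of order `d` is an eigenvector of the number operator. -/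
lemma numberOp_sum (hX : ∀ i, Measurable (X i)) :
    numberOp P X (fun ω => ∑ J, w J ω) =ᵐ[P] fun ω => d * ∑ J, w J ω :=
  numberOp_eq_of_eigen univ w id
    (fun J _ => or_iff_not_imp_left.2 fun hJ => h.eq_zero J hJ)
    (fun J => (h.memLp_two J).integrable one_le_two)
    (fun J _ i hi => h.condExp_erase J i hi)
    (fun _ _ _ hi => (h.condExp_eq_self hX hi).eventuallyEq)

lemma condExp_mul_eq_zero {J K : Finset (Fin n)} {i : Fin n} (hi : i ∈ J) (hi' : i ∉ K) :
    P[fun ω => w K ω * w J ω | coordSigma X (univ.erase i)] =ᵐ[P] 0 := by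
  have hK : StronglyMeasurable[coordSigma X (univ.erase i)] (w K) :=
    h.stronglyMeasurable_of_subset fun j hj => mem_erase.2 ⟨fun e => hi' (e ▸ hj), mem_univ _⟩
  have e := condExp_mul_of_stronglyMeasurable_left hK
    (integrable_mul_of_four (h.memLp K) (h.memLp J)) ((h.memLp_two J).integrable one_le_two)
  refine EventuallyEq.trans e ?_
  filter_upwards [h.condExp_erase J i hi] with ω hω
  simp [hω]

/-- The part `∑_{J ∩ K = ∅} w_J w_K` of the square is an eigenvector of the number operator. -/
lemma numberOp_sum_disjoint (hX : ∀ i, Measurable (X i)) :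
    numberOp P X (fun ω => ∑ p : Finset (Fin n) × Finset (Fin n) with Disjoint p.1 p.2,
        w p.1 ω * w p.2 ω)
      =ᵐ[P] fun ω => ((2 * d : ℕ) : ℝ) *
        ∑ p : Finset (Fin n) × Finset (Fin n) with Disjoint p.1 p.2, w p.1 ω * w p.2 ω := by
  refine numberOp_eq_of_eigen
    (univ.filter fun p : Finset (Fin n) × Finset (Fin n) => Disjoint p.1 p.2)
    (fun p ω => w p.1 ω * w p.2 ω) (fun p => p.1 ∪ p.2) (D := 2 * d) ?_
    (fun p => integrable_mul_of_four (h.memLp _) (h.memLp _)) ?_ ?_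
  · intro p hp
    by_cases h1 : p.1.card = d
    · by_cases h2 : p.2.card = d
      · left
        rw [card_union_of_disjoint (mem_filter.1 hp).2]
        omega
      · right
        ext ω; simp [h.eq_zero _ h2]
    · right
      ext ω; simp [h.eq_zero _ h1]
  · intro p hp i hi
    have hd := (mem_filter.1 hp).2
    rcases mem_union.1 hi with hi | hi
    · simp only [mul_comm (w p.1 _)]
      exact h.condExp_mul_eq_zero hi (disjoint_left.1 hd hi)
    · exact h.condExp_mul_eq_zero hi (disjoint_right.1 hd hi)
  · intro p _ i hi
    rw [condExp_of_stronglyMeasurable (coordSigma_le hX _) _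
      (integrable_mul_of_four (h.memLp _) (h.memLp _))]
    have hsub : p.1 ∪ p.2 ⊆ univ.erase i :=
      fun j hj => mem_erase.2 ⟨fun e => hi (e ▸ hj), mem_univ _⟩
    exact (h.stronglyMeasurable_of_subset (subset_union_left.trans hsub)).mul
      (h.stronglyMeasurable_of_subset (subset_union_right.trans hsub))

/-- The effect of the number operator on the square of a degenerate `U`-statistic of order `d`,
expressed by the second moment of the part of order `2d` of that square. -/
lemma square_bounds (hX : ∀ i, Measurable (X i)) (hindep : iIndepFun X P) (hd : 1 ≤ d) {W : Ω → ℝ}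
    (hWsum : W =ᵐ[P] fun ω => ∑ J, w J ω) {t : ℝ}
    (ht : t = ∫ ω, (∑ p : Finset (Fin n) × Finset (Fin n) with Disjoint p.1 p.2,
          w p.1 ω * w p.2 ω) ^ 2 ∂P) :
    ∫ ω, (W ω ^ 2 - (2 * d : ℝ)⁻¹ * numberOp P X (fun ω => W ω ^ 2) ω) ^ 2 ∂P
      ≤ ∫ ω, W ω ^ 4 ∂P - t ∧
    2 * d * t ≤ ∫ ω, W ω ^ 2 * numberOp P X (fun ω => W ω ^ 2) ω ∂P := by
  set v : Finset (Fin n) × Finset (Fin n) → Ω → ℝ := fun p ω => w p.1 ω * w p.2 ω with hv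
  have hv0 : ∀ p, ¬ (p.1.card = d ∧ p.2.card = d) → v p = fun _ => 0 := by
    intro p hc
    ext ω
    rcases not_and_or.1 hc with hc | hc
    · simp only [hv, h.eq_zero _ hc, Pi.zero_apply, zero_mul]
    · simp only [hv, h.eq_zero _ hc, Pi.zero_apply, mul_zero]
  have hvm : ∀ p, StronglyMeasurable[coordSigma X (p.1 ∪ p.2)] (v p) := fun p =>
    (h.stronglyMeasurable_of_subset (J := p.1) subset_union_left).mul
      (h.stronglyMeasurable_of_subset (J := p.2) subset_union_right)
  have hv2 : ∀ p, MemLp (v p) 2 P := fun p => memLp_two_mul (h.memLp _) (h.memLp _)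
  set T : Ω → ℝ := fun ω => ∑ p : Finset (Fin n) × Finset (Fin n) with Disjoint p.1 p.2, v p ω
    with hT
  set R : Ω → ℝ := fun ω => ∑ p : Finset (Fin n) × Finset (Fin n) with ¬ Disjoint p.1 p.2, v p ω
    with hR
  have hT2 : MemLp T 2 P := memLp_finsetSum _ fun p _ => hv2 p
  have hR2 : MemLp R 2 P := memLp_finsetSum _ fun p _ => hv2 p
  have hLT : numberOp P X T =ᵐ[P] fun ω => 2 * d * T ω := by
    filter_upwards [h.numberOp_sum_disjoint hX] with ω hω
    rw [hω]; push_cast; rfl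
  have hLR2 : MemLp (numberOp P X R) 2 P := memLp_numberOp one_le_two hR2
  have hY : (fun ω => W ω ^ 2) =ᵐ[P] fun ω => T ω + R ω := by
    filter_upwards [hWsum] with ω hω
    rw [hω, hT, hR, sum_filter_add_sum_filter_not, sq, sum_mul_sum, Fintype.sum_prod_type]
  have hLY : numberOp P X (fun ω => W ω ^ 2) =ᵐ[P] fun ω => 2 * d * T ω + numberOp P X R ω := by
    filter_upwards [numberOp_congr (X := X) hY, hLT,
      numberOp_add (X := X) (hT2.integrable one_le_two) (hR2.integrable one_le_two)]
      with ω h1 h2 h3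
    rw [h1, h3, h2]
  have hTR : ∫ ω, T ω * R ω ∂P = 0 := by
    have hint : ∀ p q : Finset (Fin n) × Finset (Fin n),
        Integrable (fun ω => v p ω * v q ω) P := fun p q => (hv2 p).integrable_mul (hv2 q)
    simp only [hT, hR, sum_mul_sum]
    rw [integral_finsetSum _ fun p _ => integrable_finsetSum _ fun q _ => hint p q]
    refine sum_eq_zero fun p hp => ?_
    rw [integral_finsetSum _ fun q _ => hint p q]
    exact sum_eq_zero fun q hq =>
      h.mixedMoment_eq_zero_of_not_disjoint hX (mem_filter.1 hp).2 (mem_filter.1 hq).2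
  have hTLR : ∫ ω, T ω * numberOp P X R ω ∂P = 0 := by
    rw [← integral_numberOp_mul_comm hX hT2 hR2]
    have : ∫ ω, numberOp P X T ω * R ω ∂P = ∫ ω, 2 * d * (T ω * R ω) ∂P :=
      integral_congr_ae (hLT.mono fun ω hω => by simp only [hω]; ring)
    rw [this, integral_const_mul, hTR, mul_zero]
  -- terms of the wrong order vanish, and get the empty index set
  have hb := numberOp_bounds hX hindep
    (univ.filter fun p : Finset (Fin n) × Finset (Fin n) => ¬ Disjoint p.1 p.2) v
    (fun p => if p.1.card = d ∧ p.2.card = d then p.1 ∪ p.2 else ∅) (D := 2 * d)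
    (fun p _ => by
      split_ifs with hc
      · have := card_union_le p.1 p.2
        omega
      · simp)
    (fun p _ => by
      by_cases hc : p.1.card = d ∧ p.2.card = d
      · rw [if_pos hc]
        exact hvm p
      · rw [hv0 p hc]
        exact stronglyMeasurable_const) hv2
  push_cast at hb
  have hd0 : (2 * d : ℝ) ≠ 0 := by positivity
  have iTT : Integrable (fun ω => T ω ^ 2) P := hT2.integrable_sq
  have iRR : Integrable (fun ω => R ω ^ 2) P := hR2.integrable_sq
  have iTR : Integrable (fun ω => T ω * R ω) P := hT2.integrable_mul hR2
  have iTL : Integrable (fun ω => T ω * numberOp P X R ω) P := hT2.integrable_mul hLR2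
  have iRL : Integrable (fun ω => R ω * numberOp P X R ω) P := hR2.integrable_mul hLR2
  constructor
  · have e1 : ∫ ω, (W ω ^ 2 - (2 * d : ℝ)⁻¹ * numberOp P X (fun ω => W ω ^ 2) ω) ^ 2 ∂P
        = ∫ ω, (R ω - (2 * d : ℝ)⁻¹ * numberOp P X R ω) ^ 2 ∂P := by
      refine integral_congr_ae ?_
      filter_upwards [hY, hLY] with ω h1 h2
      rw [h1, h2]
      congr 1
      field_simp
      ring
    have e2 : ∫ ω, W ω ^ 4 ∂P = ∫ ω, (T ω ^ 2 + 2 * (T ω * R ω) + R ω ^ 2) ∂P := by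
      refine integral_congr_ae ?_
      filter_upwards [hY] with ω h1
      have : W ω ^ 4 = (W ω ^ 2) ^ 2 := by ring
      rw [this, h1]; ring
    have i1 : Integrable (fun ω => T ω ^ 2 + 2 * (T ω * R ω)) P := iTT.add (iTR.const_mul 2)
    rw [integral_add i1 iRR, integral_add iTT (iTR.const_mul 2), integral_const_mul, hTR, ← ht]
      at e2
    rw [e1, e2]
    linarith [hb.2]
  · have e1 : ∫ ω, W ω ^ 2 * numberOp P X (fun ω => W ω ^ 2) ω ∂P
        = ∫ ω, (2 * d * T ω ^ 2 + T ω * numberOp P X R ω + 2 * d * (T ω * R ω)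
          + R ω * numberOp P X R ω) ∂P := by
      refine integral_congr_ae ?_
      filter_upwards [hY, hLY] with ω h1 h2
      rw [h1, h2]; ring
    have i1 : Integrable (fun ω => 2 * d * T ω ^ 2) P := iTT.const_mul _
    have i2 : Integrable (fun ω => 2 * d * T ω ^ 2 + T ω * numberOp P X R ω) P := i1.add iTL
    have i3 : Integrable (fun ω => 2 * d * (T ω * R ω)) P := iTR.const_mul _
    have i4 : Integrable (fun ω => 2 * d * T ω ^ 2 + T ω * numberOp P X R ω
      + 2 * d * (T ω * R ω)) P := i2.add i3
    rw [e1, integral_add i4 iRL, integral_add i2 i3, integral_add i1 iTL, integral_const_mul,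
      integral_const_mul, hTR, hTLR, ← ht]
    linarith [hb.1]

end IsDegenerateFamily

end SquareDecomposition

/-! ### Stein's bound for an eigenvector of the number operator -/

section SteinBound

open Finset Filter

variable {Ω : Type*} [mΩ : MeasurableSpace Ω] {P : Measure Ω} [IsProbabilityMeasure P]
  {n : ℕ} {E : Fin n → Type*} [∀ i, MeasurableSpace (E i)] {X : ∀ i, Ω → E i}

omit [IsProbabilityMeasure P] in
lemma sum_integral_mul_sub_condExp {A G : Ω → ℝ}
    (hi : ∀ i, Integrable (fun ω => A ω * (G ω - P[G | coordSigma X (univ.erase i)] ω)) P) :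
    ∑ i, ∫ ω, A ω * (G ω - P[G | coordSigma X (univ.erase i)] ω) ∂P
      = ∫ ω, A ω * numberOp P X G ω ∂P := by
  rw [← integral_finsetSum _ fun i _ => hi i]
  simp only [numberOp, mul_sum]

lemma integral_sub_const_mul_numberOp (hX : ∀ i, Measurable (X i)) {G : Ω → ℝ} (hG : MemLp G 2 P)
    (c : ℝ) : ∫ ω, (G ω - c * numberOp P X G ω) ∂P = ∫ ω, G ω ∂P := by
  have hGi := hG.integrable one_le_two
  rw [integral_sub hGi (((memLp_numberOp one_le_two hG).integrable one_le_two).const_mul c),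
    integral_const_mul, integral_numberOp hX hGi, mul_zero, sub_zero]

lemma sq_integral_le {G : Ω → ℝ} (hG : MemLp G 2 P) : (∫ ω, G ω ∂P) ^ 2 ≤ ∫ ω, G ω ^ 2 ∂P := by
  have := variance_nonneg G P
  rw [variance_eq_sub hG] at this
  exact sub_nonneg.1 this

/-- Cauchy–Schwarz for a variable `G` with mean `1`: the right-hand side is its standard
deviation. -/
lemma abs_integral_mul_one_sub_le {A G : Ω → ℝ} (hA : ∀ ω, |A ω| ≤ 1) (hG : MemLp G 2 P)
    (hG1 : ∫ ω, G ω ∂P = 1) :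
    |∫ ω, A ω * (1 - G ω) ∂P| ≤ √(∫ ω, G ω ^ 2 ∂P - 1) := by
  have h1G : MemLp (fun ω => |1 - G ω|) 2 P := ((memLp_const 1).sub hG).abs
  have hGi := hG.integrable one_le_two
  refine Real.le_sqrt_of_sq_le ?_
  have e1 : |∫ ω, A ω * (1 - G ω) ∂P| ≤ ∫ ω, |1 - G ω| ∂P := by
    rw [← Real.norm_eq_abs]
    refine norm_integral_le_of_norm_le (h1G.integrable one_le_two)
      (Eventually.of_forall fun ω => ?_)
    rw [norm_mul, Real.norm_eq_abs, Real.norm_eq_abs]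
    exact mul_le_of_le_one_left (abs_nonneg _) (hA ω)
  have e2 : (∫ ω, |1 - G ω| ∂P) ^ 2 ≤ ∫ ω, |1 - G ω| ^ 2 ∂P := sq_integral_le h1G
  have e3 : ∫ ω, |1 - G ω| ^ 2 ∂P = ∫ ω, G ω ^ 2 ∂P - 1 := by
    have e4 : ∀ ω, |1 - G ω| ^ 2 = G ω ^ 2 - (2 * G ω - 1) := fun ω => by rw [sq_abs]; ring
    simp only [e4]
    have hi : Integrable (fun ω => 2 * G ω - 1) P := (hGi.const_mul 2).sub (integrable_const 1)
    rw [integral_sub hG.integrable_sq hi,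
      integral_sub (hGi.const_mul 2) (integrable_const 1), integral_const_mul, hG1]
    simp; norm_num
  calc |∫ ω, A ω * (1 - G ω) ∂P| ^ 2 ≤ (∫ ω, |1 - G ω| ∂P) ^ 2 := by gcongr
    _ ≤ _ := e2.trans_eq e3

/-- Stein's bound for an eigenvector `W` of the number operator `L` with eigenvalue `d`. The
variable `Γ = W² - L(W²) / 2d` plays the role of the Stein kernel of `W`. Summed over the
coordinates, the second moments of the increments give `2d`, and `hB` bounds the sum of their
fourth moments. -/
lemma abs_stein_eigen_le (hX : ∀ i, Measurable (X i)) (hindep : iIndepFun X P)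
    {F : (∀ i, E i) → ℝ} (hF : Measurable F) {W : Ω → ℝ} (hW : W = fun ω => F (fun i => X i ω))
    (hW4 : MemLp W 4 P) (hvar : ∫ ω, W ω ^ 2 ∂P = 1) {d : ℝ} (hd : 0 < d)
    (hLW : numberOp P X W =ᵐ[P] fun ω => d * W ω) {v B : ℝ}
    (hv : ∫ ω, (W ω ^ 2 - (2 * d)⁻¹ * numberOp P X (fun ω => W ω ^ 2) ω) ^ 2 ∂P ≤ 1 + v)
    (hB : 8 * d * ∫ ω, W ω ^ 4 ∂P - 6 * ∫ ω, W ω ^ 2 * numberOp P X (fun ω => W ω ^ 2) ω ∂P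
      ≤ 4 * d * B)
    {f g : ℝ → ℝ} (hf : ∀ x, HasDerivAt f (g x) x) (hg : LipschitzWith 2 g)
    (hg1 : ∀ x, |g x| ≤ 1) :
    |∫ ω, (g (W ω) - W ω * f (W ω)) ∂P| ≤ √v + √2 / 2 * √B := by
  have hgc : Continuous g := hg.continuous
  have hY2 : MemLp (fun ω => W ω ^ 2) 2 P := memLp_two_sq hW4
  have hYi : Integrable (fun ω => W ω ^ 2) P := hY2.integrable one_le_two
  have hf4 : MemLp (fun ω => f (W ω)) 4 P := memLp_comp_of_deriv_le hf hg1 hW4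
  have h14 : (1 : ENNReal) ≤ 4 := by norm_num
  set Y : Ω → ℝ := fun ω => W ω ^ 2 with hY
  have hD4 : ∀ i : Fin n, MemLp (fun ω => W ω - P[W | coordSigma X (univ.erase i)] ω) 4 P :=
    fun i => hW4.sub (hW4.condExp h14)
  have hDY : ∀ i : Fin n, MemLp (fun ω => Y ω - P[Y | coordSigma X (univ.erase i)] ω) 2 P :=
    fun i => hY2.sub (hY2.condExp one_le_two)
  have hLY2 : MemLp (numberOp P X Y) 2 P := memLp_numberOp one_le_two hY2
  set Γ : Ω → ℝ := fun ω => Y ω - (2 * d)⁻¹ * numberOp P X Y ω with hΓ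
  have hΓ2 : MemLp Γ 2 P := hY2.sub (hLY2.const_mul _)
  have hΓ1 : ∫ ω, Γ ω ∂P = 1 := (integral_sub_const_mul_numberOp hX hY2 _).trans hvar
  -- integrability of the terms in the coordinatewise bound
  have i1 : ∀ i : Fin n, Integrable
      (fun ω => W ω * (W ω - P[W | coordSigma X (univ.erase i)] ω)) P :=
    fun i => integrable_mul_of_four hW4 (hD4 i)
  have i2 : ∀ i : Fin n, Integrable
      (fun ω => W ω ^ 3 * (W ω - P[W | coordSigma X (univ.erase i)] ω)) P := fun i =>
    (integrable_mul_mul_mul hW4 hW4 hW4 (hD4 i)).congr (Eventually.of_forall fun ω => by ring)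
  have i3 : ∀ i : Fin n, Integrable
      (fun ω => Y ω * (Y ω - P[Y | coordSigma X (univ.erase i)] ω)) P :=
    fun i => hY2.integrable_mul (hDY i)
  have i4 : ∀ i : Fin n, Integrable
      (fun ω => f (W ω) * (W ω - P[W | coordSigma X (univ.erase i)] ω)) P :=
    fun i => integrable_mul_of_four hf4 (hD4 i)
  have i5 : ∀ i : Fin n, Integrable
      (fun ω => g (W ω) * W ω * (W ω - P[W | coordSigma X (univ.erase i)] ω)) P := fun i =>
    (integrable_comp_mul hgc hg1 hW4 (i1 i)).congr (Eventually.of_forall fun ω => by ring)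
  have i6 : ∀ i : Fin n, Integrable
      (fun ω => g (W ω) * (Y ω - P[Y | coordSigma X (univ.erase i)] ω)) P := fun i =>
    integrable_comp_mul hgc hg1 hW4 ((hDY i).integrable one_le_two)
  have igY : Integrable (fun ω => g (W ω) * Y ω) P := integrable_comp_mul hgc hg1 hW4 hYi
  have igL : Integrable (fun ω => g (W ω) * numberOp P X Y ω) P :=
    integrable_comp_mul hgc hg1 hW4 (hLY2.integrable one_le_two)
  have igΓ : Integrable (fun ω => g (W ω) * Γ ω) P :=
    integrable_comp_mul hgc hg1 hW4 (hΓ2.integrable one_le_two)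
  -- summation over the coordinates
  have s1 : ∑ i : Fin n, 2 * ∫ ω, W ω * (W ω - P[W | coordSigma X (univ.erase i)] ω) ∂P
      = 2 * d := by
    have : ∫ ω, W ω * numberOp P X W ω ∂P = ∫ ω, d * W ω ^ 2 ∂P :=
      integral_congr_ae (hLW.mono fun ω hω => by simp only [hω]; ring)
    rw [← mul_sum, sum_integral_mul_sub_condExp i1, this, integral_const_mul, hvar, mul_one]
  have s2 : ∑ i : Fin n, (8 * ∫ ω, W ω ^ 3 * (W ω - P[W | coordSigma X (univ.erase i)] ω) ∂P
      - 6 * ∫ ω, W ω ^ 2 * (W ω ^ 2 - P[Y | coordSigma X (univ.erase i)] ω) ∂P)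
      = 8 * d * ∫ ω, W ω ^ 4 ∂P - 6 * ∫ ω, W ω ^ 2 * numberOp P X Y ω ∂P := by
    have : ∫ ω, W ω ^ 3 * numberOp P X W ω ∂P = ∫ ω, d * W ω ^ 4 ∂P :=
      integral_congr_ae (hLW.mono fun ω hω => by simp only [hω]; ring)
    rw [sum_sub_distrib, ← mul_sum, ← mul_sum, sum_integral_mul_sub_condExp i2,
      sum_integral_mul_sub_condExp i3, this, integral_const_mul, mul_assoc]
  have s3 : ∑ i : Fin n, 2 * ∫ ω, f (W ω) * (W ω - P[W | coordSigma X (univ.erase i)] ω) ∂P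
      = 2 * d * ∫ ω, W ω * f (W ω) ∂P := by
    have : ∫ ω, f (W ω) * numberOp P X W ω ∂P = ∫ ω, d * (W ω * f (W ω)) ∂P :=
      integral_congr_ae (hLW.mono fun ω hω => by simp only [hω]; ring)
    rw [← mul_sum, sum_integral_mul_sub_condExp i4, this, integral_const_mul, mul_assoc]
  have s4 : ∑ i : Fin n, ∫ ω, g (W ω) * (P[Y | coordSigma X (univ.erase i)] ω
      - 2 * W ω * P[W | coordSigma X (univ.erase i)] ω + W ω ^ 2) ∂P
      = 2 * d * ∫ ω, g (W ω) * Γ ω ∂P := by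
    have e1 : ∀ i : Fin n, ∫ ω, g (W ω) * (P[Y | coordSigma X (univ.erase i)] ω
        - 2 * W ω * P[W | coordSigma X (univ.erase i)] ω + W ω ^ 2) ∂P
        = 2 * ∫ ω, g (W ω) * W ω * (W ω - P[W | coordSigma X (univ.erase i)] ω) ∂P
          - ∫ ω, g (W ω) * (Y ω - P[Y | coordSigma X (univ.erase i)] ω) ∂P := by
      intro i
      rw [← integral_const_mul, ← integral_sub ((i5 i).const_mul 2) (i6 i)]
      refine integral_congr_ae (Eventually.of_forall fun ω => ?_)
      simp only [hY]; ring
    have e2 : ∫ ω, g (W ω) * W ω * numberOp P X W ω ∂P = ∫ ω, d * (g (W ω) * Y ω) ∂P :=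
      integral_congr_ae (hLW.mono fun ω hω => by simp only [hω, hY]; ring)
    have e3 : ∀ ω, g (W ω) * Γ ω = g (W ω) * Y ω - (2 * d)⁻¹ * (g (W ω) * numberOp P X Y ω) :=
      fun ω => by simp only [hΓ]; ring
    simp only [e1, e3]
    rw [sum_sub_distrib, ← mul_sum, sum_integral_mul_sub_condExp i5,
      sum_integral_mul_sub_condExp i6, e2, integral_const_mul,
      integral_sub igY (igL.const_mul _), integral_const_mul]
    field_simp
  -- the coordinatewise bounds, combined by the Cauchy–Schwarz inequality
  have key : |2 * d * ∫ ω, W ω * f (W ω) ∂P - 2 * d * ∫ ω, g (W ω) * Γ ω ∂P|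
      ≤ √(2 * d) * √(4 * d * B) / 2 := by
    have hc := fun i => abs_stein_coord_le hX hindep hF hW hW4 hf hg hg1 i
    rw [← s3, ← s4, ← sum_sub_distrib]
    refine (abs_sum_le_sum_abs _ _).trans ((sum_le_sum fun i _ => (hc i).2.2).trans ?_)
    rw [← sum_div]
    refine div_le_div_of_nonneg_right ?_ zero_le_two
    refine (Real.sum_sqrt_mul_sqrt_le _ (fun i => (hc i).1) fun i => (hc i).2.1).trans ?_
    rw [s1]
    refine mul_le_mul_of_nonneg_left (Real.sqrt_le_sqrt ?_) (Real.sqrt_nonneg _)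
    exact s2.trans_le hB
  have hroot : √(2 * d) * √(4 * d * B) / 2 = 2 * d * (√2 / 2 * √B) := by
    have : √(4 * d * B) = 2 * (√d * √B) := by
      rw [mul_assoc, Real.sqrt_mul (by norm_num), Real.sqrt_mul hd.le,
        show (4 : ℝ) = 2 ^ 2 by norm_num, Real.sqrt_sq zero_le_two]
    rw [this, Real.sqrt_mul zero_le_two]
    have hs := Real.mul_self_sqrt hd.le
    linear_combination (√2 * √B) * hs
  rw [hroot, ← mul_sub, abs_mul, abs_of_pos (by positivity : 0 < 2 * d)] at key
  have key' := le_of_mul_le_mul_left key (by positivity)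
  have hone := (abs_integral_mul_one_sub_le (A := fun ω => g (W ω)) (fun ω => hg1 _) hΓ2 hΓ1).trans
    (Real.sqrt_le_sqrt (show _ ≤ v by linarith))
  have ig : Integrable (fun ω => g (W ω)) P := by
    simpa using integrable_comp_mul hgc hg1 hW4 (integrable_const (1 : ℝ))
  have iWf : Integrable (fun ω => W ω * f (W ω)) P := integrable_mul_of_four hW4 hf4
  have hsplit : ∫ ω, (g (W ω) - W ω * f (W ω)) ∂P
      = ∫ ω, g (W ω) * (1 - Γ ω) ∂P
        - (∫ ω, W ω * f (W ω) ∂P - ∫ ω, g (W ω) * Γ ω ∂P) := by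
    simp only [mul_sub, mul_one]
    rw [integral_sub ig iWf, integral_sub ig igΓ]
    ring
  rw [hsplit]
  exact (abs_sub _ _).trans (add_le_add hone key')

end SteinBound

/-! ### The components of a degenerate `U`-statistic -/

section Components

open Finset Filter

variable {Ω : Type*} [mΩ : MeasurableSpace Ω] {P : Measure Ω} [IsProbabilityMeasure P]
  {n d : ℕ} {E : Fin n → Type*} [∀ i, MeasurableSpace (E i)] {X : ∀ i, Ω → E i}
  {W : Ω → ℝ} {WJ : Finset (Fin n) → Ω → ℝ}

/-- The components of a Hoeffding decomposition inherit the integrability of `W`: by inclusion and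
exclusion they are combinations of conditional expectations of `W`. -/
lemma IsHoeffdingDecomposition.memLp (hdec : IsHoeffdingDecomposition P X W WJ)
    (hX : ∀ i, Measurable (X i)) {p : ENNReal} (hp : 1 ≤ p) (hW : MemLp W p P)
    (J : Finset (Fin n)) : MemLp (WJ J) p P := by
  induction J using Finset.strongInduction with
  | H J ih =>
    have e1 : P[W | coordSigma X J] =ᵐ[P] ∑ K, P[WJ K | coordSigma X J] := by
      refine EventuallyEq.trans (condExp_congr_ae (hdec.ae_eq_sum.trans ?_))
        (condExp_finsetSum (fun K _ => hdec.integrable K) _)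
      exact Eventually.of_forall fun ω => (Finset.sum_apply ω _ _).symm
    have e2 : ∀ᵐ ω ∂P, ∀ K, P[WJ K | coordSigma X J] ω = if K ⊆ J then WJ K ω else 0 := by
      rw [ae_all_iff]
      intro K
      split_ifs with hK
      · rw [condExp_of_stronglyMeasurable (coordSigma_le hX J)
          ((hdec.measurable K).stronglyMeasurable.mono (coordSigma_mono hK)) (hdec.integrable K)]
        exact Eventually.of_forall fun _ => rfl
      · exact hdec.condExp_eq_zero K J hK
    have e3 : WJ J =ᵐ[P] fun ω => P[W | coordSigma X J] ω - ∑ K ∈ J.ssubsets, WJ K ω := by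
      filter_upwards [e1, e2] with ω h1 h2
      rw [h1, Finset.sum_apply]
      simp only [h2]
      rw [← sum_filter]
      have hs : (univ.filter fun K => K ⊆ J) = J.powerset := by ext; simp
      rw [hs, ← sum_erase_add _ _ (mem_powerset_self J)]
      simp [ssubsets]
    refine MemLp.ae_eq e3.symm ?_
    exact (hW.condExp hp).sub (memLp_finsetSum _ fun K hK => ih K (mem_ssubsets.1 hK))

lemma IsDegenerateUStatistic.isDegenerateFamily (hdeg : IsDegenerateUStatistic P X d W WJ)
    (hX : ∀ i, Measurable (X i)) (hW4 : MemLp W 4 P) :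
    IsDegenerateFamily P X d fun J => if J.card = d then WJ J else 0 where
  stronglyMeasurable J := by
    split_ifs
    · exact (hdeg.measurable J).stronglyMeasurable
    · exact stronglyMeasurable_zero
  memLp J := by
    split_ifs
    · exact hdeg.toIsHoeffdingDecomposition.memLp hX (by norm_num) hW4 J
    · exact MemLp.zero
  condExp_erase J i hi := by
    split_ifs
    · exact hdeg.condExp_eq_zero J _ fun h => notMem_erase i _ (h hi)
    · rw [condExp_zero]
  eq_zero J hJ := if_neg hJ

omit [IsProbabilityMeasure P] in
lemma IsDegenerateUStatistic.ae_eq_sum_ite (hdeg : IsDegenerateUStatistic P X d W WJ) :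
    W =ᵐ[P] fun ω => ∑ J : Finset (Fin n), (if J.card = d then WJ J else 0) ω := by
  have h : ∀ᵐ ω ∂P, ∀ J, WJ J ω = (if J.card = d then WJ J else 0) ω := by
    rw [ae_all_iff]
    intro J
    split_ifs with hJ
    · exact Eventually.of_forall fun _ => rfl
    · exact hdeg.ae_eq_zero J hJ
  filter_upwards [hdeg.ae_eq_sum, h] with ω h1 h2
  rw [h1]
  exact sum_congr rfl fun J _ => h2 J

/-- Components with nonempty index set are centred. -/
lemma IsHoeffdingDecomposition.variance_eq (hdec : IsHoeffdingDecomposition P X W WJ)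
    (hX : ∀ i, Measurable (X i)) {J : Finset (Fin n)} (hJ : J.Nonempty) :
    variance (WJ J) P = ∫ ω, WJ J ω ^ 2 ∂P := by
  refine variance_of_integral_eq_zero (hdec.integrable J).aestronglyMeasurable.aemeasurable ?_
  rw [← integral_condExp (coordSigma_le hX ∅)]
  exact integral_eq_zero_of_ae
    (hdec.condExp_eq_zero J ∅ fun h => hJ.ne_empty (subset_empty.1 h))

lemma IsDegenerateUStatistic.sum_secondMoment_le_maxInfluence
    (hdeg : IsDegenerateUStatistic P X d W WJ) (hX : ∀ i, Measurable (X i)) (i : Fin n) :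
    ∑ K : Finset (Fin n) with i ∈ K,
      secondMoment P (fun J => if J.card = d then WJ J else 0) K ≤ maxInfluence P d WJ := by
  have e : ∑ K : Finset (Fin n) with i ∈ K,
      secondMoment P (fun J => if J.card = d then WJ J else 0) K
      = ∑ K : Finset (Fin n) with K.card = d ∧ i ∈ K, variance (WJ K) P := by
    have hf : (univ.filter fun K : Finset (Fin n) => K.card = d ∧ i ∈ K)
        = (univ.filter fun K : Finset (Fin n) => i ∈ K).filter fun K => K.card = d := by
      ext; simp [and_comm]
    rw [hf, sum_filter (fun K : Finset (Fin n) => K.card = d)]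
    refine sum_congr rfl fun K hK => ?_
    simp only [secondMoment]
    by_cases hc : K.card = d
    · simp only [hc, if_true]
      exact (hdeg.toIsHoeffdingDecomposition.variance_eq hX ⟨i, (mem_filter.1 hK).2⟩).symm
    · simp [hc]
  rw [e]
  exact le_ciSup (f := fun i : Fin n =>
    ∑ K : Finset (Fin n) with K.card = d ∧ i ∈ K, variance (WJ K) P)
    (Set.finite_range _).bddAbove i

omit [IsProbabilityMeasure P] in
lemma maxInfluence_nonneg : 0 ≤ maxInfluence P d WJ :=
  Real.iSup_nonneg fun _ => sum_nonneg fun _ _ => variance_nonneg _ _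

end Components

/-! ### Numerical constants -/

section Constants

/-- The bound with coefficients `1` and `√2 / 2` that the exchangeable pair yields is better than
the one with `√(2 / π)` and `2 √2 / 3`, because the second root is at least `√2` times the first. -/
lemma stein_bound_le_of_kernel_bound {x y : ℝ} (hy : 0 ≤ y) :
    √(x + y) + √2 / 2 * √(2 * x + 3 * y)
      ≤ √(2 / Real.pi) * √(x + y) + 2 * √2 / 3 * √(2 * x + 3 * y) := by
  have h1 : √2 * √(x + y) ≤ √(2 * x + 3 * y) := by
    rw [← Real.sqrt_mul zero_le_two]
    exact Real.sqrt_le_sqrt (by linarith)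
  have h2 : (2 / 3 : ℝ) ≤ √(2 / Real.pi) := by
    refine Real.le_sqrt_of_sq_le ?_
    rw [le_div_iff₀ Real.pi_pos]
    have := Real.pi_le_four
    nlinarith
  have h3 : √2 * √2 = 2 := Real.mul_self_sqrt zero_le_two
  have h4 := mul_le_mul_of_nonneg_left h1 (Real.sqrt_nonneg 2)
  have h5 := mul_le_mul_of_nonneg_right h2 (Real.sqrt_nonneg (x + y))
  rw [← mul_assoc, h3] at h4
  linarith

lemma stein_bound_le_abs {x κ r : ℝ} (hκ : 0 ≤ κ) (hr : 0 ≤ r) :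
    √(2 / Real.pi) * √(x + κ * r) + 2 * √2 / 3 * √(2 * x + 3 * κ * r)
      ≤ (√(2 / Real.pi) + 4 / 3) * √|x| + √κ * (√(2 / Real.pi) + 2 * √2 / √3) * √r := by
  have hadd : ∀ {a b : ℝ}, 0 ≤ a → 0 ≤ b → √(a + b) ≤ √a + √b := fun {a b} ha hb =>
    Real.sqrt_le_iff.2 ⟨by positivity, by
      have h1 := Real.sq_sqrt ha
      have h2 := Real.sq_sqrt hb
      nlinarith [mul_nonneg (Real.sqrt_nonneg a) (Real.sqrt_nonneg b)]⟩
  have h1 : √(x + κ * r) ≤ √|x| + √κ * √r := by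
    rw [← Real.sqrt_mul hκ]
    exact (Real.sqrt_le_sqrt (by linarith [le_abs_self x])).trans
      (hadd (abs_nonneg x) (by positivity))
  have h2 : √(2 * x + 3 * κ * r) ≤ √2 * √|x| + √3 * (√κ * √r) := by
    rw [← Real.sqrt_mul hκ, ← Real.sqrt_mul zero_le_two, ← Real.sqrt_mul zero_le_three]
    exact (Real.sqrt_le_sqrt (by linarith [le_abs_self x])).trans
      (hadd (by positivity) (by positivity))
  have h3 : √2 * √2 = 2 := Real.mul_self_sqrt zero_le_two
  have h4 : √3 / 3 = 1 / √3 := Real.sqrt_div_self'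
  calc _ ≤ √(2 / Real.pi) * (√|x| + √κ * √r)
        + 2 * √2 / 3 * (√2 * √|x| + √3 * (√κ * √r)) := by gcongr
    _ = _ := by
      linear_combination (2 / 3 * √|x|) * h3 + (2 * √2 * √κ * √r) * h4

end Constants

/-! ### The quantitative fourth moment theorem -/

lemma constC_nonneg (d : ℕ) : 0 ≤ constC d :=
  mul_nonneg (by positivity)
    (Finset.sum_nonneg fun _ _ => Finset.sum_nonneg fun _ _ => by positivity)

theorem theorem1p2
    {Ω : Type*} [MeasurableSpace Ω] (P : Measure Ω) [IsProbabilityMeasure P]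
    {Ω' : Type*} [MeasurableSpace Ω'] (Q : Measure Ω') [IsProbabilityMeasure Q]
    {n d : ℕ} (hd : 1 ≤ d) (hdn : d ≤ n)
    {E : Fin n → Type*} [∀ i, MeasurableSpace (E i)]
    (X : ∀ i, Ω → E i) (hX : ∀ i, Measurable (X i)) (hindep : iIndepFun X P)
    (f : (∀ i, E i) → ℝ) (hf : Measurable f)
    (W : Ω → ℝ) (hW : W = fun ω => f (fun i => X i ω))
    (hW4 : MemLp W 4 P) (hmean : ∫ ω, W ω ∂P = 0) (hvar : ∫ ω, W ω ^ 2 ∂P = 1)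
    (WJ : Finset (Fin n) → Ω → ℝ) (hdeg : IsDegenerateUStatistic P X d W WJ)
    (Z : Ω' → ℝ) (hZ : HasLaw Z (gaussianReal 0 1) Q) :
    0 ≤ (∫ ω, W ω ^ 4 ∂P) - 3 + constKappa d * maxInfluence P d WJ ∧
    0 ≤ 2 * ((∫ ω, W ω ^ 4 ∂P) - 3) + 3 * constKappa d * maxInfluence P d WJ ∧
    wassersteinDist P W Q Z ≤ ENNReal.ofReal
      (√(2 / Real.pi) * √((∫ ω, W ω ^ 4 ∂P) - 3 + constKappa d * maxInfluence P d WJ)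
        + 2 * √2 / 3 *
          √(2 * ((∫ ω, W ω ^ 4 ∂P) - 3) + 3 * constKappa d * maxInfluence P d WJ)) ∧
    √(2 / Real.pi) * √((∫ ω, W ω ^ 4 ∂P) - 3 + constKappa d * maxInfluence P d WJ)
        + 2 * √2 / 3 *
          √(2 * ((∫ ω, W ω ^ 4 ∂P) - 3) + 3 * constKappa d * maxInfluence P d WJ)
      ≤ (√(2 / Real.pi) + 4 / 3) * √|(∫ ω, W ω ^ 4 ∂P) - 3|
        + √(constKappa d) * (√(2 / Real.pi) + 2 * √2 / √3) * √(maxInfluence P d WJ) := by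
  have hfam := hdeg.isDegenerateFamily hX hW4
  set w : Finset (Fin n) → Ω → ℝ := fun J => if J.card = d then WJ J else 0
  have hsum : W =ᵐ[P] fun ω => ∑ J, w J ω := hdeg.ae_eq_sum_ite
  have hr := hdeg.sum_secondMoment_le_maxInfluence hX
  have hr0 : 0 ≤ maxInfluence P d WJ := maxInfluence_nonneg
  set r := maxInfluence P d WJ with hr_def
  set κ := constKappa d with hκ
  have hκ0 : 0 ≤ κ := add_nonneg (constC_nonneg d) (by positivity)
  have hκr : 0 ≤ κ * r := mul_nonneg hκ0 hr0
  have hone : ∑ J, secondMoment P w J = 1 := by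
    rw [hfam.sum_secondMoment hX, ← hvar]
    exact integral_congr_ae (hsum.mono fun ω hω => by simp only [hω])
  set t := ∫ ω, (∑ p : Finset (Fin n) × Finset (Fin n) with Disjoint p.1 p.2,
          w p.1 ω * w p.2 ω) ^ 2 ∂P with ht
  -- the constant enters only through this lower bound
  have ht2 : 2 - κ * r ≤ t := by
    refine le_trans ?_ (hfam.two_sub_le_integral_sq hX hindep hd hone hr)
    have hc := mul_le_mul_of_nonneg_right (le_constC hd) hr0
    rw [hκ, constKappa]
    linarith
  obtain ⟨hb1, hb2⟩ := hfam.square_bounds hX hindep hd hsum ht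
  set M := ∫ ω, W ω ^ 4 ∂P with hM
  have hd0 : (0 : ℝ) < d := by exact_mod_cast hd
  have hY2 : MemLp (fun ω => W ω ^ 2) 2 P := memLp_two_sq hW4
  -- the kernel `W² - L(W²) / 2d` has mean `1`, hence second moment at least `1`
  have hv : 0 ≤ M - 3 + κ * r := by
    have h1 := sq_integral_le
      (hY2.sub ((memLp_numberOp (X := X) one_le_two hY2).const_mul (2 * d : ℝ)⁻¹))
    have h2 := integral_sub_const_mul_numberOp hX hY2 (2 * d : ℝ)⁻¹
    rw [hvar] at h2
    have h3 : (1 : ℝ) ^ 2 ≤ M - t := by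
      rw [← h2]
      exact h1.trans hb1
    linarith
  refine ⟨hv, by linarith, ?_, stein_bound_le_abs hκ0 hr0⟩
  refine iSup₂_le fun h hh => ENNReal.ofReal_le_ofReal ?_
  obtain ⟨F, g, hF, hst, hg1, hg⟩ := SteinEquation.exists_solution hh
  have hLW : numberOp P X W =ᵐ[P] fun ω => d * W ω := by
    filter_upwards [numberOp_congr (X := X) hsum, hfam.numberOp_sum hX, hsum] with ω h1 h2 h3
    rw [h1, h2, h3]
  have key := abs_stein_eigen_le hX hindep hf hW hW4 hvar hd0 hLW
    (v := M - 3 + κ * r) (B := 2 * (M - 3) + 3 * κ * r) (by linarith)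
    (by
      have := mul_le_mul_of_nonneg_left ht2 hd0.le
      nlinarith) hF hg hg1
  have hZint : ∫ ω, h (Z ω) ∂Q = ∫ y, h y ∂(gaussianReal 0 1) :=
    hZ.integral_comp hh.continuous.aestronglyMeasurable
  have hgi : Integrable (fun ω => g (W ω)) P := by
    simpa using integrable_comp_mul hg.continuous hg1 hW4 (integrable_const (1 : ℝ))
  have hFi : Integrable (fun ω => W ω * F (W ω)) P :=
    integrable_mul_of_four hW4 (memLp_comp_of_deriv_le hF hg1 hW4)
  have hgF : Integrable (fun ω => g (W ω) - W ω * F (W ω)) P := hgi.sub hFi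
  have hWint : ∫ ω, h (W ω) ∂P - ∫ ω, h (Z ω) ∂Q = ∫ ω, (g (W ω) - W ω * F (W ω)) ∂P := by
    have e : ∀ ω, h (W ω) = (g (W ω) - W ω * F (W ω)) + ∫ y, h y ∂(gaussianReal 0 1) :=
      fun ω => by rw [hst]; ring
    simp only [e]
    rw [integral_add hgF (integrable_const _), hZint]
    simp
  rw [hWint]
  have hfin := stein_bound_le_of_kernel_bound (x := M - 3) hκr
  rw [← mul_assoc 3 κ r] at hfin
  exact key.trans hfin
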